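/- Let $F$ be a local field: a non-archimedean local field, $\mathbb R$ or $\mathbb C$ (for instance the completion of a number field at any place). Let $|x|$ be its module, defined by $d(tx)=|t|\,dx$ for additive Haar measures $dx$, with $|0|=0$ (so $|z|=z\bar z$ on $\mathbb C$). Let $\mathcal S$ be the space of Schwartz–Bruhat functions on $F$ and $\mathcal S_0\subset\mathcal S$ the subspace of those with compact support that vanish identically in a neighbourhood of $0$. Fix a non-trivial continuous unitary additive character $\lambda$ of $F$ (for instance the standard one $\exp(2\pi i\{\mathrm{Sp}(x)\})$). There is a unique additive Haar measure $dx$ such that $\mathcal F\varphi(y)=\int_F\varphi(x)\lambda(-yx)\,dx$ satisfies $\mathcal F\mathcal F\varphi(x)=\varphi(-x)$ for all $\varphi\in\mathcal S$; let $L^2=L^2(F,dx)$. Let $A$ be multiplication by $\log|x|$, let $B=\mathcal F A\mathcal F^{-1}$ and let $K=i[B,A]=i(BA-AB)$, with initial domain $\mathcal S_0$. **Theorem E3.** $A\mathcal S_0\subset\mathcal S_0$, the integrals defining $B$ on $\mathcal S$ converge absolutely, and $K$ is a well-defined linear operator from $\mathcal S_0$ to $L^2$. Moreover: 1. $(K,\mathcal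 S_0)$ is essentially self-adjoint: it is densely defined and closable and its closure is self-adjoint. 2. It is bounded: its closure, again denoted $K$, is a bounded operator defined on all of $L^2$. 3. For every $t\in F^\times$, the map $(U(t)f)(x)=|t|^{-1/2}f(x/t)$ is unitary on $L^2$ and $KU(t)=U(t)K$. The Fourier transform $\mathcal F$ extends from $\mathcal S$ to a unitary operator on $L^2$, and $K\mathcal F=-\mathcal F K$. The inversion $(If)(x)=|x|^{-1}f(1/x)$ is unitary on $L^2$, and $KI=-IK$. 4. For every continuous unitary character $\chi$ of $F^\times$ there is a function $s\mapsto\Gamma(\chi,s)$, holomorphic and without zeros in the strip $0<\mathrm{Re}(s)<1$, such that there, for all $\alpha\in\mathcal S$, $$\int_F\mathcal F\alpha(y)\,\chi(y)|y|^{s-1}\,dy=\Gamma(\chi,s)\int_F\alpha(x)\,\chi^{-1}(x)|x|^{-s}\,dx$$ (both integrals converging absolutely). With $$K(\chi,s)=-i\,\frac{\partial^2}{\partial s^2}\log\Gamma(\chi,s)=-i\,\frac{\partial}{\partial s}\frac{\Gamma'(\chi,s)}{\Gamma(\chi,s)},$$ the identity $K(\chi^{-1}|x|^{-s})=K(\chi,s)\,\chi^{-1}|x|^{-s}$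 holds in the sense of distributions on $F\setminus\{0\}$: for all $\varphi\in\mathcal S_0$, all $\chi$ and $0<\mathrm{Re}(s)<1$, $$\int_F\overline{K\varphi(x)}\,\chi^{-1}(x)|x|^{-s}\,dx=K(\chi,s)\int_F\overline{\varphi(x)}\,\chi^{-1}(x)|x|^{-s}\,dx,$$ the left integral converging absolutely. Finally, $K(\chi,s)$ is bounded on the critical line $\mathrm{Re}(s)=\tfrac12$, uniformly in $\chi$. -/

import Mathlib

open MeasureTheory Topology ComplexConjugate
open scoped SchwartzMap

noncomputable section

namespace CommutatorOperator

/-! ### Test functions -/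

/-- `IsSchwartzBruhatSpace F 𝒮` says that `F` is a local field (a non-archimedean one, `ℝ` or `ℂ`)
and that `𝒮` is the space of Schwartz-Bruhat functions on it: the locally constant functions with
compact support in the non-archimedean case, the Schwartz functions on `ℝ` or `ℂ`. A non-archimedean
local field is a locally compact field whose topology comes from a nontrivial ultrametric absolute
value (for instance the completion of a number field at a finite place). -/
inductive IsSchwartzBruhatSpace :
    (F : Type) → [Field F] → [TopologicalSpace F] → Set (F → ℂ) → Prop
  | nonarchimedean (F : Type) [NontriviallyNormedField F] [IsUltrametricDist F]
      [LocallyCompactSpace F] :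
      IsSchwartzBruhatSpace F {φ : F → ℂ | IsLocallyConstant φ ∧ HasCompactSupport φ}
  | real : IsSchwartzBruhatSpace ℝ {φ : ℝ → ℂ | ∃ f : 𝓢(ℝ, ℂ), φ = f}
  | complex : IsSchwartzBruhatSpace ℂ {φ : ℂ → ℂ | ∃ f : 𝓢(ℂ, ℂ), φ = f}

/-- The functions of `𝒮` which have compact support and vanish identically near the origin. -/
def puncturedTestFunctions {F : Type} [Field F] [TopologicalSpace F] (𝒮 : Set (F → ℂ)) :
    Set (F → ℂ) :=
  {φ | φ ∈ 𝒮 ∧ HasCompactSupport φ ∧ ∀ᶠ x in 𝓝 (0 : F), φ x = 0}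

section LocalField

variable {F : Type} [Field F] [TopologicalSpace F]

section Module

variable [IsTopologicalRing F] [LocallyCompactSpace F]

open Classical in
/-- The module `|x|` of `x`: the factor in `d(tx) = |t| dx` for every additive Haar measure `dx`,
and `|0| = 0`. It is the usual absolute value on `ℝ`, and `z * conj z` on `ℂ`. -/
def modulus (x : F) : ℝ :=
  if h : x = 0 then 0 else (distribHaarChar F (Units.mk0 x h) : ℝ)

open Classical in
/-- The function `x ↦ χ(x) |x|^s` on the nonzero elements (with value `0` at `0`). -/
def quasiChar (χ : Fˣ →ₜ* Circle) (s : ℂ) (x : F) : ℂ :=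
  if h : x = 0 then 0 else (χ (Units.mk0 x h) : ℂ) * (modulus x : ℂ) ^ s

/-- The dilation `φ ↦ |t|^{-1/2} φ(x/t)`. -/
def dilation (t : Fˣ) (φ : F → ℂ) (x : F) : ℂ :=
  ((Real.sqrt (modulus (t : F)))⁻¹ : ℂ) * φ (x / t)

/-- The inversion `φ ↦ |x|⁻¹ φ(1/x)`. -/
def inversion (φ : F → ℂ) (x : F) : ℂ :=
  ((modulus x)⁻¹ : ℂ) * φ x⁻¹

/-- The operator `A`: multiplication by `log |x|`. -/
def opA (φ : F → ℂ) (x : F) : ℂ := (Real.log (modulus x) : ℂ) * φ x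

end Module

variable [MeasurableSpace F] (ψ : AddChar F Circle) (μ : Measure F)

/-- The Fourier transform `y ↦ ∫ φ(x) ψ(-yx) dx`. -/
def fourier (φ : F → ℂ) : F → ℂ := Fourier.fourierIntegral ψ μ φ

/-- The inverse Fourier transform `x ↦ ∫ φ(y) ψ(yx) dy`. -/
def fourierInv (φ : F → ℂ) (x : F) : ℂ := Fourier.fourierIntegral ψ μ φ (-x)

/-- `μ` is the additive Haar measure that is self-dual for `ψ`: applying the Fourier transform
twice to a Schwartz-Bruhat function `φ` gives `x ↦ φ(-x)`. -/
def IsSelfDualMeasure (𝒮 : Set (F → ℂ)) : Prop :=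
  μ.IsAddHaarMeasure ∧ ∀ φ ∈ 𝒮, ∀ x, fourier ψ μ (fourier ψ μ φ) x = φ (-x)

variable [IsTopologicalRing F] [LocallyCompactSpace F]

/-- The operator `B = ℱ A ℱ⁻¹`. -/
def opB (φ : F → ℂ) : F → ℂ := fourier ψ μ (opA (fourierInv ψ μ φ))

/-- The commutator `K = i [B, A]` on functions. -/
def opK (φ : F → ℂ) (x : F) : ℂ :=
  Complex.I * (opB ψ μ (opA φ) x - opA (opB ψ μ φ) x)

/-- `T` is the commutator operator `K` as an operator in `L²(F, μ)`, with domain the (classes of)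
functions of `𝒮` with compact support which vanish near the origin. This determines `T`. -/
def IsCommutatorOperator (𝒮 : Set (F → ℂ)) (T : Lp ℂ 2 μ →ₗ.[ℂ] Lp ℂ 2 μ) : Prop :=
  (∀ f : Lp ℂ 2 μ, f ∈ T.domain ↔ ∃ φ ∈ puncturedTestFunctions 𝒮, f =ᵐ[μ] φ) ∧
  ∀ f : T.domain, ∀ φ ∈ puncturedTestFunctions 𝒮, (f : Lp ℂ 2 μ) =ᵐ[μ] φ → T f =ᵐ[μ] opK ψ μ φ

/-- The open critical strip. -/
def criticalStrip : Set ℂ := {s | 0 < s.re ∧ s.re < 1}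

/-- `Γ` is the Tate-Gel'fand-Graev Gamma function `s ↦ Γ(χ, s)` of the unitary character `χ` in
the critical strip: the Fourier transform of the distribution `χ(y)|y|^{s-1}` is
`Γ(χ, s) χ⁻¹(x)|x|^{-s}`. -/
def IsTateGamma (𝒮 : Set (F → ℂ)) (χ : Fˣ →ₜ* Circle) (Γ : ℂ → ℂ) : Prop :=
  ∀ s ∈ criticalStrip, ∀ α ∈ 𝒮,
    Integrable (fun y => fourier ψ μ α y * quasiChar χ (s - 1) y) μ ∧
    Integrable (fun x => α x * quasiChar χ⁻¹ (-s) x) μ ∧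
    ∫ y, fourier ψ μ α y * quasiChar χ (s - 1) y ∂μ =
      Γ s * ∫ x, α x * quasiChar χ⁻¹ (-s) x ∂μ

end LocalField

/-- `-i ∂²/∂s² log Γ(s)`, where `∂/∂s log Γ` is the logarithmic derivative `Γ'/Γ`. -/
def spectralFunction (Γ : ℂ → ℂ) (s : ℂ) : ℂ := -Complex.I * deriv (logDeriv Γ) s

/-- A (densely defined, closable) operator is essentially self-adjoint when its closure is
self-adjoint. -/
def IsEssentiallySelfAdjoint {H : Type*} [NormedAddCommGroup H] [InnerProductSpace ℂ H]
    [CompleteSpace H] (T : H →ₗ.[ℂ] H) : Prop :=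
  Dense (T.domain : Set H) ∧ T.IsClosable ∧ IsSelfAdjoint T.closure

end CommutatorOperator

end

/-!
The distribution `log |x|` changes by a constant under dilations, so its Fourier transform is, on
test functions vanishing at the origin, a real multiple `c` of the measure `d×x = dx / |x|`. Hence
`B = ℱ A ℱ⁻¹` is the convolution with a regularization of `c / |x|`, and the commutator
`i (B A - A B)` has the kernel `i c (log |y| - log |x|) / |x - y|`. Writing `y = x / t`, this says
that `K = ∫ κ(t) U(t) d×t` with `κ(t) = -i c log |t| |t|^{1/2} / |1 - t|`, which is integrable for
`d×t` because `log |t|` vanishes where `|1 - t|⁻¹` blows up. So `K` is bounded, and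
`κ(t⁻¹) = -κ(t) = conj κ(t)` gives the self-adjointness as well as the (anti)commutation with the
dilations, `ℱ` and `I`. Since the Mellin transform turns `A` into `∂/∂s`, differentiating Tate's
local functional equation twice identifies the eigenvalue of `K` on `χ⁻¹ |x|^{-s}`; on the critical
line this eigenvalue is bounded by a multiple of the `L¹` norm of `κ`.
-/

noncomputable section

namespace CommutatorOperator

section Modulus

variable {F : Type} [Field F] [TopologicalSpace F] [IsTopologicalRing F] [LocallyCompactSpace F]

@[simp] lemma modulus_zero : modulus (0 : F) = 0 := by simp [modulus]

lemma modulus_of_ne_zero {x : F} (hx : x ≠ 0) :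
    modulus x = (distribHaarChar F (Units.mk0 x hx) : ℝ) := by simp [modulus, hx]

lemma modulus_pos {x : F} (hx : x ≠ 0) : 0 < modulus x := by
  rw [modulus_of_ne_zero hx]
  exact_mod_cast distribHaarChar_pos

lemma modulus_ne_zero {x : F} (hx : x ≠ 0) : modulus x ≠ 0 := (modulus_pos hx).ne'

lemma modulus_nonneg (x : F) : 0 ≤ modulus x := by
  rcases eq_or_ne x 0 with rfl | hx
  · exact modulus_zero.ge
  · exact (modulus_pos hx).le

@[simp] lemma modulus_one : modulus (1 : F) = 1 := by
  rw [modulus_of_ne_zero one_ne_zero]; simp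

@[simp] lemma modulus_mul (x y : F) : modulus (x * y) = modulus x * modulus y := by
  rcases eq_or_ne x 0 with rfl | hx
  · simp
  rcases eq_or_ne y 0 with rfl | hy
  · simp
  rw [modulus_of_ne_zero hx, modulus_of_ne_zero hy, modulus_of_ne_zero (mul_ne_zero hx hy),
    ← NNReal.coe_mul, ← map_mul, Units.mk0_mul]

variable (F) in
/-- The module `x ↦ |x|` as a homomorphism of monoids with zero. -/
def modulusHom : F →*₀ ℝ where
  toFun := modulus
  map_zero' := modulus_zero
  map_one' := modulus_one
  map_mul' := modulus_mul

@[simp] lemma modulus_inv (x : F) : modulus x⁻¹ = (modulus x)⁻¹ := map_inv₀ (modulusHom F) x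

@[simp] lemma modulus_div (x y : F) : modulus (x / y) = modulus x / modulus y :=
  map_div₀ (modulusHom F) x y

@[simp] lemma modulus_pow (x : F) (n : ℕ) : modulus (x ^ n) = modulus x ^ n :=
  map_pow (modulusHom F) x n

@[simp] lemma modulus_neg (x : F) : modulus (-x) = modulus x := by
  have neg_one_sq : modulus (-1 : F) * modulus (-1 : F) = 1 := by rw [← modulus_mul]; simp
  have neg_one_eq : modulus (-1 : F) = 1 := by nlinarith [modulus_nonneg (-1 : F)]
  rw [← neg_one_mul, modulus_mul, neg_one_eq, one_mul]

lemma modulus_sub_comm (x y : F) : modulus (x - y) = modulus (y - x) := by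
  rw [← neg_sub, modulus_neg]

end Modulus

section MeasureScaling

lemma measurableEmbedding_mul_left {F : Type*} [Field F] [TopologicalSpace F]
    [IsTopologicalRing F] [MeasurableSpace F] [BorelSpace F] {t : F} (ht : t ≠ 0) :
    MeasurableEmbedding (fun x => t * x) :=
  (Homeomorph.mulLeft₀ t ht).measurableEmbedding

variable {F : Type} [NontriviallyNormedField F] [ProperSpace F] [MeasurableSpace F] [BorelSpace F]
  {E : Type*} [NormedAddCommGroup E] (μ : Measure F) [μ.IsAddHaarMeasure]

lemma measure_image_mul_left {t : F} (ht : t ≠ 0) (s : Set F) :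
    μ ((fun x => t * x) '' s) = ENNReal.ofReal (modulus t) * μ s := by
  rw [modulus_of_ne_zero ht, ENNReal.ofReal_coe_nnreal, distribHaarChar_mul]
  rfl

lemma map_mul_left_eq_smul {t : F} (ht : t ≠ 0) :
    μ.map (fun x => t * x) = ENNReal.ofReal (modulus t)⁻¹ • μ := by
  ext s -
  rw [(measurableEmbedding_mul_left ht).map_apply, Measure.smul_apply, smul_eq_mul, ← modulus_inv,
    ← measure_image_mul_left μ (inv_ne_zero ht)]
  exact congrArg μ ((Homeomorph.mulLeft₀ t ht).toEquiv.image_symm_eq_preimage s).symm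

lemma lintegral_comp_mul_left {t : F} (ht : t ≠ 0) (f : F → ENNReal) :
    ∫⁻ x, f (t * x) ∂μ = ENNReal.ofReal (modulus t)⁻¹ * ∫⁻ x, f x ∂μ := by
  rw [← (measurableEmbedding_mul_left ht).lintegral_map, map_mul_left_eq_smul μ ht,
    lintegral_smul_measure, smul_eq_mul]

lemma integral_comp_mul_left [NormedSpace ℝ E] {t : F} (ht : t ≠ 0) (f : F → E) :
    ∫ x, f (t * x) ∂μ = (modulus t)⁻¹ • ∫ x, f x ∂μ := by
  rw [← (measurableEmbedding_mul_left ht).integral_map, map_mul_left_eq_smul μ ht,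
    integral_smul_measure, ENNReal.toReal_ofReal (inv_nonneg.2 (modulus_nonneg t))]

lemma integrable_comp_mul_left {t : F} (ht : t ≠ 0) {f : F → E} :
    Integrable (fun x => f (t * x)) μ ↔ Integrable f μ := by
  rw [← Function.comp_def f, ← (measurableEmbedding_mul_left ht).integrable_map_iff,
    map_mul_left_eq_smul μ ht, integrable_smul_measure _ ENNReal.ofReal_ne_top]
  exact (ENNReal.ofReal_pos.2 (inv_pos.2 (modulus_pos ht))).ne'

lemma measure_singleton_zero : μ {(0 : F)} = 0 := by
  have : (𝓝[≠] (0 : F)).NeBot := inferInstance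
  exact measure_singleton 0

lemma modulus_mul_measure_closedBall (t : F) :
    ENNReal.ofReal (modulus t) * μ (Metric.closedBall 0 1) = μ (Metric.closedBall 0 ‖t‖) := by
  rcases eq_or_ne t 0 with rfl | ht
  · simp [measure_singleton_zero μ]
  · rw [← measure_image_mul_left μ ht]
    congr 1
    exact (smul_closedBall' ht (0 : F) 1).trans (by rw [smul_zero, mul_one])

end MeasureScaling

section ModulusTopology

variable {F : Type} [NontriviallyNormedField F] [ProperSpace F]

lemma modulus_le_of_norm_le {x y : F} (h : ‖x‖ ≤ ‖y‖) : modulus x ≤ modulus y := by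
  borelize F
  have hle := measure_mono (μ := (Measure.addHaar : Measure F))
    (Metric.closedBall_subset_closedBall (x := 0) h)
  rw [← modulus_mul_measure_closedBall, ← modulus_mul_measure_closedBall,
    ENNReal.mul_le_mul_iff_left (Metric.measure_closedBall_pos _ 0 one_pos).ne'
      (isCompact_closedBall (0 : F) 1).measure_lt_top.ne] at hle
  exact (ENNReal.ofReal_le_ofReal_iff (modulus_nonneg y)).1 hle

lemma modulus_le_one {t : F} (ht : ‖t‖ ≤ 1) : modulus t ≤ 1 := by
  simpa using modulus_le_of_norm_le (y := (1 : F)) (by simpa using ht)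

lemma continuousAt_modulus_zero : ContinuousAt (modulus : F → ℝ) 0 := by
  borelize F
  let μ : Measure F := Measure.addHaar
  have hpos : 0 < μ.real (Metric.closedBall 0 1) :=
    ENNReal.toReal_pos (Metric.measure_closedBall_pos μ 0 one_pos).ne'
      (isCompact_closedBall (0 : F) 1).measure_lt_top.ne
  have hmodulus (t : F) :
      modulus t = μ.real (Metric.closedBall 0 ‖t‖) / μ.real (Metric.closedBall 0 1) := by
    rw [eq_div_iff hpos.ne', measureReal_def μ (Metric.closedBall 0 ‖t‖),
      ← modulus_mul_measure_closedBall, ENNReal.toReal_mul,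
      ENNReal.toReal_ofReal (modulus_nonneg t), measureReal_def]
  have hball : Filter.Tendsto (fun r => μ (Metric.cthickening r {(0 : F)})) (𝓝 0) (𝓝 (μ {0})) :=
    tendsto_measure_cthickening_of_isCompact isCompact_singleton
  have hlim := (ENNReal.tendsto_toReal (by simp [measure_singleton_zero μ])).comp
    (hball.comp (tendsto_norm_zero (E := F)))
  rw [measure_singleton_zero, ENNReal.toReal_zero] at hlim
  rw [ContinuousAt, modulus_zero, funext hmodulus,
    ← zero_div (μ.real (Metric.closedBall (0 : F) 1))]
  refine (hlim.congr fun t => ?_).div_const _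
  simp only [Function.comp_apply, Metric.cthickening_singleton _ (norm_nonneg t), measureReal_def]

lemma continuousAt_modulus_of_ne_zero {t : F} (ht : t ≠ 0) :
    ContinuousAt (modulus : F → ℝ) t := by
  borelize F
  let μ : Measure F := Measure.addHaar
  obtain ⟨f, hfc, hf0, hf1⟩ := exists_continuous_nonneg_pos (1 : F)
  obtain ⟨R, hR⟩ := hfc.isBounded.subset_closedBall 0
  have hint : ∫ x, f x ∂μ ≠ 0 :=
    (f.continuous.integral_pos_of_hasCompactSupport_nonneg_nonzero hfc hf0 hf1).ne'
  have hmodulus : ∀ᶠ u in 𝓝 t, (∫ x, f x ∂μ) / ∫ x, f (u * x) ∂μ = modulus u := by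
    filter_upwards [isOpen_ne.mem_nhds ht] with u hu
    rw [integral_comp_mul_left μ hu, smul_eq_mul, div_mul_cancel_right₀ hint, inv_inv]
  have hnhds : {u : F | ‖t‖ / 2 < ‖u‖} ∈ 𝓝 t :=
    (isOpen_lt continuous_const continuous_norm).mem_nhds (half_lt_self (norm_pos_iff.2 ht))
  have hcont : ContinuousAt (fun u => ∫ x, f (u * x) ∂μ) t := by
    refine (continuousOn_integral_of_compact_support (f := fun u x => f (u * x))
      (isCompact_closedBall (0 : F) (R / (‖t‖ / 2)))
      (by fun_prop) fun u x hu hx => ?_).continuousAt hnhds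
    refine image_eq_zero_of_notMem_tsupport fun hux => hx ?_
    have hux' : ‖u‖ * ‖x‖ ≤ R := by simpa using hR hux
    have ht2 : 0 < ‖t‖ / 2 := half_pos (norm_pos_iff.2 ht)
    rw [mem_closedBall_zero_iff, le_div_iff₀' ht2]
    exact (mul_le_mul_of_nonneg_right (le_of_lt hu) (norm_nonneg x)).trans hux'
  refine (continuousAt_const.div hcont ?_).congr hmodulus
  rw [integral_comp_mul_left μ ht]
  exact smul_ne_zero (inv_ne_zero (modulus_ne_zero ht)) hint

lemma continuous_modulus : Continuous (modulus : F → ℝ) :=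
  continuous_iff_continuousAt.2 fun x => by
    rcases eq_or_ne x 0 with rfl | hx
    · exact continuousAt_modulus_zero
    · exact continuousAt_modulus_of_ne_zero hx

lemma modulus_lt_one {t : F} (ht : ‖t‖ < 1) : modulus t < 1 := by
  have hlim := (continuous_modulus.tendsto 0).comp (tendsto_pow_atTop_nhds_zero_of_norm_lt_one ht)
  simp only [Function.comp_def, modulus_pow, modulus_zero] at hlim
  simpa [abs_of_nonneg (modulus_nonneg t)] using tendsto_pow_atTop_nhds_zero_iff.1 hlim

end ModulusTopology

section MultiplicativeMeasure

variable {F : Type} [NontriviallyNormedField F] [ProperSpace F] [MeasurableSpace F]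
  (μ : Measure F)

/-- The measure `|x|⁻¹ dx`: up to normalization, the Haar measure of the multiplicative group,
extended by zero to the origin. -/
def multHaar : Measure F := μ.withDensity fun x => ENNReal.ofReal (modulus x)⁻¹

lemma multHaar_absolutelyContinuous : multHaar μ ≪ μ := withDensity_absolutelyContinuous _ _

lemma multHaar_lt_top_of_le_norm {s : Set F} {r : ℝ} (hr : 0 < r) (hsm : MeasurableSet s)
    (hs : ∀ x ∈ s, r ≤ ‖x‖) (hμs : μ s ≠ ⊤) : multHaar μ s < ⊤ := by
  obtain ⟨t, ht0, ht⟩ := NormedField.exists_norm_lt F hr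
  rw [multHaar, withDensity_apply _ hsm]
  refine (setLIntegral_mono' (g := fun _ => ENNReal.ofReal (modulus t)⁻¹) hsm
    fun x hx => ?_).trans_lt ?_
  · exact ENNReal.ofReal_le_ofReal (inv_anti₀ (modulus_pos (norm_pos_iff.1 ht0))
      (modulus_le_of_norm_le (ht.le.trans (hs x hx))))
  · rw [setLIntegral_const]
    exact ENNReal.mul_lt_top ENNReal.ofReal_lt_top hμs.lt_top

variable [BorelSpace F] {E : Type*} [NormedAddCommGroup E]

lemma measurable_modulus : Measurable (modulus : F → ℝ) := continuous_modulus.measurable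

lemma lintegral_multHaar {f : F → ENNReal} (hf : Measurable f) :
    ∫⁻ x, f x ∂(multHaar μ) = ∫⁻ x, ENNReal.ofReal (modulus x)⁻¹ * f x ∂μ :=
  lintegral_withDensity_eq_lintegral_mul _ measurable_modulus.inv.ennreal_ofReal hf

lemma integrable_multHaar [NormedSpace ℝ E] {f : F → E} :
    Integrable f (multHaar μ) ↔ Integrable (fun x => (modulus x)⁻¹ • f x) μ := by
  have hm : Measurable fun x : F => ENNReal.ofReal (modulus x)⁻¹ :=
    measurable_modulus.inv.ennreal_ofReal
  rw [multHaar, integrable_withDensity_iff_integrable_smul' hm (by simp)]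
  simp_rw [ENNReal.toReal_ofReal (inv_nonneg.2 (modulus_nonneg _))]

lemma integral_multHaar [NormedSpace ℝ E] (f : F → E) :
    ∫ x, f x ∂(multHaar μ) = ∫ x, (modulus x)⁻¹ • f x ∂μ := by
  have h := integral_withDensity_eq_integral_smul (μ := μ)
    (f := fun x : F => (modulus x)⁻¹.toNNReal) measurable_modulus.inv.real_toNNReal f
  simp only [NNReal.smul_def, Real.coe_toNNReal _ (inv_nonneg.2 (modulus_nonneg _))] at h
  exact h

instance [SigmaFinite μ] : SigmaFinite (multHaar μ) := by
  unfold multHaar; infer_instance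

variable [μ.IsAddHaarMeasure]

lemma ae_ne_zero : ∀ᵐ x ∂μ, x ≠ (0 : F) := by
  rw [ae_iff]; simp

lemma multHaar_ae_ne_zero : ∀ᵐ x ∂(multHaar μ), x ≠ (0 : F) :=
  (multHaar_absolutelyContinuous μ).ae_le (ae_ne_zero μ)

lemma absolutelyContinuous_multHaar : μ ≪ multHaar μ := by
  refine withDensity_absolutelyContinuous' measurable_modulus.inv.ennreal_ofReal.aemeasurable ?_
  filter_upwards [ae_ne_zero μ] with x hx
  simpa using modulus_pos hx

lemma lintegral_multHaar_comp_mul_left {t : F} (ht : t ≠ 0) {f : F → ENNReal}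
    (hf : Measurable f) : ∫⁻ x, f (t * x) ∂(multHaar μ) = ∫⁻ x, f x ∂(multHaar μ) := by
  have hscale (x : F) : ENNReal.ofReal (modulus x)⁻¹ * f (t * x) =
      ENNReal.ofReal (modulus t) * (ENNReal.ofReal (modulus (t * x))⁻¹ * f (t * x)) := by
    rw [← mul_assoc, ← ENNReal.ofReal_mul (modulus_nonneg t), modulus_mul, mul_inv,
      mul_inv_cancel_left₀ (modulus_ne_zero ht)]
  rw [lintegral_multHaar μ hf,
    lintegral_multHaar μ (f := fun x => f (t * x)) (hf.comp (measurable_const_mul t))]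
  simp_rw [hscale]
  rw [lintegral_const_mul' _ _ ENNReal.ofReal_ne_top,
    lintegral_comp_mul_left μ ht (fun x => ENNReal.ofReal (modulus x)⁻¹ * f x), ← mul_assoc,
    ← ENNReal.ofReal_mul (modulus_nonneg t), mul_inv_cancel₀ (modulus_ne_zero ht),
    ENNReal.ofReal_one, one_mul]

lemma measurePreserving_mul_left {t : F} (ht : t ≠ 0) :
    MeasurePreserving (fun x => t * x) (multHaar μ) (multHaar μ) :=
  ⟨measurable_const_mul t, Measure.ext_of_lintegral _ fun f hf => by
    rw [lintegral_map hf (measurable_const_mul t), lintegral_multHaar_comp_mul_left μ ht hf]⟩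

lemma exists_multHaar_ne_zero_ne_top :
    ∃ s : Set F, MeasurableSet s ∧ multHaar μ s ≠ 0 ∧ multHaar μ s ≠ ⊤ := by
  refine ⟨Metric.ball 1 (1 / 2), measurableSet_ball, fun h => ?_, ?_⟩
  · exact (Metric.measure_ball_pos μ (1 : F) one_half_pos).ne'
      (absolutelyContinuous_multHaar μ h)
  · refine (multHaar_lt_top_of_le_norm μ one_half_pos measurableSet_ball (fun x hx => ?_)
      measure_ball_lt_top.ne).ne
    rw [mem_ball_iff_norm'] at hx
    have := norm_sub_norm_le (1 : F) x
    rw [norm_one] at this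
    linarith

-- The uniqueness argument for Haar measures: compute `∫∫ f(x⁻¹) g(xy)` in both orders.
lemma lintegral_multHaar_comp_inv_mul {f g : F → ENNReal} (hf : Measurable f) (hg : Measurable g)
    (hg_top : ∫⁻ y, g y ∂(multHaar μ) ≠ ⊤) :
    (∫⁻ x, f x⁻¹ ∂(multHaar μ)) * ∫⁻ y, g y ∂(multHaar μ) =
      (∫⁻ x, f x ∂(multHaar μ)) * ∫⁻ y, g y ∂(multHaar μ) := by
  set ν := multHaar μ
  calc (∫⁻ x, f x⁻¹ ∂ν) * ∫⁻ y, g y ∂ν = ∫⁻ x, f x⁻¹ * ∫⁻ y, g y ∂ν ∂ν :=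
        (lintegral_mul_const' _ _ hg_top).symm
    _ = ∫⁻ x, ∫⁻ y, f x⁻¹ * g (x * y) ∂ν ∂ν := by
        refine lintegral_congr_ae ?_
        filter_upwards [multHaar_ae_ne_zero μ] with x hx
        rw [← lintegral_multHaar_comp_mul_left μ hx hg, lintegral_const_mul]
        exact hg.comp (measurable_const_mul x)
    _ = ∫⁻ y, ∫⁻ x, f x⁻¹ * g (x * y) ∂ν ∂ν :=
        lintegral_lintegral_swap ((hf.comp measurable_fst.inv).mul
          (hg.comp (measurable_fst.mul measurable_snd))).aemeasurable
    _ = ∫⁻ y, ∫⁻ x, f (y * x⁻¹) * g x ∂ν ∂ν := by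
        refine lintegral_congr_ae ?_
        filter_upwards [multHaar_ae_ne_zero μ] with y hy
        have hm : Measurable fun x => f (y * x⁻¹) * g x :=
          (hf.comp (measurable_inv.const_mul y)).mul hg
        rw [← lintegral_multHaar_comp_mul_left μ hy hm]
        refine lintegral_congr fun x => ?_
        rw [mul_inv, mul_inv_cancel_left₀ hy, mul_comm x y]
    _ = ∫⁻ x, ∫⁻ y, f (y * x⁻¹) * g x ∂ν ∂ν :=
        lintegral_lintegral_swap ((hf.comp (measurable_fst.mul measurable_snd.inv)).mul
          (hg.comp measurable_snd)).aemeasurable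
    _ = ∫⁻ x, (∫⁻ y, f y ∂ν) * g x ∂ν := by
        refine lintegral_congr_ae ?_
        filter_upwards [multHaar_ae_ne_zero μ] with x hx
        simp_rw [mul_comm _ x⁻¹]
        rw [← lintegral_multHaar_comp_mul_left μ (inv_ne_zero hx) hf, ← lintegral_mul_const]
        exact hf.comp (measurable_const_mul _)
    _ = (∫⁻ x, f x ∂ν) * ∫⁻ y, g y ∂ν := lintegral_const_mul _ hg

lemma measurePreserving_inv :
    MeasurePreserving (fun x => x⁻¹) (multHaar μ) (multHaar μ) := by
  obtain ⟨s, hs, hs0, hs_top⟩ := exists_multHaar_ne_zero_ne_top μ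
  refine ⟨measurable_inv, Measure.ext_of_lintegral _ fun f hf => ?_⟩
  have h := lintegral_multHaar_comp_inv_mul μ hf (measurable_one.indicator hs)
    (by rwa [lintegral_indicator_one hs])
  rw [lintegral_indicator_one hs] at h
  rw [lintegral_map hf measurable_inv, (ENNReal.mul_left_inj hs0 hs_top).1 h]

lemma measurePreserving_const_div {a : F} (ha : a ≠ 0) :
    MeasurePreserving (fun x => a / x) (multHaar μ) (multHaar μ) := by
  simpa only [Function.comp_def, div_eq_mul_inv] using
    (measurePreserving_mul_left μ ha).comp (measurePreserving_inv μ)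

end MultiplicativeMeasure

lemma measurableEmbedding_inv {G : Type*} [InvolutiveInv G] [MeasurableSpace G]
    [MeasurableInv G] : MeasurableEmbedding (fun x : G => x⁻¹) :=
  (MeasurableEquiv.inv G).measurableEmbedding

lemma measurableEmbedding_const_div {F : Type*} [NontriviallyNormedField F] [MeasurableSpace F]
    [BorelSpace F] {a : F} (ha : a ≠ 0) : MeasurableEmbedding (fun x => a / x) := by
  simpa only [Function.comp_def, div_eq_mul_inv] using
    (measurableEmbedding_mul_left ha).comp measurableEmbedding_inv

section MellinWeight

variable {F : Type} [NontriviallyNormedField F]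

lemma exists_norm_pow_lt_mul_inv_le {t x : F} (ht0 : t ≠ 0) (ht1 : ‖t‖ < 1) (hx0 : x ≠ 0)
    (hx1 : ‖x‖ ≤ 1) : ∃ n : ℕ, ‖t‖ < ‖(t ^ n)⁻¹ * x‖ ∧ ‖(t ^ n)⁻¹ * x‖ ≤ 1 := by
  have ht : 0 < ‖t‖ := norm_pos_iff.2 ht0
  obtain ⟨n, hn_lt, hn_le⟩ := exists_nat_pow_near_of_lt_one (norm_pos_iff.2 hx0) hx1 ht ht1
  refine ⟨n, ?_, ?_⟩ <;> rw [norm_mul, norm_inv, norm_pow, inv_mul_eq_div]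
  · rwa [lt_div_iff₀ (pow_pos ht n), ← pow_succ']
  · rwa [div_le_one (pow_pos ht n)]

variable [ProperSpace F]

/-- The weight `(1 + |log |x||) |x|^σ / (1 + |x|)`, which dominates the integrands of the Mellin
integrals at real part `σ` and of their derivatives. -/
def mellinWeight (σ : ℝ) (x : F) : ℝ :=
  (1 + |Real.log (modulus x)|) * modulus x ^ σ / (1 + modulus x)

lemma mellinWeight_nonneg (σ : ℝ) (x : F) : 0 ≤ mellinWeight σ x := by
  have := modulus_nonneg x
  unfold mellinWeight; positivity

lemma mellinWeight_inv (σ : ℝ) {x : F} (hx : x ≠ 0) :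
    mellinWeight σ x⁻¹ = mellinWeight (1 - σ) x := by
  have h := modulus_pos hx
  have := Real.rpow_pos_of_pos h σ
  unfold mellinWeight
  rw [modulus_inv, Real.log_inv, abs_neg, Real.inv_rpow h.le, Real.rpow_sub h, Real.rpow_one]
  field_simp
  ring

variable [MeasurableSpace F] [BorelSpace F] (μ : Measure F) [μ.IsAddHaarMeasure]

lemma integrable_of_integrableOn_closedBall {E : Type*} [NormedAddCommGroup E] {f : F → E}
    (hball : IntegrableOn f (Metric.closedBall 0 1) (multHaar μ))
    (hball_inv : IntegrableOn (fun x => f x⁻¹) (Metric.closedBall 0 1) (multHaar μ)) :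
    Integrable f (multHaar μ) := by
  have hcompl : IntegrableOn f ((fun x => x⁻¹) ⁻¹' (Metric.closedBall 0 1)) (multHaar μ) := by
    rw [← (measurePreserving_inv μ).integrableOn_comp_preimage measurableEmbedding_inv]
    simpa [Function.comp_def, ← Set.preimage_comp] using hball_inv
  rw [← integrableOn_univ]
  refine (hball.union hcompl).mono_set fun x _ => ?_
  simp only [Set.mem_union, Set.mem_preimage, mem_closedBall_zero_iff, norm_inv]
  exact (le_total ‖x‖ 1).imp_right inv_le_one_of_one_le₀

lemma setLIntegral_modulus_rpow_le {t : F} (ht : t ≠ 0) {σ : ℝ} (hσ : 0 ≤ σ) {A : Set F}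
    (hA : MeasurableSet A) (hA1 : ∀ x ∈ A, ‖x‖ ≤ 1) :
    ∫⁻ x in (fun x => t⁻¹ * x) ⁻¹' A, ‖modulus x ^ σ‖ₑ ∂(multHaar μ) ≤
      ENNReal.ofReal (modulus t ^ σ) * multHaar μ A := by
  have hle : ∀ x ∈ (fun x => t⁻¹ * x) ⁻¹' A,
      ‖modulus x ^ σ‖ₑ ≤ ENNReal.ofReal (modulus t ^ σ) := fun x hx => by
    rw [Real.enorm_of_nonneg (Real.rpow_nonneg (modulus_nonneg x) _)]
    refine ENNReal.ofReal_le_ofReal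
      (Real.rpow_le_rpow (modulus_nonneg x) (modulus_le_of_norm_le ?_) hσ)
    have := hA1 _ hx
    rwa [norm_mul, norm_inv, inv_mul_eq_div, div_le_one (norm_pos_iff.2 ht)] at this
  refine (setLIntegral_mono' (measurable_const_mul _ hA) hle).trans ?_
  rw [setLIntegral_const, (measurePreserving_mul_left μ (inv_ne_zero ht)).measure_preimage
    hA.nullMeasurableSet]

-- The punctured unit ball is covered by the dilates `tⁿA` of the shell `A = {‖t‖ < ‖x‖ ≤ 1}`.
lemma integrableOn_modulus_rpow {σ : ℝ} (hσ : 0 < σ) :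
    IntegrableOn (fun x : F => modulus x ^ σ) (Metric.closedBall 0 1) (multHaar μ) := by
  obtain ⟨t, ht, ht1⟩ := NormedField.exists_norm_lt F one_pos
  have ht0 : t ≠ 0 := norm_pos_iff.1 ht
  have hq : modulus t ^ σ < 1 := Real.rpow_lt_one (modulus_nonneg t) (modulus_lt_one ht1) hσ
  set A : Set F := {x | ‖t‖ < ‖x‖ ∧ ‖x‖ ≤ 1}
  have hA : MeasurableSet A :=
    (measurableSet_lt measurable_const measurable_norm).inter
      (measurableSet_le measurable_norm measurable_const)
  have hA_top : multHaar μ A < ⊤ := multHaar_lt_top_of_le_norm μ ht hA (fun x hx => hx.1.le)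
    ((measure_mono fun x hx => by simpa using hx.2).trans_lt
      (isCompact_closedBall (0 : F) 1).measure_lt_top).ne
  have hcover : (Metric.closedBall 0 1 : Set F) ≤ᵐ[multHaar μ]
      ⋃ n : ℕ, (fun x => (t ^ n)⁻¹ * x) ⁻¹' A := by
    filter_upwards [multHaar_ae_ne_zero μ] with x hx0 hx
    exact Set.mem_iUnion.2
      (exists_norm_pow_lt_mul_inv_le ht0 ht1 hx0 (mem_closedBall_zero_iff.1 hx))
  refine ⟨(measurable_modulus.pow_const σ).aestronglyMeasurable, ?_⟩
  rw [hasFiniteIntegral_iff_enorm]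
  calc ∫⁻ x in Metric.closedBall 0 1, ‖modulus x ^ σ‖ₑ ∂(multHaar μ)
      ≤ ∫⁻ x in ⋃ n : ℕ, (fun x => (t ^ n)⁻¹ * x) ⁻¹' A, ‖modulus x ^ σ‖ₑ ∂(multHaar μ) :=
        lintegral_mono' (Measure.restrict_mono_ae hcover) le_rfl
    _ ≤ ∑' n : ℕ, ∫⁻ x in (fun x => (t ^ n)⁻¹ * x) ⁻¹' A, ‖modulus x ^ σ‖ₑ ∂(multHaar μ) :=
        lintegral_iUnion_le _ _
    _ ≤ ∑' n : ℕ, ENNReal.ofReal (modulus t ^ σ) ^ n * multHaar μ A := by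
        refine ENNReal.tsum_le_tsum fun n => ?_
        rw [← ENNReal.ofReal_pow (Real.rpow_nonneg (modulus_nonneg t) σ),
          Real.rpow_pow_comm (modulus_nonneg t), ← modulus_pow]
        exact setLIntegral_modulus_rpow_le μ (pow_ne_zero n ht0) hσ.le hA fun x hx => hx.2
    _ < ⊤ := by
        rw [ENNReal.tsum_mul_right, ENNReal.tsum_geometric]
        exact ENNReal.mul_lt_top (by simpa using hq) hA_top

lemma abs_log_mul_rpow_le {u σ : ℝ} (hσ : 0 < σ) (h0 : 0 ≤ u) (h1 : u ≤ 1) :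
    |Real.log u| * u ^ σ ≤ 2 / σ * u ^ (σ / 2) := by
  rcases h0.eq_or_lt with rfl | hu
  · simp [Real.zero_rpow (half_pos hσ).ne']
  have hlog := (Real.abs_log_mul_self_rpow_lt u (σ / 2) hu h1 (half_pos hσ)).le
  rw [abs_mul, abs_of_nonneg (Real.rpow_nonneg h0 _), one_div_div] at hlog
  calc |Real.log u| * u ^ σ = |Real.log u| * u ^ (σ / 2) * u ^ (σ / 2) := by
        rw [mul_assoc, ← Real.rpow_add hu, add_halves]
    _ ≤ 2 / σ * u ^ (σ / 2) := by gcongr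

lemma measurable_mellinWeight (σ : ℝ) : Measurable (mellinWeight σ : F → ℝ) := by
  have := measurable_modulus (F := F)
  unfold mellinWeight
  fun_prop

lemma integrableOn_mellinWeight {σ : ℝ} (hσ : 0 < σ) :
    IntegrableOn (mellinWeight σ : F → ℝ) (Metric.closedBall 0 1) (multHaar μ) := by
  refine Integrable.mono' ((integrableOn_modulus_rpow μ hσ).add
    ((integrableOn_modulus_rpow μ (half_pos hσ)).const_mul (2 / σ)))
    (measurable_mellinWeight σ).aestronglyMeasurable ?_
  filter_upwards [ae_restrict_mem measurableSet_closedBall] with x hx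
  have hmod := modulus_nonneg x
  have hlog := abs_log_mul_rpow_le hσ hmod (modulus_le_one (mem_closedBall_zero_iff.1 hx))
  rw [Real.norm_of_nonneg (mellinWeight_nonneg σ x), mellinWeight]
  refine (div_le_self (by positivity) (by linarith)).trans ?_
  simp only [Pi.add_apply]
  linarith

lemma integrable_mellinWeight {σ : ℝ} (hσ0 : 0 < σ) (hσ1 : σ < 1) :
    Integrable (mellinWeight σ : F → ℝ) (multHaar μ) := by
  refine integrable_of_integrableOn_closedBall μ (integrableOn_mellinWeight μ hσ0) ?_
  refine (integrableOn_mellinWeight μ (sub_pos.2 hσ1)).congr ?_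
  filter_upwards [ae_restrict_of_ae (multHaar_ae_ne_zero μ)] with x hx
  exact (mellinWeight_inv σ hx).symm

end MellinWeight

section MultiplicativeFubini

variable {F : Type} [NontriviallyNormedField F] [ProperSpace F] [MeasurableSpace F] [BorelSpace F]

lemma integral_mul_modulus_multHaar (μ : Measure F) [μ.IsAddHaarMeasure] (f : F → ℂ) :
    ∫ x, f x * modulus x ∂(multHaar μ) = ∫ x, f x ∂μ := by
  rw [integral_multHaar]
  refine integral_congr_ae ?_
  filter_upwards [ae_ne_zero μ] with x hx
  rw [Complex.real_smul]
  have : (modulus x : ℂ) ≠ 0 := by exact_mod_cast modulus_ne_zero hx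
  push_cast
  field_simp

lemma integrable_mul_modulus_multHaar (μ : Measure F) [μ.IsAddHaarMeasure] {f : F → ℝ} :
    Integrable (fun x => f x * modulus x) (multHaar μ) ↔ Integrable f μ := by
  rw [integrable_multHaar]
  refine integrable_congr ?_
  filter_upwards [ae_ne_zero μ] with x hx
  have := modulus_ne_zero hx
  simp only [smul_eq_mul]
  field_simp

lemma integrable_mellin_prod (μ : Measure F) [μ.IsAddHaarMeasure] {h G w : F → ℂ} {a b : F → ℝ}
    (hh : Measurable h) (hG : Measurable G) (hw : Measurable w)
    (hwb : ∀ t x : F, t ≠ 0 → x ≠ 0 → ‖w (x / t)‖ ≤ a t * b x)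
    (ha : Integrable (fun t => ‖h t‖ * a t) (multHaar μ))
    (hb : Integrable (fun x => ‖G x‖ * b x) μ) :
    Integrable (fun p : F × F => h p.1 * (w (p.2 / p.1) * G p.2) * modulus p.2)
      ((multHaar μ).prod (multHaar μ)) := by
  refine Integrable.mono' (ha.mul_prod ((integrable_mul_modulus_multHaar μ).2 hb)) (Measurable.mul
    ((hh.comp measurable_fst).mul ((hw.comp (measurable_snd.div measurable_fst)).mul
      (hG.comp measurable_snd)))
    (Complex.measurable_ofReal.comp (measurable_modulus.comp measurable_snd))).aestronglyMeasurable
    ?_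
  filter_upwards [Measure.quasiMeasurePreserving_fst.ae (multHaar_ae_ne_zero μ),
    Measure.quasiMeasurePreserving_snd.ae (multHaar_ae_ne_zero μ)] with p hp1 hp2
  have hm := modulus_nonneg p.2
  simp only [norm_mul, Complex.norm_real, Real.norm_of_nonneg hm]
  calc ‖h p.1‖ * (‖w (p.2 / p.1)‖ * ‖G p.2‖) * modulus p.2
      ≤ ‖h p.1‖ * ((a p.1 * b p.2) * ‖G p.2‖) * modulus p.2 := by
        gcongr
        exact hwb p.1 p.2 hp1 hp2
    _ = _ := by ring

lemma measurePreserving_prod_mul (μ : Measure F) [μ.IsAddHaarMeasure] :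
    MeasurePreserving (fun p : F × F => (p.1, p.1 * p.2)) ((multHaar μ).prod (multHaar μ))
      ((multHaar μ).prod (multHaar μ)) :=
  (MeasurePreserving.id _).skew_product (g := fun t x => t * x) (measurable_fst.mul measurable_snd)
    (by filter_upwards [multHaar_ae_ne_zero μ] with t ht using
      (measurePreserving_mul_left μ ht).map_eq)

-- Substituting `x ↦ t * x` in `∫∫ h(t) w(x / t) G(x)` separates the variable of `w`.
lemma integral_mul_integral_comp_div (μ : Measure F) [μ.IsAddHaarMeasure] {h G w : F → ℂ}
    {a b : F → ℝ} (hh : Measurable h) (hG : Measurable G) (hw : Measurable w)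
    (hwb : ∀ t x : F, t ≠ 0 → x ≠ 0 → ‖w (x / t)‖ ≤ a t * b x)
    (ha : Integrable (fun t => ‖h t‖ * a t) (multHaar μ))
    (hb : Integrable (fun x => ‖G x‖ * b x) μ) :
    ∫ t, h t * ∫ x, w (x / t) * G x ∂μ ∂(multHaar μ) =
      ∫ x, w x * ∫ t, h t * G (t * x) ∂μ ∂μ := by
  set ν := multHaar μ
  set Φ : F × F → ℂ := fun p => h p.1 * (w (p.2 / p.1) * G p.2) * modulus p.2 with hΦ
  have hΦi : Integrable Φ (ν.prod ν) := integrable_mellin_prod μ hh hG hw hwb ha hb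
  have hS := measurePreserving_prod_mul μ
  calc ∫ t, h t * ∫ x, w (x / t) * G x ∂μ ∂ν
      = ∫ t, ∫ x, Φ (t, x) ∂ν ∂ν := by
        congr 1 with t
        rw [← integral_mul_modulus_multHaar, ← integral_const_mul]
        simp only [hΦ, mul_assoc]; rfl
    _ = ∫ p, Φ p ∂(ν.prod ν) := (integral_prod _ hΦi).symm
    _ = ∫ p, Φ (p.1, p.1 * p.2) ∂(ν.prod ν) := by
        rw [← integral_map hS.measurable.aemeasurable
          (by rw [hS.map_eq]; exact hΦi.aestronglyMeasurable), hS.map_eq]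
    _ = ∫ x, ∫ t, Φ (t, t * x) ∂ν ∂ν :=
        integral_prod_symm _ (hS.integrable_comp_of_integrable hΦi)
    _ = ∫ x, (w x * ∫ t, h t * G (t * x) ∂μ) * modulus x ∂ν := by
        congr 1 with x
        rw [← integral_mul_modulus_multHaar μ (fun t => h t * G (t * x)), mul_assoc,
          mul_comm (∫ _, _ ∂_), ← mul_assoc, ← integral_const_mul]
        refine integral_congr_ae ?_
        filter_upwards [multHaar_ae_ne_zero μ] with t ht
        simp only [hΦ, mul_div_cancel_left₀ _ ht, modulus_mul]
        push_cast; ring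
    _ = _ := integral_mul_modulus_multHaar μ _

end MultiplicativeFubini

section FourierTransform

variable {F : Type} [Field F] [MeasurableSpace F] {ψ : AddChar F Circle} {μ : Measure F}

lemma fourier_apply (φ : F → ℂ) (y : F) :
    fourier ψ μ φ y = ∫ x, (ψ (-(x * y)) : ℂ) * φ x ∂μ := by
  simp only [fourier, Fourier.fourierIntegral_def, Circle.smul_def, smul_eq_mul]

lemma fourierInv_apply (φ : F → ℂ) (x : F) :
    fourierInv ψ μ φ x = fourier ψ μ φ (-x) := rfl

lemma norm_fourier_le (φ : F → ℂ) (y : F) : ‖fourier ψ μ φ y‖ ≤ ∫ x, ‖φ x‖ ∂μ :=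
  Fourier.norm_fourierIntegral_le_integral_norm ψ μ φ y

lemma fourier_smul (c : ℂ) (f : F → ℂ) (y : F) :
    fourier ψ μ (fun x => c * f x) y = c * fourier ψ μ f y := by
  simp only [fourier_apply, ← integral_const_mul]
  congr 1 with x
  ring

lemma fourier_char_mul (a : F) (f : F → ℂ) (y : F) :
    fourier ψ μ (fun x => ψ (x * a) * f x) y = fourier ψ μ f (y - a) := by
  simp only [fourier_apply]
  congr 1 with x
  rw [← mul_assoc, ← Circle.coe_mul, ← AddChar.map_add_eq_mul]
  ring_nf

lemma conj_fourier (f : F → ℂ) (y : F) :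
    conj (fourier ψ μ f y) = fourier ψ μ (fun x => conj (f x)) (-y) := by
  simp only [fourier_apply, ← integral_conj]
  congr 1 with x
  rw [map_mul, ← Circle.coe_inv_eq_conj, ← AddChar.map_neg_eq_inv]
  ring_nf

lemma fourier_smul_measure (k : NNReal) (φ : F → ℂ) (y : F) :
    fourier ψ (k • μ) φ y = (k : ℂ) * fourier ψ μ φ y := by
  simp only [fourier_apply]
  rw [integral_smul_nnreal_measure]
  simp [NNReal.smul_def]

lemma fourier_fourier_smul_measure (k : NNReal) (φ : F → ℂ) (x : F) :
    fourier ψ (k • μ) (fourier ψ (k • μ) φ) x = (k : ℂ) ^ 2 * fourier ψ μ (fourier ψ μ φ) x := by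
  rw [fourier_smul_measure, funext (fourier_smul_measure k φ), fourier_smul]
  ring

variable [TopologicalSpace F] [IsTopologicalRing F] [BorelSpace F]

lemma integrable_char_mul (hψ : Continuous ψ) {f : F → ℂ} (hf : Integrable f μ) (y : F) :
    Integrable (fun x => (ψ (-(x * y)) : ℂ) * f x) μ := by
  refine (hf.bdd_mul (c := 1) ?_ ?_)
  · have : Continuous fun x : F => (ψ (-(x * y)) : ℂ) := by fun_prop
    exact this.aestronglyMeasurable
  · exact Filter.Eventually.of_forall fun x => (Circle.norm_coe _).le

lemma fourier_add (hψ : Continuous ψ) {f g : F → ℂ} (hf : Integrable f μ) (hg : Integrable g μ)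
    (y : F) : fourier ψ μ (fun x => f x + g x) y = fourier ψ μ f y + fourier ψ μ g y := by
  simp only [fourier_apply, mul_add]
  exact integral_add (integrable_char_mul hψ hf y) (integrable_char_mul hψ hg y)

lemma fourier_comp_add [μ.IsAddHaarMeasure] (a : F) (f : F → ℂ) (y : F) :
    fourier ψ μ (fun x => f (x + a)) y = ψ (a * y) * fourier ψ μ f y := by
  simp only [fourier_apply, ← integral_const_mul]
  rw [← integral_add_right_eq_self (fun x => (ψ (a * y) : ℂ) * ((ψ (-(x * y)) : ℂ) * f x)) a]
  congr 1 with x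
  rw [← mul_assoc, ← Circle.coe_mul, ← AddChar.map_add_eq_mul]
  ring_nf

end FourierTransform

section FourierDilation

variable {F : Type} [NontriviallyNormedField F] [MeasurableSpace F] [BorelSpace F]
  {ψ : AddChar F Circle} {μ : Measure F}

lemma continuous_fourier (hψ : Continuous ψ) {φ : F → ℂ} (hφ : Integrable φ μ) :
    Continuous (fourier ψ μ φ) :=
  VectorFourier.fourierIntegral_continuous hψ (by simpa using continuous_mul) hφ

variable [ProperSpace F] [μ.IsAddHaarMeasure]

lemma integral_fourier_mul (hψ : Continuous ψ) {f g : F → ℂ} (hf : Integrable f μ)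
    (hg : Integrable g μ) :
    ∫ x, fourier ψ μ f x * g x ∂μ = ∫ x, f x * fourier ψ μ g x ∂μ := by
  have h := VectorFourier.integral_fourierIntegral_smul_eq_flip (L := LinearMap.mul F F)
    hψ (by simpa using continuous_mul) hf hg
  simp only [smul_eq_mul] at h
  have hflip : (LinearMap.mul F F).flip = LinearMap.mul F F := by
    ext; simp
  rw [hflip] at h
  exact h

lemma fourier_comp_mul {t : F} (ht : t ≠ 0) (f : F → ℂ) (y : F) :
    fourier ψ μ (fun x => f (t * x)) y = ((modulus t)⁻¹ : ℂ) * fourier ψ μ f (y / t) := by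
  simp only [fourier_apply]
  rw [← Complex.ofReal_inv, ← Complex.real_smul, ← integral_comp_mul_left μ ht]
  congr 1 with x
  congr 4
  field_simp

lemma integral_mul_fourier_dilate (hψ : Continuous ψ) {f g : F → ℂ} (hf : Integrable f μ)
    (hg : Integrable g μ) {x : F} (hx : x ≠ 0) :
    ∫ t, g t * fourier ψ μ f (t * x) ∂μ = ∫ t, f t * fourier ψ μ g (t * x) ∂μ := by
  have h := integral_fourier_mul hψ (f := fun t => f (x⁻¹ * t)) (g := g)
    ((integrable_comp_mul_left μ (inv_ne_zero hx)).2 hf) hg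
  simp only [fourier_comp_mul (inv_ne_zero hx)] at h
  have hsubst := integral_comp_mul_left μ (inv_ne_zero hx) (fun t => f t * fourier ψ μ g (t * x))
  have hcancel (t : F) : x⁻¹ * t * x = t := by field_simp
  simp only [hcancel, modulus_inv, inv_inv, Complex.real_smul] at hsubst
  rw [modulus_inv, Complex.ofReal_inv, inv_inv, hsubst] at h
  refine mul_left_cancel₀ (Complex.ofReal_ne_zero.2 (modulus_ne_zero hx)) ?_
  rw [← h, ← integral_const_mul]
  congr 1 with t
  rw [div_inv_eq_mul]; ring

end FourierDilation

/-- The properties of the space `𝒮` of Schwartz-Bruhat functions on which the theory of the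
commutator operator rests; they do not depend on the type of the local field. The exponents in
`decay` and `holder` suffice for the integrals against `log |x|` and `|x|^{-1}` to converge, and
`bump` takes real-valued functions because it serves as a source of nonnegative weights. -/
structure IsSchwartzBruhatLike {F : Type} [Field F] [TopologicalSpace F] [IsTopologicalRing F]
    [LocallyCompactSpace F] [MeasurableSpace F] [BorelSpace F] (ψ : AddChar F Circle)
    (𝒮 : Set (F → ℂ)) : Prop where
  add_mem : ∀ φ ∈ 𝒮, ∀ η ∈ 𝒮, (fun x => φ x + η x) ∈ 𝒮
  smul_mem : ∀ c : ℂ, ∀ φ ∈ 𝒮, (fun x => c * φ x) ∈ 𝒮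
  translate_mem : ∀ a : F, ∀ φ ∈ 𝒮, (fun x => φ (x + a)) ∈ 𝒮
  dilate_mem : ∀ t : F, t ≠ 0 → ∀ φ ∈ 𝒮, (fun x => φ (t * x)) ∈ 𝒮
  conj_mem : ∀ φ ∈ 𝒮, (fun x => conj (φ x)) ∈ 𝒮
  continuous : ∀ φ ∈ 𝒮, Continuous φ
  decay : ∀ φ ∈ 𝒮, ∃ C : ℝ, ∀ x, ‖φ x‖ * (1 + modulus x) ^ 2 ≤ C
  holder : ∀ φ ∈ 𝒮, ∃ C : ℝ, ∀ x, ‖φ x - φ 0‖ ≤ C * modulus x ^ (1 / 2 : ℝ)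
  fourier_mem : ∀ (μ : Measure F) [μ.IsAddHaarMeasure], ∀ φ ∈ 𝒮, fourier ψ μ φ ∈ 𝒮
  opA_mem : ∀ φ ∈ puncturedTestFunctions 𝒮, opA φ ∈ 𝒮
  bump : ∀ V ∈ 𝓝 (1 : F), ∃ r : F → ℝ, (fun x => (r x : ℂ)) ∈ puncturedTestFunctions 𝒮 ∧
    (∀ x, 0 ≤ r x) ∧ r 1 ≠ 0 ∧ ∀ x, x ∉ V → r x = 0
  ae_eq_zero : ∀ (μ : Measure F) [μ.IsAddHaarMeasure] (f : F → ℂ), MemLp f 2 μ →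
    (∀ φ ∈ puncturedTestFunctions 𝒮, ∫ x, φ x * f x ∂μ = 0) → f =ᵐ[μ] 0

section TestFunctions

variable {F : Type} [NontriviallyNormedField F] [ProperSpace F] [MeasurableSpace F] [BorelSpace F]
  {ψ : AddChar F Circle} {𝒮 : Set (F → ℂ)} {μ : Measure F} [μ.IsAddHaarMeasure]

lemma measurable_log_modulus : Measurable fun x : F => Real.log (modulus x) :=
  Real.measurable_log.comp measurable_modulus

lemma integrable_log_mul_modulus_rpow {σ : ℝ} (h0 : 0 < σ) (h1 : σ < 1) :
    Integrable (fun x : F =>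
      (1 + |Real.log (modulus x)|) * modulus x ^ (-σ) / (1 + modulus x)) μ := by
  rw [← integrable_mul_modulus_multHaar]
  refine (integrable_mellinWeight μ (sub_pos.2 h1) (by linarith : 1 - σ < 1)).congr ?_
  filter_upwards [multHaar_ae_ne_zero μ] with x hx
  have h := modulus_pos hx
  unfold mellinWeight
  rw [Real.rpow_sub h, Real.rpow_one, Real.rpow_neg h.le]
  ring

lemma rpow_half_le_one_add {u : ℝ} (hu : 0 ≤ u) : u ^ (1 / 2 : ℝ) ≤ 1 + u := by
  rw [← Real.sqrt_eq_rpow]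
  nlinarith [Real.sq_sqrt hu, Real.sqrt_nonneg u, sq_nonneg (Real.sqrt u - 1)]

lemma one_le_one_add_mul_rpow {u : ℝ} (hu : 0 < u) : 1 ≤ (1 + u) * u ^ (-(1 / 2) : ℝ) := by
  rw [Real.rpow_neg hu.le, ← div_eq_mul_inv, one_le_div (Real.rpow_pos_of_pos hu _)]
  exact rpow_half_le_one_add hu.le

lemma integrable_log_mul_of_decay {f : F → ℂ} (hf : Measurable f) {C : ℝ}
    (h : ∀ x, ‖f x‖ * (1 + modulus x) ^ 2 ≤ C) :
    Integrable (fun x => ‖f x‖ * (1 + |Real.log (modulus x)|)) μ := by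
  have hm : Measurable (fun x => ‖f x‖ * (1 + |Real.log (modulus x)|)) :=
    hf.norm.mul (measurable_const.add (continuous_abs.measurable.comp measurable_log_modulus))
  refine ((integrable_log_mul_modulus_rpow one_half_pos one_half_lt_one).const_mul C).mono'
    hm.aestronglyMeasurable ?_
  filter_upwards [ae_ne_zero μ] with x hx
  have hp := modulus_pos hx
  rw [Real.norm_of_nonneg (by positivity)]
  have hone := one_le_one_add_mul_rpow hp
  have hC : ‖f x‖ ≤ C / (1 + modulus x) ^ 2 := by
    rw [le_div_iff₀ (by positivity)]; exact h x
  have hC0 : 0 ≤ C := le_trans (by positivity) (h x)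
  calc ‖f x‖ * (1 + |Real.log (modulus x)|)
      ≤ C / (1 + modulus x) ^ 2 * (1 + |Real.log (modulus x)|) * 1 := by rw [mul_one]; gcongr
    _ ≤ C / (1 + modulus x) ^ 2 * (1 + |Real.log (modulus x)|) *
        ((1 + modulus x) * modulus x ^ (-(1 / 2) : ℝ)) := by gcongr
    _ = _ := by field_simp

lemma integrable_of_decay {f : F → ℂ} (hf : Measurable f) {C : ℝ}
    (h : ∀ x, ‖f x‖ * (1 + modulus x) ^ 2 ≤ C) : Integrable f μ := by
  refine (integrable_log_mul_of_decay hf h).mono' hf.aestronglyMeasurable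
    (Filter.Eventually.of_forall fun x => ?_)
  nlinarith [norm_nonneg (f x), abs_nonneg (Real.log (modulus x))]

namespace IsSchwartzBruhatLike

variable (H : IsSchwartzBruhatLike ψ 𝒮) {φ η : F → ℂ}
include H

lemma measurable (hφ : φ ∈ 𝒮) : Measurable φ := (H.continuous φ hφ).measurable

lemma integrable (hφ : φ ∈ 𝒮) : Integrable φ μ := by
  obtain ⟨C, hC⟩ := H.decay φ hφ
  exact integrable_of_decay (H.measurable hφ) hC

lemma integrable_log (hφ : φ ∈ 𝒮) :
    Integrable (fun x => ‖φ x‖ * (1 + |Real.log (modulus x)|)) μ := by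
  obtain ⟨C, hC⟩ := H.decay φ hφ
  exact integrable_log_mul_of_decay (H.measurable hφ) hC

lemma memLp (hφ : φ ∈ 𝒮) : MemLp φ 2 μ := by
  obtain ⟨C, hC⟩ := H.decay φ hφ
  rw [memLp_two_iff_integrable_sq_norm (H.measurable hφ).aestronglyMeasurable]
  refine ((H.integrable (μ := μ) hφ).norm.const_mul C).mono'
    ((H.measurable hφ).norm.pow_const 2).aestronglyMeasurable
    (Filter.Eventually.of_forall fun x => ?_)
  have h0 := modulus_nonneg x
  rw [Real.norm_of_nonneg (by positivity), sq]
  refine mul_le_mul_of_nonneg_right (le_trans ?_ (hC x)) (norm_nonneg _)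
  exact le_mul_of_one_le_right (norm_nonneg _) (by nlinarith)

lemma integrable_log_multHaar (hφ : φ ∈ 𝒮) (h0 : φ 0 = 0) :
    Integrable (fun x => ‖φ x‖ * (1 + |Real.log (modulus x)|)) (multHaar μ) := by
  obtain ⟨C, hC⟩ := H.decay φ hφ
  obtain ⟨D, hD⟩ := H.holder φ hφ
  have hm : Measurable (fun x => ‖φ x‖ * (1 + |Real.log (modulus x)|)) :=
    (H.measurable hφ).norm.mul
      (measurable_const.add (continuous_abs.measurable.comp measurable_log_modulus))
  refine ((integrable_mellinWeight μ (σ := 1 / 2) (by norm_num) (by norm_num)).const_mul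
    (2 * |D| + |C|)).mono' hm.aestronglyMeasurable ?_
  filter_upwards [multHaar_ae_ne_zero μ] with x hx
  have hp := modulus_pos hx
  have hr := Real.rpow_pos_of_pos hp (1 / 2)
  rw [Real.norm_of_nonneg (by positivity), mellinWeight]
  have hbound : ‖φ x‖ * (1 + modulus x) ≤ (2 * |D| + |C|) * modulus x ^ (1 / 2 : ℝ) := by
    rcases le_total (modulus x) 1 with hx1 | hx1
    · have hnear : ‖φ x‖ ≤ |D| * modulus x ^ (1 / 2 : ℝ) := by
        simpa only [h0, sub_zero] using (hD x).trans (by gcongr; exact le_abs_self D)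
      have : 0 ≤ |C| * modulus x ^ (1 / 2 : ℝ) := by positivity
      nlinarith [norm_nonneg (φ x)]
    · have hfar : ‖φ x‖ * (1 + modulus x) ≤ |C| := by
        refine le_trans ?_ ((hC x).trans (le_abs_self C))
        rw [sq, ← mul_assoc]
        exact le_mul_of_one_le_right (by positivity) (by linarith)
      have : 1 ≤ modulus x ^ (1 / 2 : ℝ) := Real.one_le_rpow hx1 (by norm_num)
      nlinarith [abs_nonneg C, abs_nonneg D, mul_nonneg (abs_nonneg D) hr.le]
  have hsplit : ‖φ x‖ * (1 + |Real.log (modulus x)|) =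
      ‖φ x‖ * (1 + modulus x) * ((1 + |Real.log (modulus x)|) / (1 + modulus x)) := by
    field_simp
  rw [hsplit]
  calc _ ≤ (2 * |D| + |C|) * modulus x ^ (1 / 2 : ℝ) *
        ((1 + |Real.log (modulus x)|) / (1 + modulus x)) := by gcongr
    _ = _ := by ring

lemma integrable_multHaar_of_zero (hφ : φ ∈ 𝒮) (h0 : φ 0 = 0) : Integrable φ (multHaar μ) := by
  refine (H.integrable_log_multHaar (μ := μ) hφ h0).mono' (H.measurable hφ).aestronglyMeasurable
    (Filter.Eventually.of_forall fun x => ?_)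
  nlinarith [norm_nonneg (φ x), abs_nonneg (Real.log (modulus x))]

lemma exists_bump_integral {V : Set F} (hV : V ∈ 𝓝 (1 : F)) :
    ∃ r : F → ℝ, (fun x => (r x : ℂ)) ∈ puncturedTestFunctions 𝒮 ∧ (∀ x, 0 ≤ r x) ∧
      (∀ x, x ∉ V → r x = 0) ∧ 0 < ∫ x, r x ∂μ ∧ 0 < ∫ x, r x ∂(multHaar μ) := by
  obtain ⟨r, hr, hr_nonneg, hr_one, hr_zero⟩ := H.bump V hV
  have hc : Continuous r := by
    have := Complex.continuous_re.comp (H.continuous _ hr.1)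
    exact this
  have hz : r 0 = 0 := by simpa using hr.2.2.self_of_nhds
  have hpos : ∃ᶠ x in ae μ, 0 < r x := by
    intro hne
    have hopen : IsOpen {x | 0 < r x} := isOpen_lt continuous_const hc
    have hmeas_pos := hopen.measure_pos μ ⟨1, lt_of_le_of_ne (hr_nonneg 1) (Ne.symm hr_one)⟩
    have hmeas_zero : μ {x | 0 < r x} = 0 := by
      rw [ae_iff] at hne; simpa using hne
    exact hmeas_pos.ne' hmeas_zero
  have hi : Integrable r μ := by
    simpa using (H.integrable (μ := μ) hr.1).re
  have hi_mult : Integrable r (multHaar μ) := by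
    simpa using (H.integrable_multHaar_of_zero (μ := μ) hr.1 (by simp [hz])).re
  refine ⟨r, hr, hr_nonneg, hr_zero, ?_, ?_⟩
  · refine lt_of_le_of_ne (integral_nonneg hr_nonneg) fun h => ?_
    have := (integral_eq_zero_iff_of_nonneg hr_nonneg hi).1 h.symm
    exact hpos (this.mono fun x hx => by simp [hx])
  · refine lt_of_le_of_ne (integral_nonneg hr_nonneg) fun h => ?_
    have := (integral_eq_zero_iff_of_nonneg hr_nonneg hi_mult).1 h.symm
    have hae : ∀ᵐ x ∂μ, r x = 0 := (absolutelyContinuous_multHaar μ).ae_le this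
    exact hpos (hae.mono fun x hx => by simp [hx])

end IsSchwartzBruhatLike

end TestFunctions

lemma exists_re_addChar_lt_one {G : Type*} [AddMonoid G] {ψ : AddChar G Circle} (hψ1 : ψ ≠ 1) :
    ∃ a, (ψ a : ℂ).re < 1 := by
  by_contra! h
  refine hψ1 (DFunLike.ext _ _ fun a => Circle.ext ?_)
  have hnorm : ‖(ψ a : ℂ)‖ = 1 := Circle.norm_coe _
  have hre : (ψ a : ℂ).re = 1 := ((Complex.re_le_norm _).trans_eq hnorm).antisymm (h a)
  have him : (ψ a : ℂ).im = 0 := Complex.abs_re_eq_norm.1 (by rw [hre, hnorm, abs_one])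
  simpa using Complex.ext hre him

section SelfDual

variable {F : Type} [NontriviallyNormedField F] [ProperSpace F] [MeasurableSpace F] [BorelSpace F]
  {ψ : AddChar F Circle} {𝒮 : Set (F → ℂ)} {μ : Measure F} [μ.IsAddHaarMeasure]

-- By Fubini, both sides are `∫∫ g(t) ℱf(t x) dt dx` with `dt`, `dx` additive.
lemma integral_fourier_mul_symm (hψ : Continuous ψ) {f g : F → ℂ} (hfm : Measurable f)
    (hgm : Measurable g) (hf : Integrable f μ) (hg : Integrable g μ)
    (hf' : Integrable f (multHaar μ)) (hg' : Integrable g (multHaar μ))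
    (hff : Integrable (fourier ψ μ f) μ) (hgf : Integrable (fourier ψ μ g) μ) :
    (∫ x, g x ∂(multHaar μ)) * ∫ x, fourier ψ μ f x ∂μ =
      (∫ x, f x ∂(multHaar μ)) * ∫ x, fourier ψ μ g x ∂μ := by
  have fubini {h G : F → ℂ} (hh : Measurable h) (hG : Measurable G)
      (hhν : Integrable h (multHaar μ)) (hGμ : Integrable G μ) :
      (∫ x, h x ∂(multHaar μ)) * ∫ x, G x ∂μ = ∫ x, ∫ t, h t * G (t * x) ∂μ ∂μ := by
    simpa only [one_mul, integral_mul_const] using integral_mul_integral_comp_div μ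
      (w := fun _ => 1) (a := fun _ => 1) (b := fun _ => 1) hh hG measurable_const (by simp)
      (by simpa using hhν.norm) (by simpa using hGμ.norm)
  rw [fubini hgm (continuous_fourier hψ hf).measurable hg' hff,
    fubini hfm (continuous_fourier hψ hg).measurable hf' hgf]
  refine integral_congr_ae ?_
  filter_upwards [ae_ne_zero μ] with x hx
  exact integral_mul_fourier_dilate hψ hf hg hx

namespace IsSchwartzBruhatLike

variable (H : IsSchwartzBruhatLike ψ 𝒮) {φ η : F → ℂ}
include H

lemma integrable_fourier (hφ : φ ∈ 𝒮) : Integrable (fourier ψ μ φ) μ :=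
  H.integrable (H.fourier_mem μ φ hφ)

lemma sub_mem (hφ : φ ∈ 𝒮) (hη : η ∈ 𝒮) : (fun x => φ x - η x) ∈ 𝒮 := by
  have := H.add_mem _ hφ _ (H.smul_mem (-1) _ hη)
  simpa [sub_eq_add_neg] using this

lemma neg_mem (hφ : φ ∈ 𝒮) : (fun x => φ (-x)) ∈ 𝒮 := by
  have := H.dilate_mem (-1) (by simp) _ hφ
  simpa using this

lemma integral_char_mul_mul_integral_fourier (hψ : Continuous ψ) (hφ : φ ∈ 𝒮) (h0 : φ 0 = 0)
    (a : F) :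
    (∫ x, ψ (x * a) * φ x ∂(multHaar μ)) * ∫ x, fourier ψ μ φ x ∂μ =
      (∫ x, φ x ∂(multHaar μ)) * ∫ x, fourier ψ μ φ x ∂μ := by
  have hψm : Continuous fun x : F => (ψ (x * a) : ℂ) := by fun_prop
  have hbound : ∀ x, ‖(ψ (x * a) : ℂ)‖ ≤ 1 := fun x => (Circle.norm_coe _).le
  have hfourier : (fourier ψ μ fun x => ψ (x * a) * φ x) = fun y => fourier ψ μ φ (y - a) :=
    funext (fourier_char_mul a φ)
  have h := integral_fourier_mul_symm (g := fun x => ψ (x * a) * φ x) hψ (H.measurable hφ)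
    (hψm.measurable.mul (H.measurable hφ)) (H.integrable (μ := μ) hφ)
    ((H.integrable hφ).bdd_mul hψm.aestronglyMeasurable (.of_forall hbound))
    (H.integrable_multHaar_of_zero hφ h0)
    ((H.integrable_multHaar_of_zero hφ h0).bdd_mul hψm.aestronglyMeasurable (.of_forall hbound))
    (H.integrable_fourier hφ)
    (by rw [hfourier]; exact (H.integrable_fourier hφ).comp_sub_right a)
  rwa [hfourier, integral_sub_right_eq_self (fourier ψ μ φ) a] at h

lemma exists_integral_fourier_eq_zero (hψ : Continuous ψ) (hψ1 : ψ ≠ 1) :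
    ∃ ρ ∈ 𝒮, ρ 0 = 0 ∧ ∫ x, ρ x ∂(multHaar μ) ≠ 0 ∧ ∫ x, fourier ψ μ ρ x ∂μ = 0 := by
  obtain ⟨a, ha⟩ := exists_re_addChar_lt_one hψ1
  obtain ⟨c, hac, hc1⟩ := exists_between ha
  have hcont : Continuous fun x : F => (ψ (x * a) : ℂ).re := by fun_prop
  obtain ⟨r, hr, hr0, hrV, -, hrpos⟩ := H.exists_bump_integral (μ := μ)
    ((isOpen_lt hcont continuous_const).mem_nhds (by simpa using hac) :
      {x : F | (ψ (x * a) : ℂ).re < c} ∈ 𝓝 (1 : F))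
  have hρ0 : (r 0 : ℂ) = 0 := hr.2.2.self_of_nhds
  have hρν := H.integrable_multHaar_of_zero (μ := μ) hr.1 hρ0
  have hτν : Integrable (fun x => (ψ (x * a) : ℂ) * r x) (multHaar μ) :=
    hρν.bdd_mul (by fun_prop : Continuous fun x : F => (ψ (x * a) : ℂ)).aestronglyMeasurable
      (.of_forall fun x => (Circle.norm_coe _).le)
  have hρint : ∫ x, (r x : ℂ) ∂(multHaar μ) ≠ 0 := by
    rw [integral_complex_ofReal]
    exact_mod_cast hrpos.ne'
  refine ⟨_, hr.1, hρ0, hρint, by_contra fun hne => ?_⟩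
  have heq := congrArg Complex.re
    (mul_right_cancel₀ hne (H.integral_char_mul_mul_integral_fourier (μ := μ) hψ hr.1 hρ0 a))
  rw [integral_complex_ofReal, Complex.ofReal_re, ← RCLike.re_eq_complex_re,
    ← integral_re hτν] at heq
  have hle : ∫ x, r x ∂(multHaar μ) ≤ ∫ x, c * r x ∂(multHaar μ) := by
    rw [← heq]
    refine integral_mono hτν.re (Integrable.const_mul (by simpa using hρν.re) c) fun x => ?_
    simp only [RCLike.re_eq_complex_re, Complex.re_mul_ofReal]
    by_cases hx : (ψ (x * a) : ℂ).re < c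
    · exact mul_le_mul_of_nonneg_right hx.le (hr0 x)
    · simp [hrV x hx]
  rw [integral_const_mul] at hle
  exact (mul_lt_of_lt_one_left hrpos hc1).not_ge hle

lemma integral_fourier_eq_zero (hψ : Continuous ψ) (hψ1 : ψ ≠ 1) (hφ : φ ∈ 𝒮) (h0 : φ 0 = 0) :
    ∫ x, fourier ψ μ φ x ∂μ = 0 := by
  obtain ⟨ρ, hρ, hρ0, hρν, hρF⟩ := H.exists_integral_fourier_eq_zero (μ := μ) hψ hψ1
  have h := integral_fourier_mul_symm hψ (H.measurable hρ) (H.measurable hφ)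
    (H.integrable (μ := μ) hρ) (H.integrable hφ) (H.integrable_multHaar_of_zero hρ hρ0)
    (H.integrable_multHaar_of_zero hφ h0) (H.integrable_fourier hρ) (H.integrable_fourier hφ)
  rw [hρF, mul_zero] at h
  exact (mul_eq_zero.1 h.symm).resolve_left hρν

lemma exists_fourier_fourier (hψ : Continuous ψ) (hψ1 : ψ ≠ 1) :
    ∃ c : ℂ, ∀ φ ∈ 𝒮, ∀ x, fourier ψ μ (fourier ψ μ φ) x = c * φ (-x) := by
  obtain ⟨r, hr, -, hr1, -⟩ := H.bump Set.univ Filter.univ_mem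
  set ρ : F → ℂ := fun x => (r 1 : ℂ)⁻¹ * r (x + 1) with hρdef
  have hρ : ρ ∈ 𝒮 := H.smul_mem _ _ (H.translate_mem 1 _ hr.1)
  have hρ0 : ρ 0 = 1 := by
    have : (r 1 : ℂ) ≠ 0 := by exact_mod_cast hr1
    simp [hρdef, this]
  have hint : ∀ φ ∈ 𝒮, ∫ y, fourier ψ μ φ y ∂μ = (∫ y, fourier ψ μ ρ y ∂μ) * φ 0 := by
    intro φ hφ
    have hmem := H.smul_mem (φ 0) _ hρ
    have hzero := H.integral_fourier_eq_zero (μ := μ) hψ hψ1 (H.sub_mem hφ hmem) (by simp [hρ0])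
    have hsub : ∀ y, fourier ψ μ (fun x => φ x - φ 0 * ρ x) y =
        fourier ψ μ φ y + (-φ 0) * fourier ψ μ ρ y := by
      intro y
      rw [← fourier_smul, ← fourier_add hψ (H.integrable hφ)
        (H.integrable (H.smul_mem (-φ 0) _ hρ))]
      congr 1; ext x; ring
    simp only [hsub] at hzero
    rw [integral_add (H.integrable_fourier hφ) ((H.integrable_fourier hρ).const_mul _),
      integral_const_mul] at hzero
    linear_combination hzero
  refine ⟨∫ y, fourier ψ μ ρ y ∂μ, fun φ hφ x => ?_⟩
  have h := hint _ (H.translate_mem (-x) _ hφ)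
  rw [zero_add] at h
  rw [← h, fourier_apply]
  congr 1 with y
  rw [fourier_comp_add]
  ring_nf

lemma plancherel_const (hψ : Continuous ψ) {c : ℂ}
    (hc : ∀ φ ∈ 𝒮, ∀ x, fourier ψ μ (fourier ψ μ φ) x = c * φ (-x)) (hφ : φ ∈ 𝒮) (hη : η ∈ 𝒮) :
    ∫ y, fourier ψ μ φ y * conj (fourier ψ μ η y) ∂μ = c * ∫ x, φ x * conj (η x) ∂μ := by
  have hη' := H.conj_mem _ hη
  have hconj : (fun y => conj (fourier ψ μ η y)) =
      fun y => fourier ψ μ (fun x => conj (η x)) ((-1) * y) := by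
    ext y; rw [conj_fourier, neg_one_mul]
  have hparseval := integral_fourier_mul hψ (H.integrable (μ := μ) hφ)
    (H.integrable (μ := μ) (H.conj_mem _ (H.fourier_mem μ _ hη)))
  rw [hparseval, ← integral_const_mul]
  congr 1 with x
  rw [hconj, fourier_comp_mul (by simp), hc _ hη']
  simp
  ring_nf

lemma integral_sq_norm_pos (hφ : φ ∈ 𝒮) {x : F} (hx : φ x ≠ 0) : 0 < ∫ x, ‖φ x‖ ^ 2 ∂μ := by
  rw [integral_pos_iff_support_of_nonneg (fun x => by positivity)
    ((memLp_two_iff_integrable_sq_norm (H.measurable hφ).aestronglyMeasurable).1 (H.memLp hφ))]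
  exact ((H.continuous _ hφ).norm.pow 2).isOpen_support.measure_pos μ ⟨x, by simpa using hx⟩

lemma exists_fourier_fourier_eq_nnreal (hψ : Continuous ψ) (hψ1 : ψ ≠ 1) :
    ∃ c : NNReal, c ≠ 0 ∧ ∀ φ ∈ 𝒮, ∀ x, fourier ψ μ (fourier ψ μ φ) x = (c : ℂ) * φ (-x) := by
  obtain ⟨c, hc⟩ := H.exists_fourier_fourier (μ := μ) hψ hψ1
  obtain ⟨r, hr, -, -, hrpos, -⟩ := H.exists_bump_integral (μ := μ) Filter.univ_mem
  set ρ : F → ℂ := fun x => r x with hρ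
  have hFρ : fourier ψ μ ρ 0 ≠ 0 := by
    simp only [fourier_apply, mul_zero, neg_zero, AddChar.map_zero_eq_one, Circle.coe_one, one_mul,
      hρ]
    rw [integral_complex_ofReal]
    exact_mod_cast hrpos.ne'
  obtain ⟨x, hx⟩ : ∃ x, ρ x ≠ 0 := by
    by_contra! h
    exact hFρ (by simp [fourier_apply, h])
  have hnum := H.integral_sq_norm_pos (μ := μ) (H.fourier_mem μ _ hr.1) hFρ
  have hden := H.integral_sq_norm_pos (μ := μ) hr.1 hx
  have hplancherel := H.plancherel_const (μ := μ) hψ hc hr.1 hr.1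
  simp only [Complex.mul_conj'] at hplancherel
  norm_cast at hplancherel
  refine ⟨_, (Real.toNNReal_pos.2 (div_pos hnum hden)).ne', fun φ hφ x => ?_⟩
  rw [hc φ hφ, Real.coe_toNNReal _ (div_pos hnum hden).le]
  congr 1
  push_cast
  rw [eq_div_iff (by exact_mod_cast hden.ne')]
  exact hplancherel.symm

end IsSchwartzBruhatLike

lemma IsSchwartzBruhatLike.existsUnique_isSelfDualMeasure (H : IsSchwartzBruhatLike ψ 𝒮)
    (hψ : Continuous ψ) (hψ1 : ψ ≠ 1) : ∃! μ : Measure F, IsSelfDualMeasure ψ μ 𝒮 := by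
  obtain ⟨c, hc0, hc⟩ :=
    H.exists_fourier_fourier_eq_nnreal (μ := Measure.addHaar) hψ hψ1
  set k : NNReal := (NNReal.sqrt c)⁻¹
  have hk : k ^ 2 * c = 1 := by rw [inv_pow, NNReal.sq_sqrt, inv_mul_cancel₀ hc0]
  refine ⟨k • Measure.addHaar, ⟨?_, fun φ hφ x => ?_⟩, fun ν ⟨_, hν⟩ => ?_⟩
  · exact Measure.IsAddHaarMeasure.nnreal_smul _ (inv_ne_zero (by simpa using hc0))
  · rw [fourier_fourier_smul_measure, hc φ hφ, ← mul_assoc]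
    norm_cast
    rw [hk, NNReal.coe_one, Complex.ofReal_one, one_mul]
  · have hνk := Measure.isAddLeftInvariant_eq_smul ν (Measure.addHaar : Measure F)
    set j := ν.addHaarScalarFactor (Measure.addHaar : Measure F)
    obtain ⟨r, hr, -, hr1, -⟩ := H.bump Set.univ Filter.univ_mem
    have hj := hν _ hr.1 (-1)
    rw [hνk, fourier_fourier_smul_measure, hc _ hr.1, neg_neg, ← mul_assoc] at hj
    norm_cast at hj
    have hjc : j ^ 2 * c = 1 := by
      exact_mod_cast mul_right_cancel₀ hr1 (hj.trans (one_mul _).symm)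
    rw [hνk, (pow_left_inj₀ zero_le zero_le two_ne_zero).1
      (mul_right_cancel₀ hc0 (hjc.trans hk.symm))]

end SelfDual

section LogFunctional

lemma norm_log_modulus_div_le {F : Type} [Field F] [TopologicalSpace F] [IsTopologicalRing F]
    [LocallyCompactSpace F] {t x : F} (ht : t ≠ 0) (hx : x ≠ 0) :
    ‖(Real.log (modulus (x / t)) : ℂ)‖ ≤
      (1 + |Real.log (modulus t)|) * (1 + |Real.log (modulus x)|) := by
  rw [Complex.norm_real, Real.norm_eq_abs, modulus_div,
    Real.log_div (modulus_ne_zero hx) (modulus_ne_zero ht)]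
  have := abs_sub (Real.log (modulus x)) (Real.log (modulus t))
  nlinarith [abs_nonneg (Real.log (modulus x)), abs_nonneg (Real.log (modulus t)),
    mul_nonneg (abs_nonneg (Real.log (modulus x))) (abs_nonneg (Real.log (modulus t)))]

variable {F : Type} [NontriviallyNormedField F] [ProperSpace F] [MeasurableSpace F] [BorelSpace F]
  {ψ : AddChar F Circle} {𝒮 : Set (F → ℂ)} {μ : Measure F} [μ.IsAddHaarMeasure]

/-- `∫ log |x| ℱφ(x) dx`: the Fourier transform of the tempered distribution `log |x|`,
evaluated at `φ`. -/
def logFunctional (ψ : AddChar F Circle) (μ : Measure F) (φ : F → ℂ) : ℂ :=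
  ∫ x, (Real.log (modulus x) : ℂ) * fourier ψ μ φ x ∂μ

lemma integrable_log_fourier (H : IsSchwartzBruhatLike ψ 𝒮) {φ : F → ℂ} (hφ : φ ∈ 𝒮) :
    Integrable (fun x => (Real.log (modulus x) : ℂ) * φ x) μ := by
  refine (H.integrable_log (μ := μ) hφ).mono'
    ((Complex.measurable_ofReal.comp measurable_log_modulus).mul
      (H.measurable hφ)).aestronglyMeasurable (Filter.Eventually.of_forall fun x => ?_)
  rw [norm_mul, Complex.norm_real, Real.norm_eq_abs]
  nlinarith [norm_nonneg (φ x), abs_nonneg (Real.log (modulus x))]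

-- Since `∫ ℱf = f 0 = 0`, the functional `∫ log |x| ℱf(x) dx` does not see the shift of `log |x|`
-- produced by a dilation, so it can be averaged over dilations against `g`.
lemma integral_mul_logFunctional (H : IsSchwartzBruhatLike ψ 𝒮) (hψ : Continuous ψ) (hψ1 : ψ ≠ 1)
    {f g : F → ℂ} (hf : f ∈ 𝒮) (hg : g ∈ 𝒮) (hf0 : f 0 = 0) (hg0 : g 0 = 0) :
    (∫ x, g x ∂(multHaar μ)) * logFunctional ψ μ f =
      ∫ x, (Real.log (modulus x) : ℂ) * ∫ t, g t * fourier ψ μ f (t * x) ∂μ ∂μ := by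
  have hff := H.fourier_mem μ _ hf
  rw [← integral_mul_integral_comp_div μ (H.measurable hg) (H.measurable hff)
    (w := fun x => (Real.log (modulus x) : ℂ))
    (Complex.measurable_ofReal.comp measurable_log_modulus)
    (fun _ _ => norm_log_modulus_div_le)
    (H.integrable_log_multHaar hg hg0) (H.integrable_log hff), ← integral_mul_const]
  refine integral_congr_ae ?_
  filter_upwards [multHaar_ae_ne_zero μ] with t ht
  have hlog : ∀ᵐ x ∂μ, (Real.log (modulus (x / t)) : ℂ) * fourier ψ μ f x =
      (Real.log (modulus x) : ℂ) * fourier ψ μ f x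
        - (Real.log (modulus t) : ℂ) * fourier ψ μ f x := by
    filter_upwards [ae_ne_zero μ] with x hx
    rw [modulus_div, Real.log_div (modulus_ne_zero hx) (modulus_ne_zero ht)]
    push_cast; ring
  rw [integral_congr_ae hlog, integral_sub (integrable_log_fourier H hff)
    ((H.integrable hff).const_mul _), integral_const_mul,
    H.integral_fourier_eq_zero hψ hψ1 hf hf0, mul_zero, sub_zero, logFunctional]

lemma integral_mul_logFunctional_comm (H : IsSchwartzBruhatLike ψ 𝒮) (hψ : Continuous ψ)
    (hψ1 : ψ ≠ 1) {f g : F → ℂ} (hf : f ∈ 𝒮) (hg : g ∈ 𝒮) (hf0 : f 0 = 0) (hg0 : g 0 = 0) :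
    (∫ x, g x ∂(multHaar μ)) * logFunctional ψ μ f =
      (∫ x, f x ∂(multHaar μ)) * logFunctional ψ μ g := by
  rw [integral_mul_logFunctional H hψ hψ1 hf hg hf0 hg0,
    integral_mul_logFunctional H hψ hψ1 hg hf hg0 hf0]
  refine integral_congr_ae ?_
  filter_upwards [ae_ne_zero μ] with x hx
  rw [integral_mul_fourier_dilate hψ (H.integrable hf) (H.integrable hg) hx]

lemma exists_logFunctional (H : IsSchwartzBruhatLike ψ 𝒮) (hψ : Continuous ψ) (hψ1 : ψ ≠ 1) :
    ∃ c : ℝ, ∀ φ ∈ 𝒮, φ 0 = 0 → logFunctional ψ μ φ = c * ∫ x, φ x ∂(multHaar μ) := by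
  obtain ⟨r, hr, -, -, -, hpos⟩ := H.exists_bump_integral (μ := μ) Filter.univ_mem
  have hz : r 0 = 0 := by simpa using hr.2.2.self_of_nhds
  set ρ : F → ℂ := fun x => r x with hρ
  have hreal : conj (logFunctional ψ μ ρ) = logFunctional ψ μ ρ := by
    rw [logFunctional, ← integral_conj, ← integral_neg_eq_self]
    congr 1 with x
    rw [map_mul, Complex.conj_ofReal, conj_fourier, modulus_neg, neg_neg]
    simp only [hρ, Complex.conj_ofReal]
  obtain ⟨l, hl⟩ := Complex.conj_eq_iff_real.1 hreal
  refine ⟨l / ∫ x, r x ∂(multHaar μ), fun φ hφ h0 => ?_⟩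
  have h := integral_mul_logFunctional_comm (μ := μ) H hψ hψ1 hφ hr.1 h0 (by simp [hρ, hz])
  change _ = _ * logFunctional ψ μ ρ at h
  rw [integral_complex_ofReal, hl] at h
  have hne : ((∫ x, r x ∂(multHaar μ) : ℝ) : ℂ) ≠ 0 := by exact_mod_cast hpos.ne'
  push_cast
  field_simp
  linear_combination h

end LogFunctional

section AbstractOperators

lemma exists_inner_eq_integral {H : Type*} [NormedAddCommGroup H] [InnerProductSpace ℂ H]
    [CompleteSpace H] {T : Type*} [MeasurableSpace T] {ν : Measure T} {κ : T → ℂ}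
    (hκ : Integrable κ ν) (V : T → H →L[ℂ] H) (hV : ∀ t f, ‖V t f‖ ≤ ‖f‖)
    (hm : ∀ f g, AEStronglyMeasurable (fun t => inner ℂ f (V t g)) ν) :
    ∃ K : H →L[ℂ] H, ∀ f g, inner ℂ f (K g) = ∫ t, κ t * inner ℂ f (V t g) ∂ν := by
  have hb : ∀ f g t, ‖inner ℂ f (V t g)‖ ≤ ‖f‖ * ‖g‖ := fun f g t =>
    (norm_inner_le_norm _ _).trans (by gcongr; exact hV t g)
  have hi : ∀ f g, Integrable (fun t => κ t * inner ℂ f (V t g)) ν := fun f g =>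
    hκ.mul_bdd (c := ‖f‖ * ‖g‖) (hm f g) (Filter.Eventually.of_forall (hb f g))
  let B₀ : H →ₗ⋆[ℂ] H →ₗ[ℂ] ℂ := LinearMap.mk₂'ₛₗ (starRingEnd ℂ) (RingHom.id ℂ)
    (fun f g => ∫ t, κ t * inner ℂ f (V t g) ∂ν)
    (fun f f' g => by
      rw [← integral_add (hi f g) (hi f' g)]
      congr 1 with t
      rw [inner_add_left, mul_add])
    (fun c f g => by
      rw [smul_eq_mul, ← integral_const_mul]
      congr 1 with t
      rw [inner_smul_left]; ring)
    (fun f g g' => by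
      rw [← integral_add (hi f g) (hi f g')]
      congr 1 with t
      rw [map_add, inner_add_right, mul_add])
    (fun c f g => by
      rw [RingHom.id_apply, smul_eq_mul, ← integral_const_mul]
      congr 1 with t
      rw [map_smul, inner_smul_right]; ring)
  let B : H →L⋆[ℂ] H →L[ℂ] ℂ := B₀.mkContinuous₂ (∫ t, ‖κ t‖ ∂ν) (fun f g => by
    calc ‖∫ t, κ t * inner ℂ f (V t g) ∂ν‖ ≤ ∫ t, ‖κ t‖ * (‖f‖ * ‖g‖) ∂ν := by
          refine norm_integral_le_of_norm_le (hκ.norm.mul_const _)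
            (Filter.Eventually.of_forall fun t => ?_)
          rw [norm_mul]
          gcongr
          exact hb f g t
      _ = _ := by rw [integral_mul_const, mul_assoc])
  refine ⟨ContinuousLinearMap.adjoint (InnerProductSpace.continuousLinearMapOfBilin B),
    fun f g => ?_⟩
  rw [ContinuousLinearMap.adjoint_inner_right,
    InnerProductSpace.continuousLinearMapOfBilin_apply]
  rfl

lemma mem_graph_toPMap {R E E' : Type*} [Ring R] [AddCommGroup E] [Module R E] [AddCommGroup E']
    [Module R E'] (f : E →ₗ[R] E') (p : Submodule R E) (y : E × E') :
    y ∈ (f.toPMap p).graph ↔ y.1 ∈ p ∧ f y.1 = y.2 := by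
  rw [LinearPMap.mem_graph_iff]
  constructor
  · rintro ⟨z, hz, hfz⟩
    exact ⟨hz ▸ z.2, by rw [← hz, ← hfz]; rfl⟩
  · rintro ⟨hy, hfy⟩
    exact ⟨⟨y.1, hy⟩, rfl, hfy⟩

lemma closure_toPMap_of_dense {H : Type*} [NormedAddCommGroup H] [InnerProductSpace ℂ H]
    (K : H →L[ℂ] H) {p : Submodule ℂ H} (hp : Dense (p : Set H)) :
    ((K : H →ₗ[ℂ] H).toPMap p).IsClosable ∧
      ((K : H →ₗ[ℂ] H).toPMap p).closure = (K : H →ₗ[ℂ] H).toPMap ⊤ := by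
  have hgraph : ((K : H →ₗ[ℂ] H).toPMap p).graph.topologicalClosure =
      ((K : H →ₗ[ℂ] H).toPMap ⊤).graph := by
    ext ⟨x, y⟩
    rw [← SetLike.mem_coe, Submodule.topologicalClosure_coe, mem_graph_toPMap]
    constructor
    · intro hxy
      have hclosed : IsClosed {z : H × H | K z.1 = z.2} :=
        isClosed_eq (K.continuous.comp continuous_fst) continuous_snd
      exact ⟨trivial, hclosed.closure_subset_iff.2
        (fun z hz => ((mem_graph_toPMap _ p z).1 hz).2) hxy⟩
    · rintro ⟨-, rfl : K x = y⟩
      have hxy : (x, K x) ∈ closure ((fun z => (z, K z)) '' (p : Set H)) :=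
        image_closure_subset_closure_image (by fun_prop) (Set.mem_image_of_mem _ (hp x))
      refine closure_mono ?_ hxy
      rintro _ ⟨z, hz, rfl⟩
      exact (mem_graph_toPMap _ p _).2 ⟨hz, rfl⟩
  have hclosable : ((K : H →ₗ[ℂ] H).toPMap p).IsClosable := ⟨_, hgraph⟩
  refine ⟨hclosable, LinearPMap.eq_of_eq_graph ?_⟩
  rw [← hclosable.graph_closure_eq_closure_graph, hgraph]

lemma isEssentiallySelfAdjoint_toPMap {H : Type*} [NormedAddCommGroup H] [InnerProductSpace ℂ H]
    [CompleteSpace H] (K : H →L[ℂ] H) (hK : ContinuousLinearMap.adjoint K = K)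
    {p : Submodule ℂ H} (hp : Dense (p : Set H)) :
    IsEssentiallySelfAdjoint ((K : H →ₗ[ℂ] H).toPMap p) := by
  obtain ⟨h1, h2⟩ := closure_toPMap_of_dense K hp
  refine ⟨hp, h1, ?_⟩
  rw [h2, LinearPMap.isSelfAdjoint_def,
    ContinuousLinearMap.toPMap_adjoint_eq_adjoint_toPMap_of_dense K (by simp), hK]

end AbstractOperators

section WeightedComposition

variable {F : Type} [MeasurableSpace F] {μ : Measure F}

lemma quasiMeasurePreserving_of_lintegral_mul_comp {w : F → ℂ} {g : F → F} (hw : Measurable w)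
    (hg : Measurable g) (hw0 : ∀ᵐ x ∂μ, w x ≠ 0)
    (h : ∀ u : F → ENNReal, Measurable u → ∫⁻ x, ‖w x‖ₑ ^ 2 * u (g x) ∂μ = ∫⁻ x, u x ∂μ) :
    Measure.QuasiMeasurePreserving g μ μ := by
  refine ⟨hg, Measure.AbsolutelyContinuous.mk fun s hs hs0 => ?_⟩
  rw [Measure.map_apply hg hs]
  have hnull := h (s.indicator 1) (measurable_one.indicator hs)
  have hm : Measurable fun x => ‖w x‖ₑ ^ 2 * s.indicator (1 : F → ENNReal) (g x) :=
    (hw.enorm.pow_const 2).mul ((measurable_one.indicator hs).comp hg)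
  rw [lintegral_indicator_one hs, hs0, lintegral_eq_zero_iff hm] at hnull
  rw [measure_eq_zero_iff_ae_notMem]
  filter_upwards [hnull, hw0] with x hx hx0 hxs
  have hxs' : g x ∈ s := hxs
  simp [hxs', hx0] at hx

lemma exists_linearIsometry_mul_comp {w : F → ℂ} {g : F → F} (hw : Measurable w)
    (hg : Measurable g) (hw0 : ∀ᵐ x ∂μ, w x ≠ 0)
    (h : ∀ u : F → ENNReal, Measurable u → ∫⁻ x, ‖w x‖ₑ ^ 2 * u (g x) ∂μ = ∫⁻ x, u x ∂μ) :
    ∃ U : Lp ℂ 2 μ →ₗᵢ[ℂ] Lp ℂ 2 μ, ∀ f, U f =ᵐ[μ] fun x => w x * f (g x) := by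
  have hq := quasiMeasurePreserving_of_lintegral_mul_comp hw hg hw0 h
  have hnorm : ∀ f : Lp ℂ 2 μ, eLpNorm (fun x => w x * f (g x)) 2 μ = eLpNorm f 2 μ := by
    intro f
    rw [eLpNorm_eq_lintegral_rpow_enorm_toReal (by simp) (by simp),
      eLpNorm_eq_lintegral_rpow_enorm_toReal (by simp) (by simp)]
    congr 1
    rw [← h (fun x => ‖f x‖ₑ ^ (2 : ENNReal).toReal)
      ((Lp.stronglyMeasurable f).measurable.enorm.pow_const _)]
    refine lintegral_congr fun x => ?_
    simp [enorm_mul, mul_pow]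
  have hmem : ∀ f : Lp ℂ 2 μ, MemLp (fun x => w x * f (g x)) 2 μ := fun f =>
    ⟨(hw.mul ((Lp.stronglyMeasurable f).measurable.comp hg)).aestronglyMeasurable, by
      rw [hnorm]; exact (Lp.memLp f).2⟩
  refine ⟨⟨⟨⟨fun f => (hmem f).toLp, fun f f' => ?_⟩, fun c f => ?_⟩, fun f => ?_⟩, fun f =>
    (hmem f).coeFn_toLp⟩
  · rw [← MemLp.toLp_add]
    refine MemLp.toLp_congr _ _ ?_
    filter_upwards [hq.ae (Lp.coeFn_add f f')] with x hx
    simp only [hx, Pi.add_apply, mul_add]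
  · simp only [RingHom.id_apply]
    rw [← MemLp.toLp_const_smul]
    refine MemLp.toLp_congr _ _ ?_
    filter_upwards [hq.ae (Lp.coeFn_smul c f)] with x hx
    simp only [hx, Pi.smul_apply, smul_eq_mul]
    ring
  · change ‖(hmem f).toLp‖ = ‖f‖
    rw [Lp.norm_toLp, hnorm, Lp.norm_def]

lemma exists_linearIsometryEquiv_mul_comp {w w' : F → ℂ} {g g' : F → F} (hw : Measurable w)
    (hg : Measurable g) (hw0 : ∀ᵐ x ∂μ, w x ≠ 0)
    (h : ∀ u : F → ENNReal, Measurable u → ∫⁻ x, ‖w x‖ₑ ^ 2 * u (g x) ∂μ = ∫⁻ x, u x ∂μ)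
    (hw' : Measurable w') (hg' : Measurable g') (hw0' : ∀ᵐ x ∂μ, w' x ≠ 0)
    (h' : ∀ u : F → ENNReal, Measurable u → ∫⁻ x, ‖w' x‖ₑ ^ 2 * u (g' x) ∂μ = ∫⁻ x, u x ∂μ)
    (hinv : ∀ᵐ x ∂μ, w x * w' (g x) = 1 ∧ g' (g x) = x) :
    ∃ U : Lp ℂ 2 μ ≃ₗᵢ[ℂ] Lp ℂ 2 μ, ∀ f, U f =ᵐ[μ] fun x => w x * f (g x) := by
  obtain ⟨U, hU⟩ := exists_linearIsometry_mul_comp hw hg hw0 h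
  obtain ⟨U', hU'⟩ := exists_linearIsometry_mul_comp hw' hg' hw0' h'
  have hq := quasiMeasurePreserving_of_lintegral_mul_comp hw hg hw0 h
  refine ⟨LinearIsometryEquiv.ofSurjective U fun f => ⟨U' f, ?_⟩, hU⟩
  refine Lp.ext ?_
  filter_upwards [hU (U' f), hq.ae (hU' f), hinv] with x h1 h2 h3
  rw [h1, h2, h3.2, ← mul_assoc, h3.1, one_mul]

end WeightedComposition

section DilationInversion

variable {F : Type} [NontriviallyNormedField F] [ProperSpace F] [MeasurableSpace F] [BorelSpace F]
  (μ : Measure F) [μ.IsAddHaarMeasure]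

lemma lintegral_dilation {t : F} (ht : t ≠ 0) (u : F → ENNReal) :
    ∫⁻ x, ‖((Real.sqrt (modulus t))⁻¹ : ℂ)‖ₑ ^ 2 * u (x / t) ∂μ = ∫⁻ x, u x ∂μ := by
  have hp := modulus_pos ht
  have hweight : ‖((Real.sqrt (modulus t))⁻¹ : ℂ)‖ₑ ^ 2 = ENNReal.ofReal (modulus t)⁻¹ := by
    rw [← ofReal_norm, ← ENNReal.ofReal_pow (norm_nonneg _), norm_inv,
      Complex.norm_real, Real.norm_of_nonneg (Real.sqrt_nonneg _), inv_pow, Real.sq_sqrt hp.le]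
  rw [hweight, lintegral_const_mul' _ _ ENNReal.ofReal_ne_top]
  simp_rw [div_eq_inv_mul]
  rw [lintegral_comp_mul_left μ (inv_ne_zero ht), ← mul_assoc,
    ← ENNReal.ofReal_mul (inv_nonneg.2 hp.le), modulus_inv, inv_inv, inv_mul_cancel₀ hp.ne']
  simp

lemma exists_linearIsometryEquiv_dilation (t : Fˣ) :
    ∃ U : Lp ℂ 2 μ ≃ₗᵢ[ℂ] Lp ℂ 2 μ, ∀ f : Lp ℂ 2 μ, U f =ᵐ[μ] dilation t f := by
  have ht : (t : F) ≠ 0 := t.ne_zero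
  have hp := modulus_pos ht
  have hs : (Real.sqrt (modulus (t : F)) : ℂ) ≠ 0 := by
    exact_mod_cast (Real.sqrt_pos.2 hp).ne'
  have h := exists_linearIsometryEquiv_mul_comp (μ := μ)
    (w := fun _ => ((Real.sqrt (modulus (t : F)))⁻¹ : ℂ)) (g := fun x => x / t)
    (w' := fun _ => ((Real.sqrt (modulus (t : F)⁻¹))⁻¹ : ℂ)) (g' := fun x => x / (t : F)⁻¹)
    measurable_const (measurable_id.div_const _) (by simp [hs])
    (fun u _ => lintegral_dilation μ ht u) measurable_const (measurable_id.div_const _)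
    (by simp [hs]) (fun u _ => lintegral_dilation μ (inv_ne_zero ht) u)
    (Filter.Eventually.of_forall fun x => ⟨by simp [hs], by field_simp⟩)
  exact h

lemma lintegral_inversion {u : F → ENNReal} (hu : Measurable u) :
    ∫⁻ x, ‖((modulus x)⁻¹ : ℂ)‖ₑ ^ 2 * u x⁻¹ ∂μ = ∫⁻ x, u x ∂μ := by
  have h := (measurePreserving_inv μ).lintegral_comp
    (f := fun x => ENNReal.ofReal (modulus x) * u x) (measurable_modulus.ennreal_ofReal.mul hu)
  rw [lintegral_multHaar μ (f := fun x => ENNReal.ofReal (modulus x) * u x)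
      (measurable_modulus.ennreal_ofReal.mul hu),
    lintegral_multHaar μ (f := fun x => ENNReal.ofReal (modulus x⁻¹) * u x⁻¹)
      ((measurable_modulus.comp measurable_inv).ennreal_ofReal.mul (hu.comp measurable_inv))] at h
  have hcancel : ∫⁻ x, ENNReal.ofReal (modulus x)⁻¹ * (ENNReal.ofReal (modulus x) * u x) ∂μ =
      ∫⁻ x, u x ∂μ := by
    refine lintegral_congr_ae ?_
    filter_upwards [ae_ne_zero μ] with x hx
    have hp := modulus_pos hx
    rw [← mul_assoc, ← ENNReal.ofReal_mul (inv_nonneg.2 hp.le), inv_mul_cancel₀ hp.ne']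
    simp
  rw [← hcancel, ← h]
  refine lintegral_congr fun x => ?_
  have hmod := modulus_nonneg x
  rw [← mul_assoc, modulus_inv, ← ENNReal.ofReal_mul (inv_nonneg.2 hmod), ← ofReal_norm,
    ← ENNReal.ofReal_pow (norm_nonneg _), norm_inv, Complex.norm_real, Real.norm_of_nonneg hmod, sq]

lemma exists_linearIsometryEquiv_inversion :
    ∃ U : Lp ℂ 2 μ ≃ₗᵢ[ℂ] Lp ℂ 2 μ, ∀ f : Lp ℂ 2 μ, U f =ᵐ[μ] inversion f := by
  have hw : Measurable fun x : F => ((modulus x)⁻¹ : ℂ) :=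
    (Complex.measurable_ofReal.comp measurable_modulus).inv
  have hw0 : ∀ᵐ x ∂μ, ((modulus x)⁻¹ : ℂ) ≠ 0 := by
    filter_upwards [ae_ne_zero μ] with x hx
    simpa using modulus_ne_zero hx
  refine exists_linearIsometryEquiv_mul_comp (μ := μ) (g := fun x => x⁻¹) (g' := fun x => x⁻¹)
    hw measurable_inv hw0 (fun u hu => lintegral_inversion μ hu) hw measurable_inv hw0
    (fun u hu => lintegral_inversion μ hu) ?_
  filter_upwards [ae_ne_zero μ] with x hx
  have : (modulus x : ℂ) ≠ 0 := by exact_mod_cast modulus_ne_zero hx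
  exact ⟨by simp [this], inv_inv x⟩

end DilationInversion

section LogKernel

variable {F : Type} [Field F] [TopologicalSpace F] [IsTopologicalRing F] [LocallyCompactSpace F]

/-- The kernel `log |t| |t|^{1/2} / |1 - t|` against which the commutator is, up to a constant, a
multiplicative convolution. -/
def logKernel (t : F) : ℝ :=
  Real.log (modulus t) * modulus t ^ (1 / 2 : ℝ) / modulus (1 - t)

lemma logKernel_inv {t : F} (ht : t ≠ 0) : logKernel t⁻¹ = -logKernel t := by
  have hp := modulus_pos ht
  have hsub : (1 : F) - t⁻¹ = -((1 - t) / t) := by field_simp; ring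
  unfold logKernel
  rw [hsub, modulus_neg, modulus_div, modulus_inv, Real.log_inv, Real.inv_rpow hp.le]
  have hsq : modulus t = modulus t ^ (1 / 2 : ℝ) * modulus t ^ (1 / 2 : ℝ) := by
    rw [← Real.rpow_add hp]; norm_num
  have hroot := (Real.rpow_pos_of_pos hp (1 / 2)).ne'
  rcases eq_or_ne (modulus (1 - t)) 0 with h0 | h0
  · simp [h0]
  · set q := modulus t ^ (1 / 2 : ℝ)
    generalize Real.log (modulus t) = l
    rw [hsq]
    field_simp

lemma abs_logKernel (t : F) :
    |logKernel t| = |Real.log (modulus t)| * modulus t ^ (1 / 2 : ℝ) / modulus (1 - t) := by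
  have := modulus_nonneg t
  rw [logKernel, abs_div, abs_mul, abs_of_nonneg (modulus_nonneg (1 - t)),
    abs_of_nonneg (a := modulus t ^ _) (by positivity)]

-- At `t = 1` both sides vanish by the convention `0⁻¹ = 0`.
lemma inv_modulus_sub_mul_log_sub_log {x t : F} (hx : x ≠ 0) (ht : t ≠ 0) :
    ((modulus (x / t - x))⁻¹ : ℂ) * (Real.log (modulus (x / t)) - Real.log (modulus x)) *
      modulus (x / t) = -logKernel t * (Real.sqrt (modulus t))⁻¹ := by
  have hp := modulus_pos ht
  have hpx := modulus_pos hx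
  have hsub : x / t - x = x * (1 - t) / t := by field_simp
  have hsqrt : (Real.sqrt (modulus t) : ℂ) ≠ 0 := by exact_mod_cast (Real.sqrt_pos.2 hp).ne'
  have hpC : (modulus t : ℂ) ≠ 0 := by exact_mod_cast hp.ne'
  have hpxC : (modulus x : ℂ) ≠ 0 := by exact_mod_cast hpx.ne'
  rw [hsub, logKernel, ← Real.sqrt_eq_rpow]
  simp only [modulus_div, modulus_mul, Real.log_div hpx.ne' hp.ne']
  push_cast
  rcases eq_or_ne (modulus (1 - t) : ℂ) 0 with h0 | h0
  · simp [h0]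
  · field_simp
    ring

end LogKernel

section Kernel

variable {F : Type} [NontriviallyNormedField F] [ProperSpace F]

lemma log_mul_rpow_le_two_mul_mellinWeight (σ : ℝ) {x : F} (hx : modulus x ≤ 1) :
    (1 + |Real.log (modulus x)|) * modulus x ^ σ ≤ 2 * mellinWeight σ x := by
  have := modulus_nonneg x
  have hnum : 0 ≤ (1 + |Real.log (modulus x)|) * modulus x ^ σ := by positivity
  rw [mellinWeight, ← mul_div_assoc, le_div_iff₀ (by linarith)]
  nlinarith

lemma exists_modulus_le_mul_modulus_sub :
    ∃ A : ℝ, 0 < A ∧ ∀ x y : F, 2 * ‖y‖ ≤ ‖x‖ → modulus x ≤ A * modulus (y - x) := by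
  obtain ⟨t, ht, ht_half⟩ := NormedField.exists_norm_lt F (one_half_pos (α := ℝ))
  have htp := modulus_pos (norm_pos_iff.1 ht)
  refine ⟨(modulus t)⁻¹, inv_pos.2 htp, fun x y hxy => ?_⟩
  rw [← div_eq_inv_mul, le_div_iff₀' htp, ← modulus_mul]
  apply modulus_le_of_norm_le
  rw [norm_mul]
  have := norm_sub_norm_le x y
  rw [norm_sub_rev] at this
  nlinarith [norm_nonneg x]

lemma exists_abs_logKernel_le_of_le_norm {ε : ℝ} (hε : 0 < ε) :
    ∃ C : ℝ, 0 ≤ C ∧ ∀ t : F, ‖t‖ ≤ 1 → ε ≤ ‖1 - t‖ →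
      |logKernel t| ≤ C * mellinWeight (1 / 2) t := by
  obtain ⟨t₁, ht₁, ht₁_norm⟩ := NormedField.exists_norm_lt F hε
  have hm₁ := modulus_pos (norm_pos_iff.1 ht₁)
  refine ⟨(modulus t₁)⁻¹ * 2, by positivity, fun t ht hεt => ?_⟩
  have hp := modulus_nonneg t
  have hnum : |Real.log (modulus t)| * modulus t ^ (1 / 2 : ℝ) ≤ 2 * mellinWeight (1 / 2) t :=
    le_trans (by gcongr; linarith)
      (log_mul_rpow_le_two_mul_mellinWeight _ (modulus_le_one ht))
  calc |logKernel t| ≤ 2 * mellinWeight (1 / 2) t / modulus t₁ := by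
        have := mellinWeight_nonneg (1 / 2) t
        rw [abs_logKernel]
        gcongr
        exact modulus_le_of_norm_le (ht₁_norm.le.trans hεt)
    _ = _ := by ring

variable [MeasurableSpace F] [BorelSpace F] {ψ : AddChar F Circle} {𝒮 : Set (F → ℂ)}
  {μ : Measure F} [μ.IsAddHaarMeasure]

lemma measurable_logKernel : Measurable (logKernel : F → ℝ) :=
  (measurable_log_modulus.mul (measurable_modulus.pow_const _)).div
    (measurable_modulus.comp (measurable_const.sub measurable_id))

lemma exists_abs_log_modulus_le (H : IsSchwartzBruhatLike ψ 𝒮) :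
    ∃ ε > 0, ε ≤ 1 / 2 ∧ ∃ C : ℝ, 0 ≤ C ∧ ∀ t : F, ‖1 - t‖ < ε →
      |Real.log (modulus t)| ≤ C * modulus (1 - t) ^ (1 / 2 : ℝ) := by
  obtain ⟨r, hr, hr0, hr1, -⟩ := H.bump Set.univ Filter.univ_mem
  have hcont : Continuous r := Complex.continuous_re.comp (H.continuous _ hr.1)
  have hpos : 0 < r 1 := lt_of_le_of_ne (hr0 1) (Ne.symm hr1)
  obtain ⟨C, hC⟩ := H.holder _ (H.translate_mem 1 _ (H.opA_mem _ hr))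
  obtain ⟨ε, hε, hball⟩ := Metric.isOpen_iff.1
    (isOpen_lt (continuous_const (y := r 1 / 2)) hcont) 1 (half_lt_self hpos)
  refine ⟨min ε (1 / 2), by positivity, min_le_right _ _, |C| * (2 / r 1), by positivity,
    fun t ht => ?_⟩
  have hrt : r 1 / 2 < r t := hball (by
    rw [mem_ball_iff_norm']; exact ht.trans_le (min_le_left _ _))
  have hholder := hC (t - 1)
  simp only [opA, sub_add_cancel, zero_add, modulus_one, Real.log_one, Complex.ofReal_zero,
    zero_mul, sub_zero, norm_mul, Complex.norm_real, Real.norm_eq_abs,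
    modulus_sub_comm t 1] at hholder
  rw [abs_of_nonneg (hr0 t)] at hholder
  have hle : |Real.log (modulus t)| * (r 1 / 2) ≤ |C| * modulus (1 - t) ^ (1 / 2 : ℝ) := by
    refine le_trans ?_ (hholder.trans ?_)
    · gcongr
    · have := modulus_nonneg (1 - t)
      gcongr
      exact le_abs_self C
  rw [← le_div_iff₀ (by positivity)] at hle
  refine hle.trans (le_of_eq ?_)
  field_simp

-- At `1` the zero of `log |t|` beats the pole of `|1 - t|⁻¹`.
lemma exists_abs_logKernel_le_of_norm_lt (H : IsSchwartzBruhatLike ψ 𝒮) :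
    ∃ ε > 0, ∃ C : ℝ, 0 ≤ C ∧ ∀ t : F, ‖1 - t‖ < ε →
      |logKernel t| ≤ C * (mellinWeight (-(1 / 2)) (1 - t) * modulus t) := by
  obtain ⟨ε, hε, hε_half, C, hC0, hC⟩ := exists_abs_log_modulus_le H
  obtain ⟨t₁, ht₁, ht₁_norm⟩ := NormedField.exists_norm_lt F (one_half_pos (α := ℝ))
  rw [norm_pos_iff] at ht₁
  have hm₁ := modulus_pos ht₁
  refine ⟨ε, hε, C * modulus t₁ ^ (-(1 / 2) : ℝ) * 2, by positivity, fun t ht => ?_⟩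
  have hnorm : ‖t₁‖ ≤ ‖t‖ := by
    have := norm_sub_norm_le (1 : F) (1 - t)
    rw [norm_one, sub_sub_cancel] at this
    linarith
  have hp : 0 < modulus t := hm₁.trans_le (modulus_le_of_norm_le hnorm)
  have hq := modulus_nonneg (1 - t)
  have hroot : modulus t ^ (1 / 2 : ℝ) ≤ modulus t₁ ^ (-(1 / 2) : ℝ) * modulus t := by
    rw [show (1 / 2 : ℝ) = -(1 / 2) + 1 by norm_num, Real.rpow_add_one hp.ne']
    gcongr ?_ * _
    · exact (Real.rpow_le_rpow_of_nonpos hm₁ (modulus_le_of_norm_le hnorm) (by norm_num)).trans_eq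
        (by norm_num)
  have hpole : modulus (1 - t) ^ (1 / 2 : ℝ) / modulus (1 - t) ≤
      2 * mellinWeight (-(1 / 2)) (1 - t) := by
    refine le_trans ?_ (log_mul_rpow_le_two_mul_mellinWeight _ (modulus_le_one (by linarith)))
    rcases hq.eq_or_lt with h0 | h0
    · rw [← h0, div_zero]; positivity
    · rw [← Real.rpow_sub_one h0.ne', show (1 / 2 - 1 : ℝ) = -(1 / 2) by norm_num]
      exact le_mul_of_one_le_left (by positivity) (by simp)
  calc |logKernel t|
      ≤ (C * modulus (1 - t) ^ (1 / 2 : ℝ)) * (modulus t₁ ^ (-(1 / 2) : ℝ) * modulus t)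
          / modulus (1 - t) := by rw [abs_logKernel]; gcongr; exact hC t ht
    _ = C * modulus t₁ ^ (-(1 / 2) : ℝ) * modulus t *
          (modulus (1 - t) ^ (1 / 2 : ℝ) / modulus (1 - t)) := by ring
    _ ≤ C * modulus t₁ ^ (-(1 / 2) : ℝ) * modulus t *
          (2 * mellinWeight (-(1 / 2)) (1 - t)) := by gcongr
    _ = _ := by ring

lemma integrable_logKernel (H : IsSchwartzBruhatLike ψ 𝒮) :
    Integrable (logKernel : F → ℝ) (multHaar μ) := by
  obtain ⟨ε, hε, C, hC0, hnear⟩ := exists_abs_logKernel_le_of_norm_lt H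
  obtain ⟨C', hC'0, hfar⟩ := exists_abs_logKernel_le_of_le_norm (F := F) hε
  have hi : Integrable (fun t : F => mellinWeight (-(1 / 2)) (1 - t) * modulus t) (multHaar μ) :=
    (integrable_mul_modulus_multHaar μ).2
      ((integrable_log_mul_modulus_rpow one_half_pos one_half_lt_one).comp_sub_left 1)
  have hi' : Integrable (mellinWeight (1 / 2) : F → ℝ) (multHaar μ) :=
    integrable_mellinWeight μ one_half_pos one_half_lt_one
  have hball : IntegrableOn (logKernel : F → ℝ) (Metric.closedBall 0 1) (multHaar μ) := by
    refine ((hi.const_mul C).add (hi'.const_mul C')).integrableOn.mono'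
      measurable_logKernel.aestronglyMeasurable ?_
    filter_upwards [ae_restrict_mem measurableSet_closedBall] with t ht
    rw [mem_closedBall_zero_iff] at ht
    have := modulus_nonneg t
    have := mellinWeight_nonneg (-(1 / 2)) (1 - t)
    have := mellinWeight_nonneg (1 / 2) t
    rcases lt_or_ge ‖1 - t‖ ε with h | h
    · exact (hnear t h).trans (le_add_of_nonneg_right (by positivity))
    · exact (hfar t ht h).trans (le_add_of_nonneg_left (by positivity))
  refine integrable_of_integrableOn_closedBall μ hball (hball.neg.congr ?_)
  filter_upwards [ae_restrict_of_ae (multHaar_ae_ne_zero μ)] with t ht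
  rw [Pi.neg_apply, logKernel_inv ht]

end Kernel

section Commutator

variable {F : Type} [NontriviallyNormedField F] [ProperSpace F] [MeasurableSpace F]
  {ψ : AddChar F Circle} {𝒮 : Set (F → ℂ)} {μ : Measure F}

lemma logFunctional_smul (c : ℂ) (f : F → ℂ) :
    logFunctional ψ μ (fun x => c * f x) = c * logFunctional ψ μ f := by
  unfold logFunctional
  rw [← integral_const_mul]
  congr 1 with x
  rw [fourier_smul]
  ring

variable [BorelSpace F] [μ.IsAddHaarMeasure]

lemma opB_eq_logFunctional (θ : F → ℂ) (x : F) :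
    opB ψ μ θ x = logFunctional ψ μ fun u => θ (u + x) := by
  rw [opB, fourier_apply, logFunctional, ← integral_neg_eq_self]
  congr 1 with y
  rw [opA, fourierInv_apply, fourier_comp_add, modulus_neg, neg_neg, neg_mul, neg_neg, mul_comm y x]
  ring

lemma opA_mem_punctured (H : IsSchwartzBruhatLike ψ 𝒮) {φ : F → ℂ}
    (hφ : φ ∈ puncturedTestFunctions 𝒮) : opA φ ∈ puncturedTestFunctions 𝒮 :=
  ⟨H.opA_mem _ hφ, hφ.2.1.mul_left, by
    filter_upwards [hφ.2.2] with x hx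
    simp [opA, hx]⟩

lemma logFunctional_add (H : IsSchwartzBruhatLike ψ 𝒮) (hψ : Continuous ψ) {f g : F → ℂ}
    (hf : f ∈ 𝒮) (hg : g ∈ 𝒮) :
    logFunctional ψ μ (fun x => f x + g x) = logFunctional ψ μ f + logFunctional ψ μ g := by
  unfold logFunctional
  rw [← integral_add (integrable_log_fourier H (H.fourier_mem μ _ hf))
    (integrable_log_fourier H (H.fourier_mem μ _ hg))]
  congr 1 with x
  rw [fourier_add hψ (H.integrable hf) (H.integrable hg)]
  ring

lemma opK_eq_logFunctional (H : IsSchwartzBruhatLike ψ 𝒮) (hψ : Continuous ψ) {φ : F → ℂ}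
    (hφ : φ ∈ puncturedTestFunctions 𝒮) (x : F) :
    opK ψ μ φ x = Complex.I * logFunctional ψ μ (fun u =>
      opA φ (u + x) + -(Real.log (modulus x) : ℂ) * φ (u + x)) := by
  rw [logFunctional_add H hψ (H.translate_mem x _ (H.opA_mem _ hφ))
    (H.smul_mem _ _ (H.translate_mem x _ hφ.1)), logFunctional_smul, ← opB_eq_logFunctional,
    ← opB_eq_logFunctional, opK, opA]
  ring

lemma opK_eq_integral (H : IsSchwartzBruhatLike ψ 𝒮) (hψ : Continuous ψ) {c : ℝ}
    (hc : ∀ φ ∈ 𝒮, φ 0 = 0 → logFunctional ψ μ φ = c * ∫ x, φ x ∂(multHaar μ))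
    {φ : F → ℂ} (hφ : φ ∈ puncturedTestFunctions 𝒮) {x : F} (hx : x ≠ 0) :
    opK ψ μ φ x = ∫ t, (-Complex.I * c * logKernel t) *
      (((Real.sqrt (modulus t))⁻¹ : ℂ) * φ (x / t)) ∂(multHaar μ) := by
  set f : F → ℂ := fun y =>
    ((modulus (y - x))⁻¹ : ℂ) * ((Real.log (modulus y) - Real.log (modulus x)) * φ y) with hf
  have htranslate : ∫ u, (modulus u)⁻¹ •
      (opA φ (u + x) + -(Real.log (modulus x) : ℂ) * φ (u + x)) ∂μ = ∫ y, f y ∂μ := by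
    rw [← integral_add_right_eq_self f x]
    congr 1 with u
    simp only [hf, add_sub_cancel_right, Complex.real_smul, opA, Complex.ofReal_inv]
    ring
  rw [opK_eq_logFunctional H hψ hφ, hc _ (H.add_mem _ (H.translate_mem x _ (H.opA_mem _ hφ)) _
      (H.smul_mem _ _ (H.translate_mem x _ hφ.1))) (by simp [opA]), integral_multHaar, htranslate,
    ← integral_mul_modulus_multHaar μ f,
    ← (measurePreserving_const_div μ hx).integral_comp (measurableEmbedding_const_div hx),
    ← mul_assoc, ← integral_const_mul]
  refine integral_congr_ae ?_
  filter_upwards [multHaar_ae_ne_zero μ] with t ht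
  have hkernel := inv_modulus_sub_mul_log_sub_log hx ht
  push_cast at hkernel
  linear_combination Complex.I * c * φ (x / t) * hkernel

lemma opB_eq_integral (H : IsSchwartzBruhatLike ψ 𝒮) {c : ℝ}
    (hc : ∀ φ ∈ 𝒮, φ 0 = 0 → logFunctional ψ μ φ = c * ∫ x, φ x ∂(multHaar μ))
    {φ : F → ℂ} (hφ : φ ∈ 𝒮) {x : F} (hx : φ x = 0) :
    opB ψ μ φ x = c * ∫ y, ((modulus (y - x))⁻¹ : ℂ) * φ y ∂μ := by
  rw [opB_eq_logFunctional, hc _ (H.translate_mem x _ hφ) (by rwa [zero_add]), integral_multHaar,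
    ← integral_add_right_eq_self (fun y => ((modulus (y - x))⁻¹ : ℂ) * φ y) x]
  simp only [Complex.real_smul, Complex.ofReal_inv, add_sub_cancel_right]

lemma exists_norm_opB_mul_modulus_le (H : IsSchwartzBruhatLike ψ 𝒮) (hψ : Continuous ψ)
    (hψ1 : ψ ≠ 1) {φ : F → ℂ} (hφ : φ ∈ 𝒮) {R : ℝ} (hφR : ∀ x, φ x ≠ 0 → ‖x‖ ≤ R) :
    ∃ E : ℝ, 0 ≤ E ∧ ∀ x, 2 * R < ‖x‖ → ‖opB ψ μ φ x‖ * modulus x ≤ E := by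
  obtain ⟨c, hc⟩ := exists_logFunctional (μ := μ) H hψ hψ1
  obtain ⟨A, hA, hmod⟩ := exists_modulus_le_mul_modulus_sub (F := F)
  refine ⟨|c| * (A * ∫ y, ‖φ y‖ ∂μ), by positivity, fun x hx => ?_⟩
  have hsupp : ∀ y, φ y ≠ 0 → 2 * ‖y‖ < ‖x‖ := fun y hy => by linarith [hφR y hy]
  have hφx : φ x = 0 := by
    by_contra h
    linarith [hsupp x h, norm_nonneg x]
  rw [opB_eq_integral H hc hφ hφx, norm_mul, Complex.norm_real, Real.norm_eq_abs, mul_assoc]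
  refine mul_le_mul_of_nonneg_left ?_ (abs_nonneg c)
  rw [mul_comm, ← Real.norm_of_nonneg (modulus_nonneg x), ← Complex.norm_real, ← norm_mul,
    ← integral_const_mul, ← integral_const_mul]
  refine norm_integral_le_of_norm_le ((H.integrable hφ).norm.const_mul _)
    (Filter.Eventually.of_forall fun y => ?_)
  rcases eq_or_ne (φ y) 0 with hy | hy
  · simp [hy]
  · rw [norm_mul, norm_mul, norm_inv, Complex.norm_real, Complex.norm_real, Real.norm_of_nonneg
      (modulus_nonneg _), Real.norm_of_nonneg (modulus_nonneg _), ← mul_assoc]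
    gcongr
    exact mul_inv_le_of_le_mul₀ (modulus_nonneg _) hA.le (hmod x y (hsupp y hy).le)

lemma opB_decay (H : IsSchwartzBruhatLike ψ 𝒮) (hψ : Continuous ψ) (hψ1 : ψ ≠ 1)
    {φ : F → ℂ} (hφ : φ ∈ puncturedTestFunctions 𝒮) :
    ∃ C, ∀ x, ‖opB ψ μ φ x‖ * (1 + modulus x) ≤ C := by
  obtain ⟨R, hR⟩ := hφ.2.1.isCompact.isBounded.exists_norm_le
  obtain ⟨E, hE0, hE⟩ := exists_norm_opB_mul_modulus_le (μ := μ) H hψ hψ1 hφ.1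
    fun x hx => hR x (subset_tsupport _ hx)
  obtain ⟨z, hz⟩ := NormedField.exists_lt_norm F (2 * R)
  set D := ∫ x, ‖opA (fourierInv ψ μ φ) x‖ ∂μ
  have hD : ∀ x, ‖opB ψ μ φ x‖ ≤ D := fun x => norm_fourier_le _ x
  have hD0 : 0 ≤ D := integral_nonneg fun x => norm_nonneg _
  refine ⟨D * (1 + modulus z) + E, fun x => ?_⟩
  have hz0 := modulus_nonneg z
  have hx0 := modulus_nonneg x
  rcases le_or_gt ‖x‖ (2 * R) with hx | hx
  · calc ‖opB ψ μ φ x‖ * (1 + modulus x) ≤ D * (1 + modulus z) := by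
          gcongr
          · exact hD x
          · exact modulus_le_of_norm_le (hx.trans hz.le)
      _ ≤ _ := le_add_of_nonneg_right hE0
  · nlinarith [hD x, hE x hx, mul_nonneg hD0 hz0]

end Commutator

section L2

lemma integral_norm_inner_le {α 𝕜 E : Type*} [MeasurableSpace α] {μ : Measure α} [RCLike 𝕜]
    [NormedAddCommGroup E] [InnerProductSpace 𝕜 E] (f g : Lp E 2 μ) :
    ∫ x, ‖inner 𝕜 (f x) (g x)‖ ∂μ ≤ ‖f‖ * ‖g‖ := by
  rw [integral_norm_eq_lintegral_enorm (L2.integrable_inner f g).aestronglyMeasurable,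
    ← eLpNorm_one_eq_lintegral_enorm, Lp.norm_def, Lp.norm_def, ← ENNReal.toReal_mul]
  refine ENNReal.toReal_mono (ENNReal.mul_ne_top (Lp.eLpNorm_ne_top f) (Lp.eLpNorm_ne_top g)) ?_
  simpa only [ENNReal.coe_one, one_mul] using
    eLpNorm_le_eLpNorm_mul_eLpNorm_of_nnnorm (p := 2) (q := 2) (r := 1)
      (Lp.aestronglyMeasurable f) (Lp.aestronglyMeasurable g) (fun a b => inner 𝕜 a b) 1
      (Filter.Eventually.of_forall fun x => by simpa using nnnorm_inner_le_nnnorm (f x) (g x))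

lemma integral_sq_norm_eq_norm_sq {α E : Type*} [MeasurableSpace α] {μ : Measure α}
    [NormedAddCommGroup E] [InnerProductSpace ℝ E] (f : Lp E 2 μ) :
    ∫ x, ‖f x‖ ^ 2 ∂μ = ‖f‖ ^ 2 := by
  rw [← real_inner_self_eq_norm_sq, L2.inner_def]
  simp only [real_inner_self_eq_norm_sq]

end L2

section DilationAlgebra

variable {F : Type} [NontriviallyNormedField F] [ProperSpace F] [MeasurableSpace F] [BorelSpace F]
  (μ : Measure F)

lemma measurable_dilation_prod (f : Lp ℂ 2 μ) :
    Measurable fun p : F × F => ((Real.sqrt (modulus p.1))⁻¹ : ℂ) * f (p.2 / p.1) := by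
  have hsqrt : Measurable fun t : F => ((Real.sqrt (modulus t))⁻¹ : ℂ) :=
    (Complex.measurable_ofReal.comp (Real.continuous_sqrt.measurable.comp measurable_modulus)).inv
  exact (hsqrt.comp measurable_fst).mul
    ((Lp.stronglyMeasurable f).measurable.comp (measurable_snd.div measurable_fst))

lemma measurable_conj_mul_dilation (f g : Lp ℂ 2 μ) : Measurable fun p : F × F =>
    conj (f p.2) * (((Real.sqrt (modulus p.1))⁻¹ : ℂ) * g (p.2 / p.1)) :=
  ((Complex.continuous_conj.measurable.comp (Lp.stronglyMeasurable f).measurable).comp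
    measurable_snd).mul (measurable_dilation_prod μ g)

variable [μ.IsAddHaarMeasure]

/-- The unitary dilation `U(t)` on `L²`. -/
def dilationL2 (t : Fˣ) : Lp ℂ 2 μ ≃ₗᵢ[ℂ] Lp ℂ 2 μ :=
  (exists_linearIsometryEquiv_dilation μ t).choose

lemma dilationL2_ae_eq (t : Fˣ) (f : Lp ℂ 2 μ) : dilationL2 μ t f =ᵐ[μ] dilation t f :=
  (exists_linearIsometryEquiv_dilation μ t).choose_spec f

/-- The unitary inversion `I` on `L²`. -/
def inversionL2 : Lp ℂ 2 μ ≃ₗᵢ[ℂ] Lp ℂ 2 μ := (exists_linearIsometryEquiv_inversion μ).choose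

lemma inversionL2_ae_eq (f : Lp ℂ 2 μ) : inversionL2 μ f =ᵐ[μ] inversion f :=
  (exists_linearIsometryEquiv_inversion μ).choose_spec f

lemma quasiMeasurePreserving_div_const {t : F} (ht : t ≠ 0) :
    Measure.QuasiMeasurePreserving (fun x => x / t) μ μ := by
  have hs : (Real.sqrt (modulus t) : ℂ) ≠ 0 := by
    exact_mod_cast (Real.sqrt_pos.2 (modulus_pos ht)).ne'
  exact quasiMeasurePreserving_of_lintegral_mul_comp (w := fun _ => ((Real.sqrt (modulus t))⁻¹ : ℂ))
    measurable_const (measurable_id.div_const _) (by simp [hs])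
    (fun u _ => lintegral_dilation μ ht u)

lemma quasiMeasurePreserving_inv :
    Measure.QuasiMeasurePreserving (fun x : F => x⁻¹) μ μ :=
  quasiMeasurePreserving_of_lintegral_mul_comp (w := fun x => ((modulus x)⁻¹ : ℂ))
    (Complex.measurable_ofReal.comp measurable_modulus).inv measurable_inv
    (by
      filter_upwards [ae_ne_zero μ] with x hx
      simpa using modulus_ne_zero hx)
    (fun u hu => lintegral_inversion μ hu)

lemma dilationL2_mul (s t : Fˣ) (f : Lp ℂ 2 μ) :
    dilationL2 μ s (dilationL2 μ t f) = dilationL2 μ (s * t) f := by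
  refine Lp.ext ?_
  filter_upwards [dilationL2_ae_eq μ s (dilationL2 μ t f), dilationL2_ae_eq μ (s * t) f,
    (quasiMeasurePreserving_div_const μ s.ne_zero).ae (dilationL2_ae_eq μ t f)] with x h1 h2 h3
  rw [h1, h2, dilation, h3, dilation, dilation, Units.val_mul, modulus_mul,
    Real.sqrt_mul (modulus_nonneg _), ← mul_assoc, div_div]
  push_cast
  rw [mul_inv]

lemma dilationL2_one (f : Lp ℂ 2 μ) : dilationL2 μ 1 f = f := by
  refine Lp.ext ?_
  filter_upwards [dilationL2_ae_eq μ 1 f] with x h1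
  simp [h1, dilation]

lemma dilationL2_comm (s t : Fˣ) (f : Lp ℂ 2 μ) :
    dilationL2 μ s (dilationL2 μ t f) = dilationL2 μ t (dilationL2 μ s f) := by
  rw [dilationL2_mul, dilationL2_mul, mul_comm]

lemma inner_dilationL2_left (t : Fˣ) (f g : Lp ℂ 2 μ) :
    inner ℂ (dilationL2 μ t f) g = inner ℂ f (dilationL2 μ t⁻¹ g) := by
  rw [← (dilationL2 μ t).inner_map_map f, dilationL2_mul, mul_inv_cancel, dilationL2_one]

lemma dilationL2_inversionL2 (t : Fˣ) (f : Lp ℂ 2 μ) :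
    dilationL2 μ t (inversionL2 μ f) = inversionL2 μ (dilationL2 μ t⁻¹ f) := by
  refine Lp.ext ?_
  filter_upwards [dilationL2_ae_eq μ t (inversionL2 μ f), inversionL2_ae_eq μ (dilationL2 μ t⁻¹ f),
    (quasiMeasurePreserving_div_const μ t.ne_zero).ae (inversionL2_ae_eq μ f),
    (quasiMeasurePreserving_inv μ).ae (dilationL2_ae_eq μ t⁻¹ f)] with x h1 h2 h3 h4
  have hp := modulus_pos t.ne_zero
  have hs : (Real.sqrt (modulus (t : F)) : ℂ) ≠ 0 := by
    exact_mod_cast (Real.sqrt_pos.2 hp).ne'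
  have hs2 : (modulus (t : F) : ℂ) =
      (Real.sqrt (modulus (t : F)) : ℂ) * (Real.sqrt (modulus (t : F)) : ℂ) := by
    exact_mod_cast (Real.mul_self_sqrt hp.le).symm
  rw [h1, h2, dilation, h3, inversion, inversion, h4, dilation, modulus_div,
    Units.val_inv_eq_inv_val, modulus_inv, Real.sqrt_inv]
  have e : (x : F)⁻¹ / (t : F)⁻¹ = (x / t)⁻¹ := by
    rw [inv_div, div_inv_eq_mul]; field_simp
  rw [e]
  push_cast
  rw [inv_inv, inv_div, ← mul_assoc, ← mul_assoc]
  congr 1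
  rw [div_eq_mul_inv, hs2]
  field_simp

open Classical in
/-- The dilations as a family of contractions indexed by the whole field, with value `0` at `0`, to
be integrated against kernels on `F`. -/
def dilationExt (t : F) : Lp ℂ 2 μ →L[ℂ] Lp ℂ 2 μ :=
  if h : t = 0 then 0 else (dilationL2 μ (Units.mk0 t h)).toContinuousLinearEquiv

lemma dilationExt_apply {t : F} (ht : t ≠ 0) (f : Lp ℂ 2 μ) :
    dilationExt μ t f = dilationL2 μ (Units.mk0 t ht) f := by
  simp [dilationExt, ht]

lemma dilationExt_ae_eq {t : F} (ht : t ≠ 0) (f : Lp ℂ 2 μ) :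
    dilationExt μ t f =ᵐ[μ] fun x => ((Real.sqrt (modulus t))⁻¹ : ℂ) * f (x / t) := by
  rw [dilationExt_apply μ ht]
  exact dilationL2_ae_eq μ (Units.mk0 t ht) f

lemma norm_dilationExt_le (t : F) (f : Lp ℂ 2 μ) : ‖dilationExt μ t f‖ ≤ ‖f‖ := by
  rcases eq_or_ne t 0 with rfl | ht
  · simp [dilationExt]
  · rw [dilationExt_apply μ ht, LinearIsometryEquiv.norm_map]

lemma inner_dilationExt {t : F} (ht : t ≠ 0) (f g : Lp ℂ 2 μ) :
    inner ℂ f (dilationExt μ t g) =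
      ∫ x, conj (f x) * (((Real.sqrt (modulus t))⁻¹ : ℂ) * g (x / t)) ∂μ := by
  rw [L2.inner_def]
  refine integral_congr_ae ?_
  filter_upwards [dilationExt_ae_eq μ ht g] with x hx
  rw [hx, RCLike.inner_apply']

lemma aestronglyMeasurable_inner_dilationExt (f g : Lp ℂ 2 μ) :
    AEStronglyMeasurable (fun t => inner ℂ f (dilationExt μ t g)) (multHaar μ) := by
  refine (measurable_conj_mul_dilation μ f g).stronglyMeasurable.integral_prod_right'
    (ν := μ) |>.aestronglyMeasurable.congr ?_
  filter_upwards [multHaar_ae_ne_zero μ] with t ht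
  exact (inner_dilationExt μ ht f g).symm

lemma integral_norm_conj_mul_dilation_le {t : F} (ht : t ≠ 0) (f g : Lp ℂ 2 μ) :
    Integrable (fun x => conj (f x) * (((Real.sqrt (modulus t))⁻¹ : ℂ) * g (x / t))) μ ∧
      ∫ x, ‖conj (f x) * (((Real.sqrt (modulus t))⁻¹ : ℂ) * g (x / t))‖ ∂μ ≤ ‖f‖ * ‖g‖ := by
  have hae : (fun x => inner ℂ (f x) (dilationExt μ t g x)) =ᵐ[μ]
      fun x => conj (f x) * (((Real.sqrt (modulus t))⁻¹ : ℂ) * g (x / t)) := by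
    filter_upwards [dilationExt_ae_eq μ ht g] with x hx
    rw [hx, RCLike.inner_apply']
  refine ⟨(L2.integrable_inner f (dilationExt μ t g)).congr hae, ?_⟩
  refine (integral_congr_ae (hae.mono fun x hx => congrArg norm hx)).ge.trans ?_
  exact (integral_norm_inner_le f (dilationExt μ t g)).trans
    (mul_le_mul_of_nonneg_left (norm_dilationExt_le μ t g) (norm_nonneg f))

lemma integrable_mul_conj_mul_dilation {κ : F → ℂ} (hκ : Integrable κ (multHaar μ))
    (hκm : Measurable κ) (f g : Lp ℂ 2 μ) :
    Integrable (fun p : F × F =>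
      κ p.1 * (conj (f p.2) * (((Real.sqrt (modulus p.1))⁻¹ : ℂ) * g (p.2 / p.1))))
      ((multHaar μ).prod μ) := by
  have hm : Measurable fun p : F × F =>
      κ p.1 * (conj (f p.2) * (((Real.sqrt (modulus p.1))⁻¹ : ℂ) * g (p.2 / p.1))) :=
    (hκm.comp measurable_fst).mul (measurable_conj_mul_dilation μ f g)
  rw [integrable_prod_iff hm.aestronglyMeasurable]
  constructor
  · filter_upwards [multHaar_ae_ne_zero μ] with t ht
    exact (integral_norm_conj_mul_dilation_le μ ht f g).1.const_mul (κ t)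
  · refine (hκ.norm.mul_const (‖f‖ * ‖g‖)).mono'
      hm.norm.stronglyMeasurable.integral_prod_right'.aestronglyMeasurable ?_
    filter_upwards [multHaar_ae_ne_zero μ] with t ht
    rw [Real.norm_of_nonneg (integral_nonneg fun x => norm_nonneg _)]
    simp only [norm_mul (κ t)]
    rw [integral_const_mul]
    gcongr
    exact (integral_norm_conj_mul_dilation_le μ ht f g).2

end DilationAlgebra

section ConvolutionOperator

variable {F : Type} [NontriviallyNormedField F] [ProperSpace F] [MeasurableSpace F] [BorelSpace F]
  {μ : Measure F} [μ.IsAddHaarMeasure]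

/-- The multiplicative convolution `x ↦ ∫ κ(t) (U(t) f)(x) d×t` of `κ` and `f`. -/
def multConvolution (μ : Measure F) (κ f : F → ℂ) (x : F) : ℂ :=
  ∫ t, κ t * (((Real.sqrt (modulus t))⁻¹ : ℂ) * f (x / t)) ∂(multHaar μ)

/-- `K` is the weak integral `∫ κ(t) U(t) d×t` of the dilations, that is, the operator of
multiplicative convolution with `κ`. -/
def IsConvolution (μ : Measure F) [μ.IsAddHaarMeasure] (κ : F → ℂ)
    (K : Lp ℂ 2 μ →L[ℂ] Lp ℂ 2 μ) : Prop :=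
  ∀ f g, inner ℂ f (K g) = ∫ t, κ t * inner ℂ f (dilationExt μ t g) ∂(multHaar μ)

lemma exists_isConvolution {κ : F → ℂ} (hκ : Integrable κ (multHaar μ)) :
    ∃ K, IsConvolution μ κ K :=
  exists_inner_eq_integral hκ _ (norm_dilationExt_le μ) (aestronglyMeasurable_inner_dilationExt μ)

variable {κ : F → ℂ} {K : Lp ℂ 2 μ →L[ℂ] Lp ℂ 2 μ}

lemma IsConvolution.commute (hK : IsConvolution μ κ K) (V : Lp ℂ 2 μ ≃ₗᵢ[ℂ] Lp ℂ 2 μ)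
    (hV : ∀ t f, dilationL2 μ t (V f) = V (dilationL2 μ t f)) (f : Lp ℂ 2 μ) :
    K (V f) = V (K f) := by
  refine ext_inner_left ℂ fun g => ?_
  obtain ⟨g, rfl⟩ := V.surjective g
  rw [V.inner_map_map, hK, hK]
  refine integral_congr_ae ?_
  filter_upwards [multHaar_ae_ne_zero μ] with t ht
  rw [dilationExt_apply μ ht, dilationExt_apply μ ht, hV, V.inner_map_map]

lemma IsConvolution.anticommute (hK : IsConvolution μ κ K)
    (hκ : ∀ t, t ≠ 0 → κ t⁻¹ = -κ t) (V : Lp ℂ 2 μ ≃ₗᵢ[ℂ] Lp ℂ 2 μ)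
    (hV : ∀ t f, dilationL2 μ t (V f) = V (dilationL2 μ t⁻¹ f)) (f : Lp ℂ 2 μ) :
    K (V f) = -V (K f) := by
  refine ext_inner_left ℂ fun g => ?_
  obtain ⟨g, rfl⟩ := V.surjective g
  rw [inner_neg_right, V.inner_map_map, hK, hK, ← integral_neg,
    ← (measurePreserving_inv μ).integral_comp measurableEmbedding_inv]
  refine integral_congr_ae ?_
  filter_upwards [multHaar_ae_ne_zero μ] with t ht
  have e : (Units.mk0 t⁻¹ (inv_ne_zero ht)) = (Units.mk0 t ht)⁻¹ := by ext; rfl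
  rw [dilationExt_apply μ ht, dilationExt_apply μ (inv_ne_zero ht), e, hV, V.inner_map_map, inv_inv,
    hκ t ht, neg_mul]

lemma IsConvolution.adjoint_eq (hK : IsConvolution μ κ K)
    (hκ : ∀ t, t ≠ 0 → conj (κ t⁻¹) = κ t) : ContinuousLinearMap.adjoint K = K := by
  refine ContinuousLinearMap.ext fun g => ext_inner_left ℂ fun f => ?_
  rw [ContinuousLinearMap.adjoint_inner_right, ← inner_conj_symm, hK, hK, ← integral_conj,
    ← (measurePreserving_inv μ).integral_comp measurableEmbedding_inv]
  refine integral_congr_ae ?_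
  filter_upwards [multHaar_ae_ne_zero μ] with t ht
  have e : (Units.mk0 t⁻¹ (inv_ne_zero ht)) = (Units.mk0 t ht)⁻¹ := by ext; rfl
  rw [dilationExt_apply μ ht, dilationExt_apply μ (inv_ne_zero ht), e, map_mul, inner_conj_symm,
    inner_dilationL2_left, inv_inv, hκ t ht]

lemma IsConvolution.inner_eq (hK : IsConvolution μ κ K) (hκ : Integrable κ (multHaar μ))
    (hκm : Measurable κ) (f g : Lp ℂ 2 μ) :
    Integrable (fun x => conj (f x) * multConvolution μ κ g x) μ ∧
      inner ℂ f (K g) = ∫ x, conj (f x) * multConvolution μ κ g x ∂μ := by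
  set Φ : F × F → ℂ := fun p =>
    κ p.1 * (conj (f p.2) * (((Real.sqrt (modulus p.1))⁻¹ : ℂ) * g (p.2 / p.1))) with hΦ
  have hΦi : Integrable Φ ((multHaar μ).prod μ) := integrable_mul_conj_mul_dilation μ hκ hκm f g
  have hfiber : ∀ x, ∫ t, Φ (t, x) ∂(multHaar μ) = conj (f x) * multConvolution μ κ g x := by
    intro x
    rw [multConvolution, ← integral_const_mul]
    congr 1 with t
    simp only [hΦ]
    ring
  refine ⟨by simpa only [hfiber] using hΦi.integral_prod_right, ?_⟩
  calc inner ℂ f (K g) = ∫ t, ∫ x, Φ (t, x) ∂μ ∂(multHaar μ) := by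
        rw [hK]
        refine integral_congr_ae ?_
        filter_upwards [multHaar_ae_ne_zero μ] with t ht
        rw [inner_dilationExt μ ht, ← integral_const_mul]
    _ = ∫ x, ∫ t, Φ (t, x) ∂(multHaar μ) ∂μ := integral_integral_swap hΦi
    _ = _ := by simp only [hfiber]

lemma IsConvolution.ae_eq (hK : IsConvolution μ κ K) (hκ : Integrable κ (multHaar μ))
    (hκm : Measurable κ) (g : Lp ℂ 2 μ) : K g =ᵐ[μ] multConvolution μ κ g := by
  have hind : ∀ (s : Set F) (hs : MeasurableSet s) (hμs : μ s ≠ ⊤) (u : F → ℂ),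
      (fun x => conj (indicatorConstLp 2 hs hμs (1 : ℂ) x) * u x) =ᵐ[μ] s.indicator u := by
    intro s hs hμs u
    filter_upwards [indicatorConstLp_coeFn (p := 2) (hs := hs) (hμs := hμs) (c := (1 : ℂ))]
      with x hx
    rw [hx]
    by_cases hxs : x ∈ s <;> simp [hxs]
  refine ae_eq_of_forall_setIntegral_eq_of_sigmaFinite (fun s _ hμs => ?_) (fun s hs hμs => ?_)
    (fun s hs hμs => ?_)
  · exact integrableOn_Lp_of_measure_ne_top (K g) one_le_two hμs.ne
  · rw [← integrable_indicator_iff hs]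
    exact (hK.inner_eq hκ hκm (indicatorConstLp 2 hs hμs.ne 1) g).1.congr (hind s hs hμs.ne _)
  · have hinner := (hK.inner_eq hκ hκm (indicatorConstLp 2 hs hμs.ne 1) g).2
    rwa [integral_congr_ae (hind s hs hμs.ne _), integral_indicator hs,
      L2.inner_indicatorConstLp_one] at hinner

end ConvolutionOperator

section FourierL2

variable {F : Type} [NontriviallyNormedField F] [ProperSpace F] [MeasurableSpace F] [BorelSpace F]
  {ψ : AddChar F Circle} {𝒮 : Set (F → ℂ)} {μ : Measure F} [μ.IsAddHaarMeasure]

lemma IsSelfDualMeasure.fourier_fourier_neg (hμ : IsSelfDualMeasure ψ μ 𝒮) {φ : F → ℂ}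
    (hφ : φ ∈ 𝒮) (y : F) : fourier ψ μ (fun x => fourier ψ μ φ (-x)) y = φ y := by
  have h := fourier_comp_mul (ψ := ψ) (μ := μ) (t := -1) (by simp) (fourier ψ μ φ) y
  simpa [modulus_neg, modulus_one, hμ.2 _ hφ, div_neg] using h

namespace IsSchwartzBruhatLike

variable (H : IsSchwartzBruhatLike ψ 𝒮)
include H

lemma zero_mem_punctured : (fun _ => (0 : ℂ)) ∈ puncturedTestFunctions 𝒮 := by
  obtain ⟨r, hr, -⟩ := H.bump Set.univ Filter.univ_mem
  refine ⟨by simpa using H.smul_mem 0 _ hr.1, HasCompactSupport.zero, by simp⟩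

lemma add_mem_punctured {φ η : F → ℂ} (hφ : φ ∈ puncturedTestFunctions 𝒮)
    (hη : η ∈ puncturedTestFunctions 𝒮) :
    (fun x => φ x + η x) ∈ puncturedTestFunctions 𝒮 :=
  ⟨H.add_mem _ hφ.1 _ hη.1, hφ.2.1.add hη.2.1, by
    filter_upwards [hφ.2.2, hη.2.2] with x h1 h2
    simp [h1, h2]⟩

lemma smul_mem_punctured (c : ℂ) {φ : F → ℂ} (hφ : φ ∈ puncturedTestFunctions 𝒮) :
    (fun x => c * φ x) ∈ puncturedTestFunctions 𝒮 :=
  ⟨H.smul_mem c _ hφ.1, hφ.2.1.mul_left, by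
    filter_upwards [hφ.2.2] with x h1
    simp [h1]⟩

lemma conj_mem_punctured {φ : F → ℂ} (hφ : φ ∈ puncturedTestFunctions 𝒮) :
    (fun x => conj (φ x)) ∈ puncturedTestFunctions 𝒮 :=
  ⟨H.conj_mem _ hφ.1, hφ.2.1.comp_left (g := fun z : ℂ => conj z) (by simp), by
    filter_upwards [hφ.2.2] with x h1
    simp [h1]⟩

/-- The test functions as a space of functions. -/
def testSpace : Submodule ℂ (F → ℂ) where
  carrier := 𝒮
  add_mem' {a b} ha hb := H.add_mem a ha b hb
  zero_mem' := H.zero_mem_punctured.1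
  smul_mem' c f hf := H.smul_mem c f hf

/-- The classes of the test functions of the initial domain of the commutator. -/
def initialDomain (μ : Measure F) : Submodule ℂ (Lp ℂ 2 μ) where
  carrier := {f | ∃ φ ∈ puncturedTestFunctions 𝒮, f =ᵐ[μ] φ}
  add_mem' := by
    rintro f g ⟨φ, hφ, h1⟩ ⟨η, hη, h2⟩
    refine ⟨_, H.add_mem_punctured hφ hη, ?_⟩
    filter_upwards [Lp.coeFn_add f g, h1, h2] with x h3 h4 h5
    exact h3.trans (by rw [Pi.add_apply, h4, h5])
  zero_mem' := ⟨_, H.zero_mem_punctured, Lp.coeFn_zero _ _ _⟩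
  smul_mem' := by
    rintro c f ⟨φ, hφ, h1⟩
    refine ⟨_, H.smul_mem_punctured c hφ, ?_⟩
    filter_upwards [Lp.coeFn_smul c f, h1] with x h3 h4
    exact h3.trans (by rw [Pi.smul_apply, h4, smul_eq_mul])

lemma dense_initialDomain : Dense (H.initialDomain μ : Set (Lp ℂ 2 μ)) := by
  rw [Submodule.dense_iff_topologicalClosure_eq_top, Submodule.topologicalClosure_eq_top_iff,
    Submodule.eq_bot_iff]
  intro f hf
  have hzero : f =ᵐ[μ] 0 := by
    refine H.ae_eq_zero μ f (Lp.memLp f) fun φ hφ => ?_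
    have hφ' := H.conj_mem_punctured hφ
    have hm := H.memLp (μ := μ) hφ'.1
    have horth := Submodule.inner_right_of_mem_orthogonal (K := H.initialDomain μ) (u := hm.toLp)
      ⟨_, hφ', hm.coeFn_toLp⟩ hf
    rw [L2.inner_def] at horth
    rw [← horth]
    refine integral_congr_ae ?_
    filter_upwards [hm.coeFn_toLp] with x hx
    rw [hx, RCLike.inner_apply', RCLike.conj_conj]
  exact Lp.ext (hzero.trans (Lp.coeFn_zero _ _ _).symm)

/-- The map sending a test function to its class in `L²`. -/
def toL2 (μ : Measure F) [μ.IsAddHaarMeasure] : H.testSpace →ₗ[ℂ] Lp ℂ 2 μ where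
  toFun φ := (H.memLp φ.2).toLp
  map_add' _ _ := rfl
  map_smul' _ _ := rfl

lemma toL2_ae_eq (φ : H.testSpace) : H.toL2 μ φ =ᵐ[μ] (φ : F → ℂ) := (H.memLp φ.2).coeFn_toLp

lemma denseRange_toL2 : DenseRange (H.toL2 μ) := by
  refine H.dense_initialDomain.mono ?_
  rintro f ⟨φ, hφ, hf⟩
  exact ⟨⟨φ, hφ.1⟩, Lp.ext ((H.toL2_ae_eq _).trans hf.symm)⟩

/-- The Fourier transform of test functions as a linear equivalence. -/
def fourierEquiv (hψ : Continuous ψ) (hμ : IsSelfDualMeasure ψ μ 𝒮) :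
    H.testSpace ≃ₗ[ℂ] H.testSpace where
  toFun φ := ⟨fourier ψ μ φ, H.fourier_mem μ _ φ.2⟩
  invFun φ := ⟨fun x => fourier ψ μ φ (-x), H.neg_mem (H.fourier_mem μ _ φ.2)⟩
  map_add' φ η := by
    ext y
    exact fourier_add hψ (H.integrable φ.2) (H.integrable η.2) y
  map_smul' c φ := by
    ext y
    exact fourier_smul c _ y
  left_inv φ := by
    ext y
    simp [hμ.2 _ φ.2]
  right_inv φ := by
    ext y
    exact hμ.fourier_fourier_neg φ.2 y

lemma norm_toL2_fourierEquiv (hψ : Continuous ψ) (hμ : IsSelfDualMeasure ψ μ 𝒮)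
    (φ : H.testSpace) : ‖H.toL2 μ (H.fourierEquiv hψ hμ φ)‖ = ‖H.toL2 μ φ‖ := by
  have hsq : ∀ η : H.testSpace, ∫ x, ‖(η : F → ℂ) x‖ ^ 2 ∂μ = ‖H.toL2 μ η‖ ^ 2 := by
    intro η
    rw [← integral_sq_norm_eq_norm_sq]
    refine integral_congr_ae ?_
    filter_upwards [H.toL2_ae_eq (μ := μ) η] with x hx
    rw [hx]
  have hplancherel := H.plancherel_const (μ := μ) hψ (c := 1) (by simpa using hμ.2) φ.2 φ.2
  simp only [Complex.mul_conj', one_mul] at hplancherel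
  norm_cast at hplancherel
  have hnorm := hsq (H.fourierEquiv hψ hμ φ)
  have hint : ∫ x, ‖(H.fourierEquiv hψ hμ φ : F → ℂ) x‖ ^ 2 ∂μ =
      ∫ x, ‖(φ : F → ℂ) x‖ ^ 2 ∂μ := hplancherel
  rw [hint, hsq] at hnorm
  exact ((sq_eq_sq₀ (norm_nonneg _) (norm_nonneg _)).1 hnorm).symm

/-- The Fourier transform of `L²`. -/
def fourierL2 (hψ : Continuous ψ) (hμ : IsSelfDualMeasure ψ μ 𝒮) : Lp ℂ 2 μ ≃ₗᵢ[ℂ] Lp ℂ 2 μ :=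
  (H.fourierEquiv hψ hμ).extendOfIsometry (H.toL2 μ) (H.toL2 μ) H.denseRange_toL2
    H.denseRange_toL2 (H.norm_toL2_fourierEquiv hψ hμ)

lemma fourierL2_toL2 (hψ : Continuous ψ) (hμ : IsSelfDualMeasure ψ μ 𝒮) (φ : H.testSpace) :
    H.fourierL2 hψ hμ (H.toL2 μ φ) = H.toL2 μ (H.fourierEquiv hψ hμ φ) :=
  LinearEquiv.extendOfIsometry_eq _ _ _ _ _ _ _

lemma fourierL2_ae_eq (hψ : Continuous ψ) (hμ : IsSelfDualMeasure ψ μ 𝒮) {φ : F → ℂ} (hφ : φ ∈ 𝒮)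
    {f : Lp ℂ 2 μ} (hf : f =ᵐ[μ] φ) : H.fourierL2 hψ hμ f =ᵐ[μ] fourier ψ μ φ := by
  have hf_eq : f = H.toL2 μ ⟨φ, hφ⟩ := Lp.ext (hf.trans (H.toL2_ae_eq (μ := μ) ⟨φ, hφ⟩).symm)
  rw [hf_eq, fourierL2_toL2]
  exact H.toL2_ae_eq _

lemma dilationL2_inv_toL2_ae_eq (t : Fˣ) (φ : H.testSpace) : dilationL2 μ t⁻¹ (H.toL2 μ φ) =ᵐ[μ]
    fun x => (Real.sqrt (modulus (t : F)) : ℂ) * (φ : F → ℂ) (t * x) := by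
  filter_upwards [dilationL2_ae_eq μ t⁻¹ (H.toL2 μ φ),
    (quasiMeasurePreserving_div_const μ (t⁻¹).ne_zero).ae (H.toL2_ae_eq (μ := μ) φ)] with x h1 h2
  rw [h1, dilation, h2, Units.val_inv_eq_inv_val, modulus_inv, Real.sqrt_inv, div_inv_eq_mul,
    mul_comm x]
  simp

lemma dilationL2_fourierL2 (hψ : Continuous ψ) (hμ : IsSelfDualMeasure ψ μ 𝒮) (t : Fˣ)
    (f : Lp ℂ 2 μ) :
    dilationL2 μ t (H.fourierL2 hψ hμ f) = H.fourierL2 hψ hμ (dilationL2 μ t⁻¹ f) := by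
  refine congrFun (H.denseRange_toL2.equalizer (g := fun f => dilationL2 μ t (H.fourierL2 hψ hμ f))
    (h := fun f => H.fourierL2 hψ hμ (dilationL2 μ t⁻¹ f))
    ((dilationL2 μ t).continuous.comp (H.fourierL2 hψ hμ).continuous)
    ((H.fourierL2 hψ hμ).continuous.comp (dilationL2 μ t⁻¹).continuous) ?_) f
  ext φ : 1
  have hs : (Real.sqrt (modulus (t : F)) : ℂ) ≠ 0 := by
    exact_mod_cast (Real.sqrt_pos.2 (modulus_pos t.ne_zero)).ne'
  have hs2 : (modulus (t : F) : ℂ) =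
      (Real.sqrt (modulus (t : F)) : ℂ) * (Real.sqrt (modulus (t : F)) : ℂ) := by
    exact_mod_cast (Real.mul_self_sqrt (modulus_nonneg _)).symm
  have hright := H.fourierL2_ae_eq hψ hμ (H.smul_mem _ _ (H.dilate_mem t t.ne_zero _ φ.2))
    (H.dilationL2_inv_toL2_ae_eq t φ)
  refine Lp.ext (Filter.EventuallyEq.trans ?_ hright.symm)
  simp only [Function.comp, fourierL2_toL2]
  filter_upwards [dilationL2_ae_eq μ t (H.toL2 μ (H.fourierEquiv hψ hμ φ)),
    (quasiMeasurePreserving_div_const μ t.ne_zero).ae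
      (H.toL2_ae_eq (μ := μ) (H.fourierEquiv hψ hμ φ))] with x h3 h4
  rw [h3, dilation, h4, fourier_smul, fourier_comp_mul t.ne_zero, ← mul_assoc]
  congr 1
  rw [hs2]
  field_simp

end IsSchwartzBruhatLike

end FourierL2

section QuasiCharacters

variable {F : Type} [NontriviallyNormedField F] [ProperSpace F]

lemma quasiChar_of_ne_zero (χ : Fˣ →ₜ* Circle) (z : ℂ) {x : F} (hx : x ≠ 0) :
    quasiChar χ z x = (χ (Units.mk0 x hx) : ℂ) * (modulus x : ℂ) ^ z := by
  simp [quasiChar, hx]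

lemma norm_quasiChar (χ : Fˣ →ₜ* Circle) (z : ℂ) {x : F} (hx : x ≠ 0) :
    ‖quasiChar χ z x‖ = modulus x ^ z.re := by
  rw [quasiChar_of_ne_zero χ z hx, norm_mul, Circle.norm_coe, one_mul,
    Complex.norm_cpow_eq_rpow_re_of_pos (modulus_pos hx)]

lemma quasiChar_div (χ : Fˣ →ₜ* Circle) (z : ℂ) {x t : F} (hx : x ≠ 0) (ht : t ≠ 0) :
    quasiChar χ z (x / t) = quasiChar χ z x * quasiChar χ⁻¹ (-z) t := by
  rw [quasiChar_of_ne_zero χ z (div_ne_zero hx ht), quasiChar_of_ne_zero χ z hx,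
    quasiChar_of_ne_zero _ _ ht]
  have hunit : Units.mk0 (x / t) (div_ne_zero hx ht) = Units.mk0 x hx * (Units.mk0 t ht)⁻¹ := by
    ext; simp [div_eq_mul_inv]
  have hinv : (χ⁻¹ (Units.mk0 t ht) : Circle) = (χ (Units.mk0 t ht))⁻¹ := rfl
  rw [hunit, map_mul, map_inv, hinv, modulus_div, Complex.ofReal_div, div_eq_mul_inv,
    ← Complex.ofReal_inv, Complex.mul_cpow_ofReal_nonneg (modulus_nonneg _)
      (inv_nonneg.2 (modulus_nonneg _)), Complex.ofReal_inv, Complex.inv_cpow, Complex.cpow_neg]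
  · push_cast; ring
  · rw [Complex.arg_ofReal_of_nonneg (modulus_nonneg t)]; exact Real.pi_pos.ne

lemma quasiChar_sub_one (χ : Fˣ →ₜ* Circle) (z : ℂ) {x : F} (hx : x ≠ 0) :
    quasiChar χ (z - 1) x = ((modulus x)⁻¹ : ℂ) * quasiChar χ z x := by
  have hp : (modulus x : ℂ) ≠ 0 := by exact_mod_cast modulus_ne_zero hx
  rw [quasiChar_of_ne_zero _ _ hx, quasiChar_of_ne_zero _ _ hx, Complex.cpow_sub _ _ hp,
    Complex.cpow_one]
  ring

lemma quasiChar_one (χ : Fˣ →ₜ* Circle) (z : ℂ) : quasiChar χ z (1 : F) = 1 := by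
  have hmk : Units.mk0 (1 : F) one_ne_zero = 1 := Units.ext rfl
  simp [quasiChar_of_ne_zero χ z one_ne_zero, modulus_one, hmk]

lemma hasDerivAt_quasiChar (χ : Fˣ →ₜ* Circle) {x : F} (hx : x ≠ 0) (z : ℂ) :
    HasDerivAt (fun w => quasiChar χ w x) (Real.log (modulus x) * quasiChar χ z x) z := by
  have hp : (modulus x : ℂ) ≠ 0 := by exact_mod_cast modulus_ne_zero hx
  simp only [quasiChar_of_ne_zero χ _ hx]
  refine (((hasDerivAt_id z).const_cpow (c := (modulus x : ℂ)) (Or.inl hp)).const_mul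
    (χ (Units.mk0 x hx) : ℂ)).congr_deriv ?_
  rw [Complex.ofReal_log (modulus_nonneg x), id]
  ring

lemma continuousOn_quasiChar (χ : Fˣ →ₜ* Circle) (z : ℂ) :
    ContinuousOn (quasiChar χ z : F → ℂ) {x | x ≠ 0} := by
  rw [continuousOn_iff_continuous_domRestrict]
  have hunits : Continuous fun x : {x : F // x ≠ 0} => (unitsHomeomorphNeZero (G₀ := F)).symm x :=
    unitsHomeomorphNeZero.symm.continuous
  have hcont : Continuous fun x : {x : F // x ≠ 0} =>
      ((χ ((unitsHomeomorphNeZero (G₀ := F)).symm x) : Circle) : ℂ) *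
        (modulus (x : F) : ℂ) ^ z := by
    have hcoe : Continuous fun z : Circle => (z : ℂ) := by fun_prop
    refine (hcoe.comp (χ.continuous_toFun.comp hunits)).mul ?_
    refine continuous_iff_continuousAt.2 fun x => ?_
    refine ContinuousAt.cpow ?_ continuousAt_const ?_
    · exact (Complex.continuous_ofReal.comp
        (continuous_modulus.comp continuous_subtype_val)).continuousAt
    · exact Complex.ofReal_mem_slitPlane.2 (modulus_pos x.2)
  refine hcont.congr fun x => ?_
  rw [Set.domRestrict_apply, quasiChar_of_ne_zero χ z x.2]
  congr 3
  exact Units.ext (congrArg Subtype.val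
    ((unitsHomeomorphNeZero (G₀ := F)).apply_symm_apply x))

lemma rpow_le_rpow_sub_add_rpow_add {u σ τ ε : ℝ} (hu : 0 < u) (h : |τ - σ| ≤ ε) :
    u ^ τ ≤ u ^ (σ - ε) + u ^ (σ + ε) := by
  have hsub := Real.rpow_pos_of_pos hu (σ - ε)
  have hadd := Real.rpow_pos_of_pos hu (σ + ε)
  rw [abs_le] at h
  rcases le_total 1 u with h1 | h1
  · linarith [Real.rpow_le_rpow_of_exponent_le h1 (by linarith : τ ≤ σ + ε)]
  · linarith [Real.rpow_le_rpow_of_exponent_ge hu h1 (by linarith : σ - ε ≤ τ)]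

lemma norm_opA_mul_quasiChar_le {f : F → ℂ} {C ε : ℝ} (hC : ∀ x, ‖f x‖ * (1 + modulus x) ≤ C)
    (χ : Fˣ →ₜ* Circle) {w z : ℂ} (hw : ‖w - z‖ ≤ ε) {x : F} (hx : x ≠ 0) :
    ‖opA f x * quasiChar χ w x‖ ≤
      C * ((1 + |Real.log (modulus x)|) * modulus x ^ (z.re - ε) / (1 + modulus x) +
        (1 + |Real.log (modulus x)|) * modulus x ^ (z.re + ε) / (1 + modulus x)) := by
  have hp := modulus_pos hx
  have hC0 : 0 ≤ C := le_trans (by positivity) (hC x)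
  have hf : ‖f x‖ ≤ C / (1 + modulus x) := by
    rw [le_div_iff₀ (by positivity)]
    exact hC x
  have hrpow : modulus x ^ w.re ≤ modulus x ^ (z.re - ε) + modulus x ^ (z.re + ε) :=
    rpow_le_rpow_sub_add_rpow_add hp ((Complex.abs_re_le_norm (w - z)).trans hw)
  rw [norm_mul, norm_quasiChar χ w hx, opA, norm_mul, Complex.norm_real, Real.norm_eq_abs]
  calc |Real.log (modulus x)| * ‖f x‖ * modulus x ^ w.re
      ≤ (1 + |Real.log (modulus x)|) * (C / (1 + modulus x)) *
        (modulus x ^ (z.re - ε) + modulus x ^ (z.re + ε)) := by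
        gcongr
        linarith
    _ = _ := by ring

lemma measurable_quasiChar [MeasurableSpace F] [BorelSpace F] (χ : Fˣ →ₜ* Circle) (z : ℂ) :
    Measurable (quasiChar χ z : F → ℂ) := by
  refine measurable_of_measurable_on_compl_singleton 0 ?_
  exact (continuousOn_iff_continuous_domRestrict.1 (continuousOn_quasiChar χ z)).measurable

end QuasiCharacters

section Mellin

variable {F : Type} [NontriviallyNormedField F] [ProperSpace F] [MeasurableSpace F]

/-- Functions which are `O((1 + |log |x||) / (1 + |x|))` on all of `F`; their Mellin transforms
converge for `-1 < Re z < 0`. -/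
def MellinDecay (f : F → ℂ) : Prop :=
  Measurable f ∧ ∃ C : ℝ, ∀ x, ‖f x‖ * (1 + modulus x) ≤ C * (1 + |Real.log (modulus x)|)

/-- Functions which are `O(1 / (1 + |x|))` on all of `F`; unlike `MellinDecay`, this leaves room for
a factor `log |x|`. -/
def StrongMellinDecay (f : F → ℂ) : Prop :=
  Measurable f ∧ ∃ C : ℝ, ∀ x, ‖f x‖ * (1 + modulus x) ≤ C

lemma StrongMellinDecay.mellinDecay {f : F → ℂ} (hf : StrongMellinDecay f) : MellinDecay f := by
  obtain ⟨hm, C, hC⟩ := hf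
  refine ⟨hm, C, fun x => (hC x).trans ?_⟩
  have h0 : 0 ≤ C := le_trans (by have := modulus_nonneg x; positivity) (hC x)
  nlinarith [abs_nonneg (Real.log (modulus x))]

lemma MellinDecay.norm_le {f : F → ℂ} (hf : MellinDecay f) : ∃ C : ℝ, ∀ x,
    ‖f x‖ ≤ C * (1 + |Real.log (modulus x)|) / (1 + modulus x) := by
  obtain ⟨-, C, hC⟩ := hf
  refine ⟨C, fun x => ?_⟩
  rw [le_div_iff₀ (by have := modulus_nonneg x; positivity)]
  exact hC x

variable [BorelSpace F]
  {ψ : AddChar F Circle} {𝒮 : Set (F → ℂ)} {μ : Measure F} [μ.IsAddHaarMeasure]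

/-- The Mellin transform `∫ f(x) χ(x) |x|^z dx`, with the additive measure. -/
def mellinInt (μ : Measure F) (f : F → ℂ) (χ : Fˣ →ₜ* Circle) (z : ℂ) : ℂ :=
  ∫ x, f x * quasiChar χ z x ∂μ

lemma StrongMellinDecay.mellinDecay_opA {f : F → ℂ} (hf : StrongMellinDecay f) :
    MellinDecay (opA f) := by
  obtain ⟨hm, C, hC⟩ := hf
  refine ⟨(Complex.measurable_ofReal.comp measurable_log_modulus).mul hm, C, fun x => ?_⟩
  have h0 : 0 ≤ C := le_trans (by have := modulus_nonneg x; positivity) (hC x)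
  have h1 := abs_nonneg (Real.log (modulus x))
  rw [opA, norm_mul, Complex.norm_real, Real.norm_eq_abs, mul_assoc]
  have := mul_le_mul_of_nonneg_left (hC x) h1
  nlinarith

lemma IsSchwartzBruhatLike.strongMellinDecay (H : IsSchwartzBruhatLike ψ 𝒮) {φ : F → ℂ}
    (hφ : φ ∈ 𝒮) :
    StrongMellinDecay φ := by
  obtain ⟨C, hC⟩ := H.decay φ hφ
  refine ⟨H.measurable hφ, C, fun x => le_trans ?_ (hC x)⟩
  have h0 := modulus_nonneg x
  rw [sq, ← mul_assoc]
  exact le_mul_of_one_le_right (by positivity) (by linarith)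

lemma MellinDecay.integrable {f : F → ℂ} (hf : MellinDecay f) (χ : Fˣ →ₜ* Circle) {z : ℂ}
    (h0 : -1 < z.re) (h1 : z.re < 0) : Integrable (fun x => f x * quasiChar χ z x) μ := by
  obtain ⟨C, hC⟩ := hf.norm_le
  refine ((integrable_log_mul_modulus_rpow (μ := μ) (σ := -z.re) (by linarith)
    (by linarith)).const_mul C).mono' (hf.1.mul (measurable_quasiChar χ z)).aestronglyMeasurable ?_
  filter_upwards [ae_ne_zero μ] with x hx
  rw [norm_mul, norm_quasiChar χ z hx, neg_neg]
  have := Real.rpow_pos_of_pos (modulus_pos hx) z.re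
  calc _ ≤ C * (1 + |Real.log (modulus x)|) / (1 + modulus x) * modulus x ^ z.re := by
        gcongr; exact hC x
    _ = _ := by ring

lemma StrongMellinDecay.hasDerivAt {f : F → ℂ} (hf : StrongMellinDecay f) (χ : Fˣ →ₜ* Circle)
    {z : ℂ} (h0 : -1 < z.re) (h1 : z.re < 0) :
    HasDerivAt (mellinInt μ f χ) (mellinInt μ (opA f) χ z) z := by
  obtain ⟨C, hC⟩ := hf.2
  obtain ⟨ε, hε0, hε⟩ := exists_between (lt_min (by linarith : 0 < 1 + z.re) (neg_pos.2 h1))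
  obtain ⟨hε1, hε2⟩ := lt_min_iff.1 hε
  have hW : ∀ σ : ℝ, -1 < σ → σ < 0 → Integrable (fun x : F =>
      (1 + |Real.log (modulus x)|) * modulus x ^ σ / (1 + modulus x)) μ := fun σ hσ0 hσ1 => by
    simpa only [neg_neg] using
      integrable_log_mul_modulus_rpow (μ := μ) (neg_pos.2 hσ1) (neg_lt.1 hσ0)
  refine (hasDerivAt_integral_of_dominated_loc_of_deriv_le (Metric.ball_mem_nhds z hε0)
    (.of_forall fun w => (hf.1.mul (measurable_quasiChar χ w)).aestronglyMeasurable)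
    (hf.mellinDecay.integrable χ h0 h1)
    (F' := fun w x => opA f x * quasiChar χ w x)
    (hf.mellinDecay_opA.1.mul (measurable_quasiChar χ z)).aestronglyMeasurable ?_
    (((hW (z.re - ε) (by linarith) (by linarith)).add
      (hW (z.re + ε) (by linarith) (by linarith))).const_mul C) ?_).2
  · filter_upwards [ae_ne_zero μ] with x hx w hw
    exact norm_opA_mul_quasiChar_le hC χ (mem_ball_iff_norm.1 hw).le hx
  · filter_upwards [ae_ne_zero μ] with x hx w _
    refine ((hasDerivAt_quasiChar χ hx w).const_mul (f x)).congr_deriv ?_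
    rw [opA]
    ring

lemma integral_quasiChar_div_mul (G : F → ℂ) (χ : Fˣ →ₜ* Circle) (z : ℂ) {t : F} (ht : t ≠ 0) :
    ∫ x, quasiChar χ z (x / t) * G x ∂μ = quasiChar χ⁻¹ (-z) t * mellinInt μ G χ z := by
  rw [mellinInt, ← integral_const_mul]
  refine integral_congr_ae ?_
  filter_upwards [ae_ne_zero μ] with x hx
  rw [quasiChar_div χ z hx ht]
  ring

lemma mellinInt_mul_mellinInt {h G : F → ℂ} (hh : MellinDecay h) (hG : MellinDecay G)
    (χ : Fˣ →ₜ* Circle) {s : ℂ} (hs : s ∈ criticalStrip) :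
    mellinInt μ h χ⁻¹ (-s) * mellinInt μ G χ (s - 1) =
      ∫ x, quasiChar χ (s - 1) x * ∫ t, h t * G (t * x) ∂μ ∂μ := by
  have hre : (s - 1).re = s.re - 1 := by simp
  have hhi := hh.integrable (μ := μ) χ⁻¹ (z := -s) (by simpa using hs.2) (by simpa using hs.1)
  have hGi := hG.integrable (μ := μ) χ (z := s - 1) (by linarith [hs.1]) (by linarith [hs.2])
  rw [← integral_mul_integral_comp_div μ hh.1 hG.1 (measurable_quasiChar χ (s - 1))
    (a := fun t => modulus t ^ (1 - s.re)) (b := fun x => modulus x ^ (s.re - 1)), mellinInt,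
    ← integral_mul_const, integral_multHaar]
  · refine integral_congr_ae ?_
    filter_upwards [ae_ne_zero μ] with t ht
    rw [integral_quasiChar_div_mul G χ (s - 1) ht, show -s = -(s - 1) - 1 by ring,
      quasiChar_sub_one _ _ ht, Complex.real_smul]
    push_cast
    ring
  · intro t x ht hx
    rw [norm_quasiChar χ _ (div_ne_zero hx ht), modulus_div,
      Real.div_rpow (modulus_nonneg _) (modulus_nonneg _), hre,
      show (1 - s.re) = -(s.re - 1) by ring, Real.rpow_neg (modulus_nonneg _), div_eq_inv_mul]
  · rw [integrable_multHaar]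
    refine hhi.norm.congr ?_
    filter_upwards [ae_ne_zero μ] with t ht
    rw [norm_mul, norm_quasiChar _ _ ht, Complex.neg_re, smul_eq_mul, Real.rpow_sub
      (modulus_pos ht), Real.rpow_one, Real.rpow_neg (modulus_nonneg t)]
    have := modulus_ne_zero ht
    field_simp
  · refine hGi.norm.congr ?_
    filter_upwards [ae_ne_zero μ] with x hx
    rw [norm_mul, norm_quasiChar _ _ hx, hre]

lemma mellinInt_mul_mellinInt_comm {h₁ h₂ G₁ G₂ : F → ℂ} (hh₁ : MellinDecay h₁)
    (hh₂ : MellinDecay h₂) (hG₁ : MellinDecay G₁) (hG₂ : MellinDecay G₂)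
    (hrel : ∀ x, x ≠ 0 → ∫ t, h₂ t * G₁ (t * x) ∂μ = ∫ t, h₁ t * G₂ (t * x) ∂μ)
    (χ : Fˣ →ₜ* Circle) {s : ℂ} (hs : s ∈ criticalStrip) :
    mellinInt μ h₂ χ⁻¹ (-s) * mellinInt μ G₁ χ (s - 1) =
      mellinInt μ h₁ χ⁻¹ (-s) * mellinInt μ G₂ χ (s - 1) := by
  rw [mellinInt_mul_mellinInt hh₂ hG₁ χ hs, mellinInt_mul_mellinInt hh₁ hG₂ χ hs]
  refine integral_congr_ae ?_
  filter_upwards [ae_ne_zero μ] with x hx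
  rw [hrel x hx]

lemma IsSchwartzBruhatLike.mellinInt_mul_mellinInt_fourier (H : IsSchwartzBruhatLike ψ 𝒮)
    (hψ : Continuous ψ) {α β : F → ℂ} (hα : α ∈ 𝒮) (hβ : β ∈ 𝒮) (χ : Fˣ →ₜ* Circle) {s : ℂ}
    (hs : s ∈ criticalStrip) :
    mellinInt μ β χ⁻¹ (-s) * mellinInt μ (fourier ψ μ α) χ (s - 1) =
      mellinInt μ α χ⁻¹ (-s) * mellinInt μ (fourier ψ μ β) χ (s - 1) :=
  mellinInt_mul_mellinInt_comm (H.strongMellinDecay hα).mellinDecay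
    (H.strongMellinDecay hβ).mellinDecay
    (H.strongMellinDecay (H.fourier_mem μ _ hα)).mellinDecay
    (H.strongMellinDecay (H.fourier_mem μ _ hβ)).mellinDecay
    (fun _ hx => integral_mul_fourier_dilate hψ (H.integrable hα) (H.integrable hβ) hx) χ hs

lemma IsSchwartzBruhatLike.strongMellinDecay_opB (H : IsSchwartzBruhatLike ψ 𝒮) (hψ : Continuous ψ)
    (hψ1 : ψ ≠ 1) {α : F → ℂ} (hα : α ∈ puncturedTestFunctions 𝒮) :
    StrongMellinDecay (opB ψ μ α) := by
  have hint : Integrable (opA (fourierInv ψ μ α)) μ :=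
    integrable_log_fourier H (H.neg_mem (H.fourier_mem μ _ hα.1))
  exact ⟨(continuous_fourier hψ hint).measurable, opB_decay H hψ hψ1 hα⟩

lemma IsSchwartzBruhatLike.mellinInt_mul_mellinInt_opA_fourier (H : IsSchwartzBruhatLike ψ 𝒮)
    (hψ : Continuous ψ) (hψ1 : ψ ≠ 1) (hμ : IsSelfDualMeasure ψ μ 𝒮) {α β : F → ℂ}
    (hα : α ∈ puncturedTestFunctions 𝒮) (hβ : β ∈ 𝒮) (χ : Fˣ →ₜ* Circle) {s : ℂ}
    (hs : s ∈ criticalStrip) :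
    mellinInt μ β χ⁻¹ (-s) * mellinInt μ (opA (fourier ψ μ α)) χ (s - 1) =
      mellinInt μ (opB ψ μ α) χ⁻¹ (-s) * mellinInt μ (fourier ψ μ β) χ (s - 1) := by
  have hFα := H.fourier_mem μ _ hα.1
  have hFβ := H.fourier_mem μ _ hβ
  have hg : Integrable (opA (fourierInv ψ μ α)) μ := integrable_log_fourier H (H.neg_mem hFα)
  refine mellinInt_mul_mellinInt_comm (H.strongMellinDecay_opB hψ hψ1 hα).mellinDecay
    (H.strongMellinDecay hβ).mellinDecay (H.strongMellinDecay hFα).mellinDecay_opA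
    (H.strongMellinDecay hFβ).mellinDecay (fun x hx => ?_) χ hs
  have hparseval := integral_fourier_mul hψ hg (H.integrable (μ := μ) (H.dilate_mem x hx _ hFβ))
  simp only [fourier_comp_mul hx, hμ.2 _ hβ] at hparseval
  have hsubst := integral_comp_mul_left μ (neg_ne_zero.2 hx)
    (fun u => opA (fourierInv ψ μ α) u * β (-(u / x)))
  calc ∫ t, β t * opA (fourier ψ μ α) (t * x) ∂μ
      = ∫ t, opA (fourierInv ψ μ α) (-x * t) * β (-(-x * t / x)) ∂μ := by
        congr 1 with t
        have hcancel : -(-x * t / x) = t := by field_simp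
        rw [hcancel, opA, opA, fourierInv_apply, neg_mul, neg_neg, modulus_neg, mul_comm t x,
          mul_comm]
    _ = ∫ t, opB ψ μ α t * fourier ψ μ β (t * x) ∂μ := by
        rw [hsubst, modulus_neg, ← integral_smul]
        simp only [mul_comm _ x]
        refine Eq.trans ?_ hparseval.symm
        congr 1 with u
        rw [Complex.real_smul]
        push_cast
        ring

lemma half_integral_le_norm_integral_mul {α : Type*} [MeasurableSpace α] {μ : Measure α}
    {r : α → ℝ} {q : α → ℂ} (hr : Integrable r μ) (hr0 : ∀ x, 0 ≤ r x)
    (hq : AEStronglyMeasurable q μ) (hrq : ∀ x, r x ≠ 0 → ‖q x - 1‖ ≤ 1 / 2) :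
    Integrable (fun x => r x * q x) μ ∧ (∫ x, r x ∂μ) / 2 ≤ ‖∫ x, r x * q x ∂μ‖ ∧
      ∫ x, ‖r x * q x‖ ∂μ ≤ 2 * ∫ x, r x ∂μ := by
  have hsub : ∀ x, ‖r x * q x - r x‖ ≤ r x / 2 := by
    intro x
    rcases eq_or_ne (r x) 0 with hx | hx
    · simp [hx]
    · rw [← mul_sub_one, norm_mul, Complex.norm_real, Real.norm_of_nonneg (hr0 x)]
      nlinarith [hr0 x, hrq x hx]
  have hle : ∀ x, ‖r x * q x‖ ≤ 2 * r x := by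
    intro x
    have h := norm_le_insert' (r x * q x) (r x)
    rw [Complex.norm_real, Real.norm_of_nonneg (hr0 x)] at h
    linarith [hr0 x, hsub x]
  have hrc : Integrable (fun x => (r x : ℂ)) μ := hr.ofReal
  have hint : Integrable (fun x => r x * q x) μ :=
    (hr.const_mul 2).mono' (hrc.aestronglyMeasurable.mul hq) (.of_forall hle)
  refine ⟨hint, ?_, ?_⟩
  · have hdist : ‖∫ x, r x * q x ∂μ - ∫ x, (r x : ℂ) ∂μ‖ ≤ ∫ x, r x / 2 ∂μ := by
      rw [← integral_sub hint hrc]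
      exact norm_integral_le_of_norm_le (hr.div_const 2) (.of_forall hsub)
    have hnorm := norm_sub_norm_le (∫ x, (r x : ℂ) ∂μ) (∫ x, r x * q x ∂μ)
    rw [norm_sub_rev, integral_complex_ofReal, Complex.norm_real,
      Real.norm_of_nonneg (integral_nonneg hr0), ← integral_complex_ofReal] at hnorm
    rw [integral_div] at hdist
    linarith
  · rw [← integral_const_mul]
    exact integral_mono hint.norm (hr.const_mul 2) hle

lemma IsSchwartzBruhatLike.exists_bump_mellin (H : IsSchwartzBruhatLike ψ 𝒮) (χ : Fˣ →ₜ* Circle)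
    (z : ℂ) : ∃ r : F → ℝ, (fun x => (r x : ℂ)) ∈ puncturedTestFunctions 𝒮 ∧
      0 < ∫ x, r x ∂μ ∧ (∫ x, r x ∂μ) / 2 ≤ ‖mellinInt μ (fun x => (r x : ℂ)) χ z‖ ∧
      Integrable (fun x => (r x : ℂ) * quasiChar χ z x) μ ∧
      ∫ x, ‖(r x : ℂ) * quasiChar χ z x‖ ∂μ ≤ 2 * ∫ x, r x ∂μ := by
  have hcont : ContinuousAt (quasiChar χ z : F → ℂ) 1 :=
    (continuousOn_quasiChar χ z).continuousAt (isOpen_ne.mem_nhds one_ne_zero)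
  have hV : {x : F | ‖quasiChar χ z x - 1‖ < 1 / 2} ∈ 𝓝 (1 : F) := by
    have h := Metric.continuousAt_iff'.1 hcont (1 / 2) one_half_pos
    simp only [quasiChar_one, dist_eq_norm] at h
    exact h
  obtain ⟨r, hr, hr0, hrV, hpos, -⟩ := H.exists_bump_integral (μ := μ) hV
  have hir : Integrable r μ := by simpa using (H.integrable (μ := μ) hr.1).re
  obtain ⟨hint, hhalf, htwo⟩ := half_integral_le_norm_integral_mul hir hr0
    (measurable_quasiChar χ z).aestronglyMeasurable
    fun x hx => le_of_lt (not_imp_comm.1 (hrV x) hx)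
  exact ⟨r, hr, hpos, hhalf, hint, htwo⟩

end Mellin

section Gamma

variable {F : Type} [NontriviallyNormedField F] [ProperSpace F] [MeasurableSpace F] [BorelSpace F]
  {ψ : AddChar F Circle} {𝒮 : Set (F → ℂ)} {μ : Measure F} [μ.IsAddHaarMeasure]

lemma isOpen_criticalStrip : IsOpen criticalStrip :=
  (isOpen_lt continuous_const Complex.continuous_re).inter
    (isOpen_lt Complex.continuous_re continuous_const)

lemma StrongMellinDecay.hasDerivAt_mellinInt_sub_one {f : F → ℂ} (hf : StrongMellinDecay f)
    (χ : Fˣ →ₜ* Circle) {s : ℂ} (hs : s ∈ criticalStrip) :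
    HasDerivAt (fun s => mellinInt μ f χ (s - 1)) (mellinInt μ (opA f) χ (s - 1)) s := by
  have h := hf.hasDerivAt (μ := μ) χ (z := s - 1) (by simpa using hs.1) (by simpa using hs.2)
  exact h.comp_sub_const s 1

lemma StrongMellinDecay.hasDerivAt_mellinInt_neg {f : F → ℂ} (hf : StrongMellinDecay f)
    (χ : Fˣ →ₜ* Circle) {s : ℂ} (hs : s ∈ criticalStrip) :
    HasDerivAt (fun s => mellinInt μ f χ (-s)) (-mellinInt μ (opA f) χ (-s)) s := by
  have h := hf.hasDerivAt (μ := μ) χ (z := -s) (by simpa using hs.2) (by simpa using hs.1)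
  have hcomp := HasDerivAt.comp s h (hasDerivAt_neg s)
  rwa [mul_neg_one] at hcomp

namespace IsSchwartzBruhatLike

variable (H : IsSchwartzBruhatLike ψ 𝒮)

lemma exists_mellin_ne_zero (H : IsSchwartzBruhatLike ψ 𝒮) (μ : Measure F) [μ.IsAddHaarMeasure]
    (χ : Fˣ →ₜ* Circle) (z : ℂ) :
    ∃ β ∈ puncturedTestFunctions 𝒮, mellinInt μ β χ z ≠ 0 := by
  obtain ⟨r, hr, hpos, h, -⟩ := H.exists_bump_mellin (μ := μ) χ z
  exact ⟨_, hr, norm_pos_iff.1 (by linarith)⟩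

/-- The Gamma factor `Γ(χ, s)` of the local functional equation, as the ratio of the two sides of
that equation for a chosen test function whose Mellin transform does not vanish. -/
def gammaFactor (H : IsSchwartzBruhatLike ψ 𝒮) (μ : Measure F) [μ.IsAddHaarMeasure]
    (χ : Fˣ →ₜ* Circle) (s : ℂ) : ℂ :=
  mellinInt μ (fourier ψ μ (H.exists_mellin_ne_zero μ χ⁻¹ (-s)).choose) χ (s - 1) /
    mellinInt μ (H.exists_mellin_ne_zero μ χ⁻¹ (-s)).choose χ⁻¹ (-s)

lemma mellinInt_fourier_eq_gammaFactor_mul (hψ : Continuous ψ) {α : F → ℂ} (hα : α ∈ 𝒮)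
    (χ : Fˣ →ₜ* Circle) {s : ℂ} (hs : s ∈ criticalStrip) :
    mellinInt μ (fourier ψ μ α) χ (s - 1) = H.gammaFactor μ χ s * mellinInt μ α χ⁻¹ (-s) := by
  obtain ⟨hβ, hne⟩ := (H.exists_mellin_ne_zero μ χ⁻¹ (-s)).choose_spec
  rw [gammaFactor]
  field_simp
  linear_combination H.mellinInt_mul_mellinInt_fourier (μ := μ) hψ hα hβ.1 χ hs

lemma isTateGamma (hψ : Continuous ψ) (χ : Fˣ →ₜ* Circle) :
    IsTateGamma ψ μ 𝒮 χ (H.gammaFactor μ χ) := by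
  intro s hs α hα
  exact ⟨(H.strongMellinDecay (H.fourier_mem μ _ hα)).mellinDecay.integrable χ
      (by simpa using hs.1) (by simpa using hs.2),
    (H.strongMellinDecay hα).mellinDecay.integrable χ⁻¹ (by simpa using hs.2) (by simpa using hs.1),
    H.mellinInt_fourier_eq_gammaFactor_mul hψ hα χ hs⟩

lemma gammaFactor_ne_zero (hψ : Continuous ψ) (hμ : IsSelfDualMeasure ψ μ 𝒮) (χ : Fˣ →ₜ* Circle)
    {s : ℂ} (hs : s ∈ criticalStrip) : H.gammaFactor μ χ s ≠ 0 := by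
  obtain ⟨β, hβ, hne⟩ := H.exists_mellin_ne_zero μ χ (s - 1)
  have hinv : fourier ψ μ (fun x => fourier ψ μ β (-x)) = β :=
    funext fun y => hμ.fourier_fourier_neg hβ.1 y
  have heq := H.mellinInt_fourier_eq_gammaFactor_mul (μ := μ) hψ
    (H.neg_mem (H.fourier_mem μ _ hβ.1)) χ hs
  intro h0
  rw [hinv, h0, zero_mul] at heq
  exact hne heq

lemma differentiableOn_gammaFactor (hψ : Continuous ψ) (χ : Fˣ →ₜ* Circle) :
    DifferentiableOn ℂ (H.gammaFactor μ χ) criticalStrip := by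
  intro s hs
  obtain ⟨β, hβ, hne⟩ := H.exists_mellin_ne_zero μ χ⁻¹ (-s)
  have hnum := (H.strongMellinDecay (H.fourier_mem μ _ hβ.1)).hasDerivAt_mellinInt_sub_one
    (μ := μ) χ hs
  have hden := (H.strongMellinDecay hβ.1).hasDerivAt_mellinInt_neg (μ := μ) χ⁻¹ hs
  refine DifferentiableAt.differentiableWithinAt ?_
  refine (hnum.differentiableAt.div hden.differentiableAt hne).congr_of_eventuallyEq ?_
  filter_upwards [isOpen_criticalStrip.mem_nhds hs, hden.continuousAt.eventually_ne hne]
    with w hw hw2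
  rw [Pi.div_apply, H.mellinInt_fourier_eq_gammaFactor_mul hψ hβ.1 χ hw,
    mul_div_cancel_right₀ _ hw2]

-- The Mellin transform turns `A` into `d/ds`, so that differentiating the functional equation once
-- gives the Mellin transform of `(A + B)α`, and differentiating again that of `[B, A]α`.
lemma mellinInt_opB_add_mellinInt_opA (hψ : Continuous ψ) (hψ1 : ψ ≠ 1)
    (hμ : IsSelfDualMeasure ψ μ 𝒮) {α : F → ℂ} (hα : α ∈ puncturedTestFunctions 𝒮)
    (χ : Fˣ →ₜ* Circle) {s : ℂ} (hs : s ∈ criticalStrip) :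
    mellinInt μ (opB ψ μ α) χ⁻¹ (-s) + mellinInt μ (opA α) χ⁻¹ (-s) =
      logDeriv (H.gammaFactor μ χ) s * mellinInt μ α χ⁻¹ (-s) := by
  obtain ⟨β, hβ, hne⟩ := H.exists_mellin_ne_zero μ χ⁻¹ (-s)
  have := H.gammaFactor_ne_zero hψ hμ χ hs
  have hleft := (H.strongMellinDecay (H.fourier_mem μ _ hα.1)).hasDerivAt_mellinInt_sub_one
    (μ := μ) χ hs
  have hΓ' := ((H.differentiableOn_gammaFactor (μ := μ) hψ χ).differentiableAt
    (isOpen_criticalStrip.mem_nhds hs)).hasDerivAt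
  have hright := hΓ'.mul ((H.strongMellinDecay hα.1).hasDerivAt_mellinInt_neg (μ := μ) χ⁻¹ hs)
  have heq : (fun s => mellinInt μ (fourier ψ μ α) χ (s - 1)) =ᶠ[𝓝 s]
      (H.gammaFactor μ χ * fun s => mellinInt μ α χ⁻¹ (-s)) := by
    filter_upwards [isOpen_criticalStrip.mem_nhds hs] with w hw
    exact H.mellinInt_fourier_eq_gammaFactor_mul hψ hα.1 χ hw
  have hderiv := hleft.unique (hright.congr_of_eventuallyEq heq)
  have htate := H.mellinInt_mul_mellinInt_opA_fourier hψ hψ1 hμ hα hβ.1 χ hs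
  rw [H.mellinInt_fourier_eq_gammaFactor_mul hψ hβ.1 χ hs] at htate
  have hmellinA : mellinInt μ (opA (fourier ψ μ α)) χ (s - 1) =
      H.gammaFactor μ χ s * mellinInt μ (opB ψ μ α) χ⁻¹ (-s) := by
    refine mul_left_cancel₀ hne ?_
    linear_combination htate
  rw [hmellinA] at hderiv
  rw [logDeriv_apply]
  field_simp
  linear_combination hderiv

lemma mellinInt_opB_opA_sub_mellinInt_opA_opB (hψ : Continuous ψ) (hψ1 : ψ ≠ 1)
    (hμ : IsSelfDualMeasure ψ μ 𝒮) {α : F → ℂ} (hα : α ∈ puncturedTestFunctions 𝒮)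
    (χ : Fˣ →ₜ* Circle) {s : ℂ} (hs : s ∈ criticalStrip) :
    mellinInt μ (opB ψ μ (opA α)) χ⁻¹ (-s) - mellinInt μ (opA (opB ψ μ α)) χ⁻¹ (-s) =
      deriv (logDeriv (H.gammaFactor μ χ)) s * mellinInt μ α χ⁻¹ (-s) := by
  have hAα := opA_mem_punctured H hα
  have hΓd := H.differentiableOn_gammaFactor (μ := μ) hψ χ
  have hd : DifferentiableAt ℂ (logDeriv (H.gammaFactor μ χ)) s := by
    have hnhds := isOpen_criticalStrip.mem_nhds hs
    exact ((hΓd.deriv isOpen_criticalStrip).differentiableAt hnhds).div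
      (hΓd.differentiableAt hnhds) (H.gammaFactor_ne_zero (μ := μ) hψ hμ χ hs)
  have hleft :=
    ((H.strongMellinDecay_opB (μ := μ) hψ hψ1 hα).hasDerivAt_mellinInt_neg (μ := μ) χ⁻¹ hs).add
      ((H.strongMellinDecay hAα.1).hasDerivAt_mellinInt_neg (μ := μ) χ⁻¹ hs)
  have hright := hd.hasDerivAt.mul
    ((H.strongMellinDecay hα.1).hasDerivAt_mellinInt_neg (μ := μ) χ⁻¹ hs)
  have heq : ((fun s => mellinInt μ (opB ψ μ α) χ⁻¹ (-s)) +
      fun s => mellinInt μ (opA α) χ⁻¹ (-s)) =ᶠ[𝓝 s]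
      (logDeriv (H.gammaFactor μ χ) * fun s => mellinInt μ α χ⁻¹ (-s)) := by
    filter_upwards [isOpen_criticalStrip.mem_nhds hs] with w hw
    exact H.mellinInt_opB_add_mellinInt_opA hψ hψ1 hμ hα χ hw
  have hderiv := hleft.unique (hright.congr_of_eventuallyEq heq)
  have hconductor := H.mellinInt_opB_add_mellinInt_opA hψ hψ1 hμ hAα χ hs
  linear_combination hconductor + hderiv

lemma conj_logFunctional (f : F → ℂ) :
    conj (logFunctional ψ μ f) = logFunctional ψ μ fun x => conj (f x) := by
  rw [logFunctional, ← integral_conj, ← integral_neg_eq_self]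
  simp only [map_mul, Complex.conj_ofReal, conj_fourier, modulus_neg, neg_neg]
  rfl

lemma conj_opK (φ : F → ℂ) (x : F) : conj (opK ψ μ φ x) =
    -Complex.I * (opB ψ μ (opA fun x => conj (φ x)) x - opA (opB ψ μ fun x => conj (φ x)) x) := by
  simp only [opK, opA, opB_eq_logFunctional, map_mul, map_sub, Complex.conj_I, conj_logFunctional,
    Complex.conj_ofReal]

lemma integral_conj_opK_mul_quasiChar (hψ : Continuous ψ) (hψ1 : ψ ≠ 1)
    (hμ : IsSelfDualMeasure ψ μ 𝒮) {φ : F → ℂ} (hφ : φ ∈ puncturedTestFunctions 𝒮)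
    (χ : Fˣ →ₜ* Circle) {s : ℂ} (hs : s ∈ criticalStrip) :
    Integrable (fun x => conj (opK ψ μ φ x) * quasiChar χ⁻¹ (-s) x) μ ∧
      ∫ x, conj (opK ψ μ φ x) * quasiChar χ⁻¹ (-s) x ∂μ =
        spectralFunction (H.gammaFactor μ χ) s *
          ∫ x, conj (φ x) * quasiChar χ⁻¹ (-s) x ∂μ := by
  have hα := H.conj_mem_punctured hφ
  have hintBA := (H.strongMellinDecay_opB (μ := μ) hψ hψ1
    (opA_mem_punctured H hα)).mellinDecay.integrable (μ := μ) χ⁻¹ (z := -s) (by simpa using hs.2)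
    (by simpa using hs.1)
  have hintAB := (H.strongMellinDecay_opB (μ := μ) hψ hψ1 hα).mellinDecay_opA.integrable (μ := μ)
    χ⁻¹ (z := -s) (by simpa using hs.2) (by simpa using hs.1)
  have hconj : (fun x => conj (opK ψ μ φ x) * quasiChar χ⁻¹ (-s) x) = fun x => -Complex.I *
      (opB ψ μ (opA fun x => conj (φ x)) x * quasiChar χ⁻¹ (-s) x -
        opA (opB ψ μ fun x => conj (φ x)) x * quasiChar χ⁻¹ (-s) x) := by
    ext x; rw [conj_opK]; ring
  rw [hconj]
  refine ⟨(hintBA.sub hintAB).const_mul _, ?_⟩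
  rw [integral_const_mul, integral_sub hintBA hintAB, spectralFunction, mul_assoc]
  exact congrArg _ (H.mellinInt_opB_opA_sub_mellinInt_opA_opB hψ hψ1 hμ hα χ hs)

end IsSchwartzBruhatLike

end Gamma

section CriticalLine

variable {F : Type} [NontriviallyNormedField F] [ProperSpace F] [MeasurableSpace F] [BorelSpace F]
  {μ : Measure F} [μ.IsAddHaarMeasure]

lemma lintegral_enorm_dilation_mul_rpow {t : F} (ht : t ≠ 0) (φ : F → ℂ) :
    ∫⁻ x, ‖((Real.sqrt (modulus t))⁻¹ : ℂ) * φ (x / t)‖ₑ *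
        ENNReal.ofReal (modulus x ^ (-(1 / 2) : ℝ)) ∂μ =
      ∫⁻ x, ‖φ x‖ₑ * ENNReal.ofReal (modulus x ^ (-(1 / 2) : ℝ)) ∂μ := by
  have htp := modulus_pos ht
  have hsqrt : ‖((Real.sqrt (modulus t))⁻¹ : ℂ)‖ₑ =
      ENNReal.ofReal (modulus t ^ (-(1 / 2) : ℝ)) := by
    rw [← ofReal_norm, norm_inv, Complex.norm_real, Real.norm_of_nonneg (Real.sqrt_nonneg _),
      Real.sqrt_eq_rpow, Real.rpow_neg htp.le]
  have hweight : ∀ x : F, ENNReal.ofReal (modulus t ^ (-(1 / 2) : ℝ)) *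
      ENNReal.ofReal (modulus x ^ (-(1 / 2) : ℝ)) = ENNReal.ofReal (modulus t)⁻¹ *
      ENNReal.ofReal (modulus (t⁻¹ * x) ^ (-(1 / 2) : ℝ)) := by
    intro x
    rw [← ENNReal.ofReal_mul (by positivity), ← ENNReal.ofReal_mul (by positivity),
      modulus_mul, modulus_inv, Real.mul_rpow (by positivity) (modulus_nonneg x),
      Real.inv_rpow htp.le, ← mul_assoc, Real.rpow_neg htp.le, inv_inv,
      ← Real.rpow_neg_one (modulus t), ← Real.rpow_neg htp.le, ← Real.rpow_add htp]
    norm_num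
  calc ∫⁻ x, ‖((Real.sqrt (modulus t))⁻¹ : ℂ) * φ (x / t)‖ₑ *
        ENNReal.ofReal (modulus x ^ (-(1 / 2) : ℝ)) ∂μ
      = ∫⁻ x, ENNReal.ofReal (modulus t)⁻¹ *
          (‖φ (t⁻¹ * x)‖ₑ * ENNReal.ofReal (modulus (t⁻¹ * x) ^ (-(1 / 2) : ℝ))) ∂μ := by
        congr 1 with x
        rw [enorm_mul, hsqrt, div_eq_inv_mul x t, mul_right_comm, hweight, mul_assoc,
          mul_comm ‖φ (t⁻¹ * x)‖ₑ]
    _ = _ := by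
        rw [lintegral_const_mul' _ _ ENNReal.ofReal_ne_top,
          lintegral_comp_mul_left μ (inv_ne_zero ht)
            (fun x => ‖φ x‖ₑ * ENNReal.ofReal (modulus x ^ (-(1 / 2) : ℝ))),
          modulus_inv, inv_inv, ← mul_assoc, ← ENNReal.ofReal_mul (by positivity),
          inv_mul_cancel₀ htp.ne', ENNReal.ofReal_one, one_mul]

lemma measurable_mul_dilation_prod {κ φ : F → ℂ} (hκ : Measurable κ) (hφ : Measurable φ) :
    Measurable fun p : F × F =>
      κ p.2 * (((Real.sqrt (modulus p.2))⁻¹ : ℂ) * φ (p.1 / p.2)) :=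
  (hκ.comp measurable_snd).mul
    ((Complex.measurable_ofReal.comp (Real.continuous_sqrt.measurable.comp
      (measurable_modulus.comp measurable_snd))).inv.mul
        (hφ.comp (measurable_fst.div measurable_snd)))

lemma lintegral_enorm_multConvolution_mul_rpow_le {κ φ : F → ℂ} (hκ : Measurable κ)
    (hφ : Measurable φ) :
    ∫⁻ x, ‖multConvolution μ κ φ x‖ₑ * ENNReal.ofReal (modulus x ^ (-(1 / 2) : ℝ)) ∂μ ≤
      (∫⁻ t, ‖κ t‖ₑ ∂(multHaar μ)) *
        ∫⁻ x, ‖φ x‖ₑ * ENNReal.ofReal (modulus x ^ (-(1 / 2) : ℝ)) ∂μ := by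
  set Φ : F → F → ENNReal := fun x t => ‖κ t * (((Real.sqrt (modulus t))⁻¹ : ℂ) * φ (x / t))‖ₑ *
    ENNReal.ofReal (modulus x ^ (-(1 / 2) : ℝ)) with hΦ
  have hΦm : Measurable (Function.uncurry Φ) :=
    (measurable_mul_dilation_prod hκ hφ).enorm.mul
      ((measurable_modulus.comp measurable_fst).pow_const _).ennreal_ofReal
  calc ∫⁻ x, ‖multConvolution μ κ φ x‖ₑ * ENNReal.ofReal (modulus x ^ (-(1 / 2) : ℝ)) ∂μ
      ≤ ∫⁻ x, ∫⁻ t, Φ x t ∂(multHaar μ) ∂μ := by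
        refine lintegral_mono fun x => ?_
        rw [lintegral_mul_const' _ _ ENNReal.ofReal_ne_top]
        gcongr
        exact enorm_integral_le_lintegral_enorm _
    _ = ∫⁻ t, ∫⁻ x, Φ x t ∂μ ∂(multHaar μ) := lintegral_lintegral_swap hΦm.aemeasurable
    _ = ∫⁻ t, ‖κ t‖ₑ *
          ∫⁻ x, ‖φ x‖ₑ * ENNReal.ofReal (modulus x ^ (-(1 / 2) : ℝ)) ∂μ ∂(multHaar μ) := by
        refine lintegral_congr_ae ?_
        filter_upwards [multHaar_ae_ne_zero μ] with t ht
        simp only [hΦ, enorm_mul (κ t), mul_assoc ‖κ t‖ₑ]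
        rw [lintegral_const_mul' _ _ enorm_ne_top, lintegral_enorm_dilation_mul_rpow ht]
    _ = _ := lintegral_mul_const _ hκ.enorm

lemma integral_norm_multConvolution_mul_quasiChar_le {κ φ : F → ℂ} (hκ : Measurable κ)
    (hκi : Integrable κ (multHaar μ)) (hφ : Measurable φ) (χ : Fˣ →ₜ* Circle) {z : ℂ}
    (hz : z.re = -(1 / 2)) (hφi : Integrable (fun x => φ x * quasiChar χ z x) μ) :
    ∫ x, ‖multConvolution μ κ φ x * quasiChar χ z x‖ ∂μ ≤
      (∫ t, ‖κ t‖ ∂(multHaar μ)) * ∫ x, ‖φ x * quasiChar χ z x‖ ∂μ := by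
  have hnorm : ∀ f : F → ℂ, ∫⁻ x, ‖f x * quasiChar χ z x‖ₑ ∂μ =
      ∫⁻ x, ‖f x‖ₑ * ENNReal.ofReal (modulus x ^ (-(1 / 2) : ℝ)) ∂μ := by
    intro f
    refine lintegral_congr_ae ?_
    filter_upwards [ae_ne_zero μ] with x hx
    rw [enorm_mul, ← ofReal_norm (quasiChar χ z x), norm_quasiChar _ _ hx, hz]
  have hmeas : AEStronglyMeasurable (fun x => multConvolution μ κ φ x * quasiChar χ z x) μ :=
    ((measurable_mul_dilation_prod hκ hφ).stronglyMeasurable.integral_prod_right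
      (ν := multHaar μ)).aestronglyMeasurable.mul (measurable_quasiChar χ z).aestronglyMeasurable
  rw [integral_norm_eq_lintegral_enorm hmeas, integral_norm_eq_lintegral_enorm hκi.1,
    integral_norm_eq_lintegral_enorm hφi.1, ← ENNReal.toReal_mul, hnorm]
  refine ENNReal.toReal_mono (ENNReal.mul_ne_top hκi.2.ne hφi.2.ne) ?_
  rw [hnorm]
  exact lintegral_enorm_multConvolution_mul_rpow_le hκ hφ

end CriticalLine

section CommutatorKernel

variable {F : Type} [NontriviallyNormedField F] [ProperSpace F]

/-- The convolution kernel of the commutator `K = i[B, A]`, where `c` is the constant for which the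
distribution `ℱ log|·|` is `c · d×x` away from the origin. -/
def commutatorKernel (c : ℝ) (t : F) : ℂ := -Complex.I * c * logKernel t

lemma commutatorKernel_inv (c : ℝ) {t : F} (ht : t ≠ 0) :
    commutatorKernel c t⁻¹ = -commutatorKernel c t := by
  rw [commutatorKernel, commutatorKernel, logKernel_inv ht, Complex.ofReal_neg, mul_neg]

lemma conj_commutatorKernel_inv (c : ℝ) {t : F} (ht : t ≠ 0) :
    conj (commutatorKernel c t⁻¹) = commutatorKernel c t := by
  rw [commutatorKernel_inv c ht]
  simp [commutatorKernel]

variable [MeasurableSpace F] [BorelSpace F]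

lemma measurable_commutatorKernel (c : ℝ) : Measurable (commutatorKernel c : F → ℂ) :=
  (Complex.measurable_ofReal.comp measurable_logKernel).const_mul _

variable {ψ : AddChar F Circle} {𝒮 : Set (F → ℂ)} {μ : Measure F} [μ.IsAddHaarMeasure]

lemma integrable_commutatorKernel (H : IsSchwartzBruhatLike ψ 𝒮) (c : ℝ) :
    Integrable (commutatorKernel c) (multHaar μ) :=
  ((integrable_logKernel H).ofReal).const_mul _

lemma opK_eq_multConvolution (H : IsSchwartzBruhatLike ψ 𝒮) (hψ : Continuous ψ) {c : ℝ}
    (hc : ∀ φ ∈ 𝒮, φ 0 = 0 → logFunctional ψ μ φ = c * ∫ x, φ x ∂(multHaar μ))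
    {φ : F → ℂ} (hφ : φ ∈ puncturedTestFunctions 𝒮) {x : F} (hx : x ≠ 0) :
    opK ψ μ φ x = multConvolution μ (commutatorKernel c) φ x :=
  opK_eq_integral H hψ hc hφ hx

lemma multConvolution_congr_ae (κ : F → ℂ) {f g : F → ℂ} (hfg : f =ᵐ[μ] g) {x : F} (hx : x ≠ 0) :
    multConvolution μ κ f x = multConvolution μ κ g x := by
  refine integral_congr_ae ?_
  have hfg' : f =ᵐ[multHaar μ] g := (multHaar_absolutelyContinuous μ).ae_le hfg
  filter_upwards [(measurePreserving_const_div μ hx).quasiMeasurePreserving.tendsto_ae.eventually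
    hfg'] with t ht
  rw [ht]

lemma IsSchwartzBruhatLike.exists_isConvolution_opK (H : IsSchwartzBruhatLike ψ 𝒮)
    (hψ : Continuous ψ) (hψ1 : ψ ≠ 1) :
    ∃ (c : ℝ) (K : Lp ℂ 2 μ →L[ℂ] Lp ℂ 2 μ), IsConvolution μ (commutatorKernel c) K ∧
      ∀ (f : Lp ℂ 2 μ), ∀ φ ∈ puncturedTestFunctions 𝒮, f =ᵐ[μ] φ → K f =ᵐ[μ] opK ψ μ φ := by
  obtain ⟨c, hc⟩ := exists_logFunctional (μ := μ) H hψ hψ1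
  have hκ : Integrable (commutatorKernel c) (multHaar μ) := integrable_commutatorKernel H c
  obtain ⟨K, hK⟩ := exists_isConvolution hκ
  refine ⟨c, K, hK, fun f φ hφ hf => (hK.ae_eq hκ (measurable_commutatorKernel c) f).trans ?_⟩
  filter_upwards [ae_ne_zero μ] with x hx
  rw [opK_eq_multConvolution H hψ hc hφ hx, multConvolution_congr_ae _ hf hx]

lemma IsSchwartzBruhatLike.exists_norm_spectralFunction_le (H : IsSchwartzBruhatLike ψ 𝒮)
    (hψ : Continuous ψ) (hψ1 : ψ ≠ 1) (hμ : IsSelfDualMeasure ψ μ 𝒮) :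
    ∃ C : ℝ, ∀ χ, ∀ s : ℂ, s.re = 1 / 2 → ‖spectralFunction (H.gammaFactor μ χ) s‖ ≤ C := by
  obtain ⟨c, hc⟩ := exists_logFunctional (μ := μ) H hψ hψ1
  set N := ∫ t : F, ‖commutatorKernel c t‖ ∂(multHaar μ)
  have : 0 ≤ N := integral_nonneg fun t => norm_nonneg _
  refine ⟨4 * N, fun χ s hs => ?_⟩
  have hstrip : s ∈ criticalStrip := by
    constructor <;> rw [hs] <;> norm_num
  obtain ⟨r, hr, hpos, hlow, hri, hup⟩ := H.exists_bump_mellin (μ := μ) χ⁻¹ (-s)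
  have hspec := congrArg norm (H.integral_conj_opK_mul_quasiChar hψ hψ1 hμ hr χ hstrip).2
  simp only [norm_mul, Complex.conj_ofReal] at hspec
  have hle : ‖∫ x, conj (opK ψ μ (fun x => (r x : ℂ)) x) * quasiChar χ⁻¹ (-s) x ∂μ‖ ≤
      N * ∫ x, ‖(r x : ℂ) * quasiChar χ⁻¹ (-s) x‖ ∂μ := by
    refine (norm_integral_le_integral_norm _).trans (le_trans (le_of_eq ?_)
      (integral_norm_multConvolution_mul_quasiChar_le (measurable_commutatorKernel c)
        (integrable_commutatorKernel H c) (H.measurable hr.1) χ⁻¹ (by simp [hs]) hri))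
    refine integral_congr_ae ?_
    filter_upwards [ae_ne_zero μ] with x hx
    rw [norm_mul, norm_mul, RCLike.norm_conj, opK_eq_multConvolution H hψ hc hr hx]
  change _ = _ * ‖mellinInt μ (fun x => (r x : ℂ)) χ⁻¹ (-s)‖ at hspec
  set Γs := ‖spectralFunction (H.gammaFactor μ χ) s‖
  have hbound : Γs * ((∫ x, r x ∂μ) / 2) ≤ N * (2 * ∫ x, r x ∂μ) :=
    calc Γs * ((∫ x, r x ∂μ) / 2)
        ≤ Γs * ‖mellinInt μ (fun x => (r x : ℂ)) χ⁻¹ (-s)‖ := by gcongr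
      _ ≤ N * ∫ x, ‖(r x : ℂ) * quasiChar χ⁻¹ (-s) x‖ ∂μ := hspec ▸ hle
      _ ≤ N * (2 * ∫ x, r x ∂μ) := by gcongr
  nlinarith

end CommutatorKernel

section SmallSubgroups

lemma three_halves_pow_mul_norm_circle_sub_one_le {z : Circle}
    (hz : ∀ n : ℕ, ‖((z ^ 2 ^ n : Circle) : ℂ) - 1‖ ≤ 1 / 2) (n : ℕ) :
    (3 / 2 : ℝ) ^ n * ‖(z : ℂ) - 1‖ ≤ ‖((z ^ 2 ^ n : Circle) : ℂ) - 1‖ := by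
  induction n with
  | zero => simp
  | succ n ih =>
    set w : ℂ := ((z ^ 2 ^ n : Circle) : ℂ) with hw
    have hfactor : ((z ^ 2 ^ (n + 1) : Circle) : ℂ) - 1 = (w + 1) * (w - 1) := by
      rw [hw, pow_succ, pow_mul, Circle.coe_pow _ 2]; ring
    have hlarge : 3 / 2 ≤ ‖w + 1‖ := by
      have htri := norm_sub_norm_le (2 : ℂ) (1 - w)
      rw [show (2 : ℂ) - (1 - w) = w + 1 by ring, norm_sub_rev, Complex.norm_ofNat] at htri
      linarith [hz n]
    rw [hfactor, norm_mul, pow_succ']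
    calc 3 / 2 * (3 / 2 : ℝ) ^ n * ‖(z : ℂ) - 1‖
        = 3 / 2 * ((3 / 2 : ℝ) ^ n * ‖(z : ℂ) - 1‖) := mul_assoc _ _ _
      _ ≤ ‖w + 1‖ * ‖w - 1‖ := by gcongr

lemma circle_eq_one_of_norm_pow_two_pow_sub_one_le {z : Circle}
    (hz : ∀ n : ℕ, ‖((z ^ 2 ^ n : Circle) : ℂ) - 1‖ ≤ 1 / 2) : z = 1 := by
  by_contra hne
  have hpos : 0 < ‖(z : ℂ) - 1‖ := by
    rw [norm_pos_iff, sub_ne_zero]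
    exact fun h => hne (Circle.ext h)
  obtain ⟨n, hn⟩ := pow_unbounded_of_one_lt (1 / 2 / ‖(z : ℂ) - 1‖) (by norm_num : (1 : ℝ) < 3 / 2)
  rw [div_lt_iff₀ hpos] at hn
  linarith [three_halves_pow_mul_norm_circle_sub_one_le hz n, hz n]

lemma exists_addChar_eq_one_of_norm_lt {E : Type*} [SeminormedAddCommGroup E]
    [IsUltrametricDist E] {ψ : AddChar E Circle} (hψ : Continuous ψ) :
    ∃ δ > 0, ∀ x : E, ‖x‖ < δ → ψ x = 1 := by
  have hcont : Continuous fun x => (ψ x : ℂ) := by fun_prop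
  obtain ⟨δ, hδ, hsmall⟩ :=
    Metric.continuousAt_iff.1 (hcont.continuousAt (x := (0 : E))) (1 / 2) one_half_pos
  refine ⟨δ, hδ, fun x hx => circle_eq_one_of_norm_pow_two_pow_sub_one_le fun n => ?_⟩
  have hmul : ‖(2 ^ n : ℕ) • x‖ < δ := (IsUltrametricDist.norm_nsmul_le x _).trans_lt hx
  have hdist := hsmall (dist_zero_right ((2 ^ n : ℕ) • x) ▸ hmul)
  rw [AddChar.map_zero_eq_one, AddChar.map_nsmul_eq_pow, dist_eq_norm, Circle.coe_one] at hdist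
  exact hdist.le

end SmallSubgroups

section LocallyConstant

lemma exists_forall_norm_lt_add_eq {E α : Type*} [SeminormedAddCommGroup E] [Zero α] {φ : E → α}
    (hφ : IsLocallyConstant φ) (hc : HasCompactSupport φ) :
    ∃ δ > 0, ∀ x a : E, ‖a‖ < δ → φ (x + a) = φ x := by
  obtain ⟨δ, hδ, hcov⟩ := lebesgue_number_lemma_of_metric (s := tsupport φ)
    (c := fun c : α => φ ⁻¹' {c}) hc (fun c => hφ.isOpen_fiber c) (fun x _ => by simp)
  have heq : ∀ x ∈ tsupport φ, ∀ y, ‖y - x‖ < δ → φ y = φ x := by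
    intro x hx y hy
    obtain ⟨c, hsub⟩ := hcov x hx
    have hxc : φ x = c := hsub (Metric.mem_ball_self hδ)
    have hyc : φ y = c := hsub (by rwa [Metric.mem_ball, dist_eq_norm])
    rw [hxc, hyc]
  refine ⟨δ, hδ, fun x a ha => ?_⟩
  by_cases hx : x ∈ tsupport φ
  · exact heq x hx _ (by simpa using ha)
  by_cases hxa : x + a ∈ tsupport φ
  · exact (heq _ hxa x (by simpa using ha)).symm
  · rw [image_eq_zero_of_notMem_tsupport hx, image_eq_zero_of_notMem_tsupport hxa]

lemma isClopen_thickening {X : Type*} [PseudoMetricSpace X] [IsUltrametricDist X] (s : Set X)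
    (r : ℝ) : IsClopen (Metric.thickening r s) := by
  rcases le_or_gt r 0 with hr | hr
  · rw [Metric.thickening_of_nonpos hr]
    exact isClopen_empty
  refine IsClopen.of_thickening_subset_self hr fun z hz => ?_
  obtain ⟨y, hy, hzy⟩ := Metric.mem_thickening_iff.1 hz
  obtain ⟨p, hp, hyp⟩ := Metric.mem_thickening_iff.1 hy
  exact Metric.mem_thickening_iff.2
    ⟨p, hp, (dist_triangle_max z y p).trans_lt (max_lt hzy hyp)⟩

/-- The space of Schwartz-Bruhat functions on a non-archimedean local field: the locally constant
functions with compact support. -/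
def locallyConstantSpace (F : Type) [TopologicalSpace F] : Set (F → ℂ) :=
  {φ | IsLocallyConstant φ ∧ HasCompactSupport φ}

lemma indicator_mem_puncturedTestFunctions {F : Type} [NontriviallyNormedField F] [ProperSpace F]
    {s : Set F} (hs : IsClopen s) (hb : Bornology.IsBounded s) (h0 : (0 : F) ∉ s) :
    s.indicator 1 ∈ puncturedTestFunctions (locallyConstantSpace F) := by
  have hc : HasCompactSupport (s.indicator (1 : F → ℂ)) :=
    HasCompactSupport.of_support_subset_isCompact
      (Metric.isCompact_of_isClosed_isBounded hs.isClosed hb) Set.support_indicator_subset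
  refine ⟨⟨(LocallyConstant.charFn ℂ hs).isLocallyConstant, hc⟩, hc, ?_⟩
  filter_upwards [hs.compl.isOpen.mem_nhds h0] with y hy
  exact Set.indicator_of_notMem hy _

end LocallyConstant

section NonarchimedeanFourier

variable {F : Type} [NontriviallyNormedField F] [MeasurableSpace F] {ψ : AddChar F Circle}

lemma isLocallyConstant_fourier [IsUltrametricDist F] (hψ : Continuous ψ) (μ : Measure F)
    {φ : F → ℂ} (hc : HasCompactSupport φ) : IsLocallyConstant (fourier ψ μ φ) := by
  rw [IsLocallyConstant.iff_eventually_eq]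
  intro y
  obtain ⟨δ, hδ, hψδ⟩ := exists_addChar_eq_one_of_norm_lt hψ
  obtain ⟨R, hR⟩ := hc.isBounded.exists_norm_le
  have hR1 : 0 < max R 1 := lt_max_of_lt_right one_pos
  filter_upwards [Metric.ball_mem_nhds y (div_pos hδ hR1)] with z hz
  rw [Metric.mem_ball, dist_eq_norm, lt_div_iff₀ hR1] at hz
  rw [fourier_apply, fourier_apply]
  congr 1 with x
  by_cases hx : x ∈ tsupport φ
  · have hsmall : ‖-(x * (z - y))‖ < δ := by
      rw [norm_neg, norm_mul, mul_comm]
      exact (mul_le_mul_of_nonneg_left ((hR x hx).trans (le_max_left _ _))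
        (norm_nonneg _)).trans_lt hz
    have hsplit : -(x * z) = -(x * y) + -(x * (z - y)) := by ring
    rw [hsplit, AddChar.map_add_eq_mul, hψδ _ hsmall, mul_one]
  · rw [image_eq_zero_of_notMem_tsupport hx, mul_zero, mul_zero]

variable [BorelSpace F]

-- A translation `a` with `ψ (a * y) ≠ 1` that leaves `φ` invariant forces `fourier ψ μ φ y = 0`.
lemma hasCompactSupport_fourier [ProperSpace F] (hψ1 : ψ ≠ 1) (μ : Measure F)
    [μ.IsAddHaarMeasure] {φ : F → ℂ} (hφ : IsLocallyConstant φ) (hc : HasCompactSupport φ) :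
    HasCompactSupport (fourier ψ μ φ) := by
  obtain ⟨δ, hδ, hinv⟩ := exists_forall_norm_lt_add_eq hφ hc
  obtain ⟨x₀, hx₀⟩ := AddChar.ne_one_iff.1 hψ1
  refine HasCompactSupport.of_support_subset_isCompact
    (isCompact_closedBall (0 : F) (‖x₀‖ / δ)) fun y hy => ?_
  rw [mem_closedBall_zero_iff]
  by_contra! hlt
  have hy0 : 0 < ‖y‖ := (by positivity : 0 ≤ ‖x₀‖ / δ).trans_lt hlt
  have ha : ‖x₀ / y‖ < δ := by
    rw [norm_div]
    exact (div_lt_comm₀ hδ hy0).1 hlt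
  have htranslate := fourier_comp_add (ψ := ψ) (μ := μ) (x₀ / y) φ y
  rw [funext fun x => hinv x _ ha, div_mul_cancel₀ _ (norm_pos_iff.1 hy0)] at htranslate
  exact hx₀ (Circle.ext ((right_eq_mul₀ hy).1 htranslate))

lemma fourier_mem_locallyConstantSpace [IsUltrametricDist F] [ProperSpace F] (hψ : Continuous ψ)
    (hψ1 : ψ ≠ 1) (μ : Measure F) [μ.IsAddHaarMeasure] {φ : F → ℂ}
    (hφ : φ ∈ locallyConstantSpace F) : fourier ψ μ φ ∈ locallyConstantSpace F :=
  ⟨isLocallyConstant_fourier hψ μ hφ.2, hasCompactSupport_fourier hψ1 μ hφ.1 hφ.2⟩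

end NonarchimedeanFourier

section NonarchimedeanDensity

variable {F : Type} [NontriviallyNormedField F] [MeasurableSpace F] [BorelSpace F]
  {μ : Measure F} {f : F → ℂ}

lemma tendsto_setIntegral_diff_ball [NullSingletonClass μ] {s : Set F} (hs : MeasurableSet s)
    (hf : IntegrableOn f s μ) :
    Filter.Tendsto (fun n : ℕ => ∫ x in s \ Metric.ball 0 (1 / ((n : ℝ) + 1)), f x ∂μ)
      Filter.atTop (𝓝 (∫ x in s, f x ∂μ)) := by
  have hball (x : F) : (∃ n : ℕ, x ∉ Metric.ball 0 (1 / ((n : ℝ) + 1))) ↔ x ≠ 0 := by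
    simp only [mem_ball_zero_iff, not_lt]
    refine ⟨?_, fun hx => (exists_nat_one_div_lt (norm_pos_iff.2 hx)).imp fun n => le_of_lt⟩
    rintro ⟨n, hn⟩
    exact norm_pos_iff.1 (Nat.one_div_pos_of_nat.trans_le hn)
  have hunion : ⋃ n : ℕ, s \ Metric.ball 0 (1 / ((n : ℝ) + 1)) = s \ {0} := by
    ext x
    simp only [Set.mem_iUnion, Set.mem_sdiff, exists_and_left, hball, Set.mem_singleton_iff]
  have hlim := tendsto_setIntegral_of_monotone (f := f) (μ := μ)
    (s := fun n : ℕ => s \ Metric.ball 0 (1 / ((n : ℝ) + 1)))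
    (fun n => hs.diff measurableSet_ball)
    (fun m n hmn => Set.sdiff_subset_sdiff_right (Metric.ball_subset_ball
      (Nat.one_div_le_one_div hmn)))
    (hunion ▸ hf.mono_set Set.sdiff_subset)
  rwa [hunion, setIntegral_congr_set (sdiff_null_ae_eq_self (measure_singleton 0))] at hlim

lemma tendsto_setIntegral_thickening [ProperSpace F] {s : Set F} (hs : IsCompact s)
    (hf : LocallyIntegrable f μ) :
    Filter.Tendsto (fun n : ℕ => ∫ x in Metric.thickening (1 / ((n : ℝ) + 1)) s, f x ∂μ)
      Filter.atTop (𝓝 (∫ x in s, f x ∂μ)) := by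
  have hinter : ⋂ n : ℕ, Metric.thickening (1 / ((n : ℝ) + 1)) s = s := by
    have h := Metric.closure_eq_iInter_thickening' s (Set.range fun n : ℕ => 1 / ((n : ℝ) + 1))
      (Set.range_subset_iff.2 fun n => Set.mem_Ioi.2 Nat.one_div_pos_of_nat) fun ε hε => by
        obtain ⟨n, hn⟩ := exists_nat_one_div_lt hε
        exact ⟨_, ⟨n, rfl⟩, Nat.one_div_pos_of_nat, hn.le⟩
    rwa [hs.isClosed.closure_eq, Set.biInter_range, eq_comm] at h
  have hlim := tendsto_setIntegral_of_antitone (f := f) (μ := μ)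
    (s := fun n : ℕ => Metric.thickening (1 / ((n : ℝ) + 1)) s)
    (fun n => Metric.isOpen_thickening.measurableSet)
    (fun m n hmn => Metric.thickening_mono (Nat.one_div_le_one_div hmn) s)
    ⟨0, (hf.integrableOn_isCompact hs.cthickening).mono_set
      (Metric.thickening_subset_cthickening _ s)⟩
  rwa [hinter] at hlim

lemma ae_eq_zero_of_integral_locallyConstant_eq_zero [IsUltrametricDist F] [ProperSpace F]
    [NullSingletonClass μ] (hf : LocallyIntegrable f μ)
    (h : ∀ φ ∈ puncturedTestFunctions (locallyConstantSpace F), ∫ x, φ x * f x ∂μ = 0) :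
    f =ᵐ[μ] 0 := by
  have hclopen {t : Set F} (ht : IsClopen t) (hb : Bornology.IsBounded t) (h0 : (0 : F) ∉ t) :
      ∫ x in t, f x ∂μ = 0 := by
    rw [← integral_indicator ht.isOpen.measurableSet,
      ← h _ (indicator_mem_puncturedTestFunctions ht hb h0)]
    simp only [← Set.indicator_mul_left, Pi.one_apply, one_mul]
  have hthick (s : Set F) (hs : IsCompact s) (r : ℝ) :
      ∫ x in Metric.thickening r s, f x ∂μ = 0 := by
    have hint : IntegrableOn f (Metric.thickening r s) μ :=
      (hf.integrableOn_isCompact hs.cthickening).mono_set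
        (Metric.thickening_subset_cthickening r s)
    have hzero (n : ℕ) :
        ∫ x in Metric.thickening r s \ Metric.ball 0 (1 / ((n : ℝ) + 1)), f x ∂μ = 0 :=
      hclopen ((isClopen_thickening s r).diff (IsUltrametricDist.isClopen_ball 0 _))
        (hs.isBounded.thickening.subset Set.sdiff_subset) fun h0 =>
          h0.2 (Metric.mem_ball_self Nat.one_div_pos_of_nat)
    exact tendsto_nhds_unique
      (tendsto_setIntegral_diff_ball Metric.isOpen_thickening.measurableSet hint)
      (tendsto_const_nhds.congr fun n => (hzero n).symm)
  refine ae_eq_zero_of_forall_setIntegral_isCompact_eq_zero' hf fun s hs => ?_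
  exact tendsto_nhds_unique (tendsto_setIntegral_thickening hs hf)
    (tendsto_const_nhds.congr fun n => (hthick s hs _).symm)

end NonarchimedeanDensity

section NonarchimedeanSchwartzBruhat

variable {F : Type} [NontriviallyNormedField F] [ProperSpace F]

lemma exists_norm_mul_one_add_modulus_sq_le {φ : F → ℂ} (hφ : Continuous φ)
    (hc : HasCompactSupport φ) : ∃ C : ℝ, ∀ x, ‖φ x‖ * (1 + modulus x) ^ 2 ≤ C := by
  have hcont : Continuous fun x => ‖φ x‖ * (1 + modulus x) ^ 2 := by
    have := continuous_modulus (F := F)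
    fun_prop
  obtain ⟨C, hC⟩ := hcont.bddAbove_range_of_hasCompactSupport hc.norm.mul_right
  exact ⟨C, fun x => hC (Set.mem_range_self x)⟩

lemma exists_norm_sub_le_mul_modulus_rpow_half {φ : F → ℂ} (hφ : IsLocallyConstant φ)
    (hc : HasCompactSupport φ) : ∃ C : ℝ, ∀ x, ‖φ x - φ 0‖ ≤ C * modulus x ^ (1 / 2 : ℝ) := by
  obtain ⟨C, hC⟩ := hc.exists_bound_of_continuous hφ.continuous
  obtain ⟨δ, hδ, hinv⟩ := exists_forall_norm_lt_add_eq hφ hc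
  obtain ⟨t, ht0, ht⟩ := NormedField.exists_norm_lt F hδ
  have hC0 : 0 ≤ C := (norm_nonneg _).trans (hC 0)
  have hm := Real.rpow_pos_of_pos (modulus_pos (norm_pos_iff.1 ht0)) (1 / 2 : ℝ)
  refine ⟨2 * C / modulus t ^ (1 / 2 : ℝ), fun x => ?_⟩
  rcases lt_or_ge ‖x‖ δ with hx | hx
  · have hx0 := hinv 0 x hx
    rw [zero_add] at hx0
    rw [hx0, sub_self, norm_zero]
    have := Real.rpow_nonneg (modulus_nonneg x) (1 / 2 : ℝ)
    positivity
  · have htx : modulus t ^ (1 / 2 : ℝ) ≤ modulus x ^ (1 / 2 : ℝ) :=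
      Real.rpow_le_rpow (modulus_nonneg _) (modulus_le_of_norm_le (ht.le.trans hx))
        one_half_pos.le
    calc ‖φ x - φ 0‖ ≤ ‖φ x‖ + ‖φ 0‖ := norm_sub_le _ _
      _ ≤ 2 * C := by linarith [hC x, hC 0]
      _ = 2 * C / modulus t ^ (1 / 2 : ℝ) * modulus t ^ (1 / 2 : ℝ) := by field_simp
      _ ≤ 2 * C / modulus t ^ (1 / 2 : ℝ) * modulus x ^ (1 / 2 : ℝ) := by gcongr

variable [IsUltrametricDist F]

lemma modulus_eq_of_norm_sub_lt {x y : F} (h : ‖y - x‖ < ‖x‖) : modulus y = modulus x := by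
  have hnorm : ‖y‖ = ‖x‖ := by
    have := IsUltrametricDist.norm_add_eq_max_of_norm_ne_norm h.ne
    rwa [sub_add_cancel, max_eq_right h.le] at this
  exact le_antisymm (modulus_le_of_norm_le hnorm.le) (modulus_le_of_norm_le hnorm.ge)

lemma opA_mem_locallyConstantSpace {φ : F → ℂ}
    (hφ : φ ∈ puncturedTestFunctions (locallyConstantSpace F)) :
    opA φ ∈ locallyConstantSpace F := by
  refine ⟨?_, hφ.2.1.mul_left⟩
  rw [IsLocallyConstant.iff_eventually_eq]
  intro x
  rcases eq_or_ne x 0 with rfl | hx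
  · filter_upwards [hφ.2.2] with y hy
    simp [opA, hy]
  · filter_upwards [(IsLocallyConstant.iff_eventually_eq _).1 hφ.1.1 x,
      Metric.ball_mem_nhds x (norm_pos_iff.2 hx)] with y hy hb
    rw [Metric.mem_ball, dist_eq_norm] at hb
    rw [opA, opA, hy, modulus_eq_of_norm_sub_lt hb]

lemma exists_bump_locallyConstantSpace {V : Set F} (hV : V ∈ 𝓝 (1 : F)) :
    ∃ r : F → ℝ, (fun x => (r x : ℂ)) ∈ puncturedTestFunctions (locallyConstantSpace F) ∧
      (∀ x, 0 ≤ r x) ∧ r 1 ≠ 0 ∧ ∀ x, x ∉ V → r x = 0 := by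
  obtain ⟨ε, hε, hb⟩ := Metric.mem_nhds_iff.1 hV
  refine ⟨(Metric.ball 1 (min ε 1)).indicator 1, ?_,
    Set.indicator_nonneg fun _ _ => zero_le_one, ?_, fun x hx => ?_⟩
  · convert indicator_mem_puncturedTestFunctions (IsUltrametricDist.isClopen_ball (1 : F) (min ε 1))
      Metric.isBounded_ball (by simp) using 2 with x
    by_cases hx : x ∈ Metric.ball (1 : F) (min ε 1) <;> simp only [hx, Set.indicator_of_mem,
      Set.indicator_of_notMem, not_false_eq_true, Pi.one_apply, Complex.ofReal_one,
      Complex.ofReal_zero]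
  · rw [Set.indicator_of_mem (Metric.mem_ball_self (lt_min hε one_pos))]
    exact one_ne_zero
  · exact Set.indicator_of_notMem
      (fun h => hx (hb (Metric.ball_subset_ball (min_le_left _ _) h))) _

theorem isSchwartzBruhatLike_locallyConstantSpace [MeasurableSpace F] [BorelSpace F]
    {ψ : AddChar F Circle} (hψ : Continuous ψ) (hψ1 : ψ ≠ 1) :
    IsSchwartzBruhatLike ψ (locallyConstantSpace F) where
  add_mem _ hφ _ hη := ⟨hφ.1.add hη.1, hφ.2.add hη.2⟩
  smul_mem c _ hφ := ⟨hφ.1.comp (c * ·), hφ.2.mul_left⟩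
  translate_mem a _ hφ := ⟨hφ.1.comp_continuous (continuous_add_const a),
    hφ.2.comp_homeomorph (Homeomorph.addRight a)⟩
  dilate_mem t ht _ hφ := ⟨hφ.1.comp_continuous (continuous_const_mul t),
    hφ.2.comp_homeomorph (Homeomorph.mulLeft₀ t ht)⟩
  conj_mem _ hφ := ⟨hφ.1.comp conj, hφ.2.comp_left (map_zero _)⟩
  continuous _ hφ := hφ.1.continuous
  decay _ hφ := exists_norm_mul_one_add_modulus_sq_le hφ.1.continuous hφ.2
  holder _ hφ := exists_norm_sub_le_mul_modulus_rpow_half hφ.1 hφ.2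
  fourier_mem μ _ _ hφ := fourier_mem_locallyConstantSpace hψ hψ1 μ hφ
  opA_mem _ hφ := opA_mem_locallyConstantSpace hφ
  bump _ hV := exists_bump_locallyConstantSpace hV
  ae_eq_zero _ _ _ hf h :=
    ae_eq_zero_of_integral_locallyConstant_eq_zero (hf.locallyIntegrable one_le_two) h

end NonarchimedeanSchwartzBruhat

section LinearLift

lemma exists_continuousLinearMap_eq_circle_exp {V : Type*} [NormedAddCommGroup V]
    [NormedSpace ℝ V] {ψ : AddChar V Circle} (hψ : Continuous ψ) :
    ∃ ℓ : V →L[ℝ] ℝ, ∀ x, ψ x = Circle.exp (ℓ x) := by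
  obtain ⟨L, ⟨-, hL⟩, huniq⟩ := Circle.isCoveringMap_exp.existsUnique_continuousMap_lifts
    (⟨ψ, hψ⟩ : C(V, Circle)) 0 0 (by simp)
  have hexp (x : V) : Circle.exp (L x) = ψ x := congrFun hL x
  have hadd (x y : V) : L (x + y) = L x + L y := by
    have hshift := huniq ⟨fun z => L (z + y) - L y, by fun_prop⟩
      ⟨by simp, by
        ext1 z
        simp only [Function.comp_apply, ContinuousMap.coe_mk]
        rw [Circle.exp_sub, hexp, hexp, AddChar.map_add_eq_mul, mul_div_cancel_right]⟩
    exact sub_eq_iff_eq_add.1 (DFunLike.congr_fun hshift x)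
  exact ⟨(AddMonoidHom.mk' L hadd).toRealLinearMap L.continuous, fun x => (hexp x).symm⟩

end LinearLift

section Archimedean

variable {𝕜 : Type} [RCLike 𝕜]

lemma modulus_eq_norm_pow (x : 𝕜) : modulus x = ‖x‖ ^ Module.finrank ℝ 𝕜 := by
  borelize 𝕜
  let μ : Measure 𝕜 := Measure.addHaar
  have hball := modulus_mul_measure_closedBall μ x
  rw [Measure.addHaar_closedBall' μ _ (norm_nonneg x)] at hball
  have hpos : μ (Metric.closedBall 0 1) ≠ 0 := (Metric.measure_closedBall_pos μ 0 one_pos).ne'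
  have hfin : μ (Metric.closedBall 0 1) ≠ ⊤ := (isCompact_closedBall _ _).measure_lt_top.ne
  exact (ENNReal.ofReal_eq_ofReal_iff (modulus_nonneg x) (by positivity)).1
    ((ENNReal.mul_left_inj hpos hfin).1 hball)

lemma min_one_norm_le_modulus_rpow_half (x : 𝕜) : min 1 ‖x‖ ≤ modulus x ^ (1 / 2 : ℝ) := by
  have hdim : ((Module.finrank ℝ 𝕜 : ℝ) / 2) ≤ 1 := by
    have : (Module.finrank ℝ 𝕜 : ℝ) ≤ 2 := by exact_mod_cast RCLike.finrank_le_two 𝕜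
    linarith
  have hmod : modulus x ^ (1 / 2 : ℝ) = ‖x‖ ^ ((Module.finrank ℝ 𝕜 : ℝ) / 2) := by
    rw [modulus_eq_norm_pow, ← Real.rpow_natCast, ← Real.rpow_mul (norm_nonneg x), mul_one_div]
  rw [hmod]
  rcases le_total ‖x‖ 1 with hx | hx
  · exact (min_le_right _ _).trans
      (Real.self_le_rpow_of_le_one (norm_nonneg x) hx hdim)
  · exact (min_le_left _ _).trans (Real.one_le_rpow hx (by positivity))

lemma contDiffAt_log_modulus {x : 𝕜} (hx : x ≠ 0) :
    ContDiffAt ℝ (⊤ : ℕ∞) (fun y : 𝕜 => (Real.log (modulus y) : ℂ)) x := by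
  simp only [modulus_eq_norm_pow]
  exact Complex.ofRealCLM.contDiff.contDiffAt.comp x
    (((contDiffAt_norm ℝ hx).pow _).log (pow_ne_zero _ (norm_ne_zero_iff.2 hx)))

lemma norm_schwartz_sub_le {E G : Type*} [NormedAddCommGroup E] [NormedSpace ℝ E]
    [NormedAddCommGroup G] [NormedSpace ℝ G] (f : 𝓢(E, G)) (x y : E) :
    ‖f y - f x‖ ≤ SchwartzMap.seminorm ℝ 0 1 f * ‖y - x‖ := by
  refine convex_univ.norm_image_sub_le_of_norm_fderiv_le (𝕜 := ℝ)
    (fun z _ => f.differentiable.differentiableAt) (fun z _ => ?_) trivial trivial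
  rw [← norm_iteratedFDeriv_one]
  exact SchwartzMap.norm_iteratedFDeriv_le_seminorm ℝ f 1 z

lemma exists_norm_schwartz_sub_le_mul_modulus_rpow_half (f : 𝓢(𝕜, ℂ)) :
    ∃ C : ℝ, ∀ x, ‖f x - f 0‖ ≤ C * modulus x ^ (1 / 2 : ℝ) := by
  set A := SchwartzMap.seminorm ℝ 0 0 f
  set D := SchwartzMap.seminorm ℝ 0 1 f
  have hD : 0 ≤ D := apply_nonneg _ _
  refine ⟨max D (2 * A), fun x => ?_⟩
  calc ‖f x - f 0‖ ≤ max D (2 * A) * min 1 ‖x‖ := by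
        rw [mul_min_of_nonneg _ _ (le_max_of_le_left hD), mul_one]
        refine le_min (le_max_of_le_right ?_) ?_
        · linarith [norm_sub_le (f x) (f 0), SchwartzMap.norm_le_seminorm ℝ f x,
            SchwartzMap.norm_le_seminorm ℝ f 0]
        · have hlip := norm_schwartz_sub_le f 0 x
          rw [sub_zero] at hlip
          exact hlip.trans (by gcongr; exact le_max_left _ _)
    _ ≤ max D (2 * A) * modulus x ^ (1 / 2 : ℝ) := by
        have := min_one_norm_le_modulus_rpow_half x
        gcongr

lemma exists_norm_schwartz_mul_one_add_modulus_sq_le (f : 𝓢(𝕜, ℂ)) :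
    ∃ C : ℝ, ∀ x, ‖f x‖ * (1 + modulus x) ^ 2 ≤ C := by
  set d := Module.finrank ℝ 𝕜
  refine ⟨2 * SchwartzMap.seminorm ℝ 0 0 f + 2 * SchwartzMap.seminorm ℝ (d * 2) 0 f, fun x => ?_⟩
  have hbound := SchwartzMap.norm_le_seminorm ℝ f x
  have hdecay := SchwartzMap.norm_pow_mul_le_seminorm ℝ f (d * 2) x
  rw [pow_mul, ← modulus_eq_norm_pow] at hdecay
  nlinarith [mul_nonneg (norm_nonneg (f x)) (sq_nonneg (1 - modulus x))]

variable (𝕜) in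
/-- The space of Schwartz-Bruhat functions on `ℝ` or `ℂ`: the Schwartz functions. -/
def schwartzSpace : Set (𝕜 → ℂ) := {φ | ∃ f : 𝓢(𝕜, ℂ), φ = f}

lemma mem_schwartzSpace_of_hasCompactSupport {φ : 𝕜 → ℂ} (hc : HasCompactSupport φ)
    (hφ : ContDiff ℝ (⊤ : ℕ∞) φ) : φ ∈ schwartzSpace 𝕜 :=
  ⟨hc.toSchwartzMap hφ, rfl⟩

lemma ofReal_mem_puncturedTestFunctions {g : 𝕜 → ℝ} (hc : HasCompactSupport g)
    (hg : ContDiff ℝ (⊤ : ℕ∞) g) (h0 : (0 : 𝕜) ∉ tsupport g) :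
    (fun x => (g x : ℂ)) ∈ puncturedTestFunctions (schwartzSpace 𝕜) := by
  have hc' : HasCompactSupport fun x => (g x : ℂ) := hc.comp_left Complex.ofReal_zero
  refine ⟨mem_schwartzSpace_of_hasCompactSupport hc' (Complex.ofRealCLM.contDiff.comp hg), hc', ?_⟩
  filter_upwards [(isClosed_tsupport g).isOpen_compl.mem_nhds h0] with x hx
  rw [image_eq_zero_of_notMem_tsupport hx, Complex.ofReal_zero]

lemma opA_mem_schwartzSpace {φ : 𝕜 → ℂ} (hφ : φ ∈ puncturedTestFunctions (schwartzSpace 𝕜)) :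
    opA φ ∈ schwartzSpace 𝕜 := by
  obtain ⟨⟨f, rfl⟩, hc, h0⟩ := hφ
  refine mem_schwartzSpace_of_hasCompactSupport hc.mul_left (contDiff_iff_contDiffAt.2 fun x => ?_)
  rcases eq_or_ne x 0 with rfl | hx
  · refine (contDiffAt_const (c := (0 : ℂ))).congr_of_eventuallyEq ?_
    filter_upwards [h0] with y hy
    simp [opA, hy]
  · exact (contDiffAt_log_modulus hx).mul (f.contDiffAt ⊤)

lemma exists_bump_schwartzSpace {V : Set 𝕜} (hV : V ∈ 𝓝 (1 : 𝕜)) :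
    ∃ r : 𝕜 → ℝ, (fun x => (r x : ℂ)) ∈ puncturedTestFunctions (schwartzSpace 𝕜) ∧
      (∀ x, 0 ≤ r x) ∧ r 1 ≠ 0 ∧ ∀ x, x ∉ V → r x = 0 := by
  obtain ⟨ε, hε, hb⟩ := Metric.mem_nhds_iff.1 hV
  have hr : 0 < min ε 1 / 2 := half_pos (lt_min hε one_pos)
  let g : ContDiffBump (1 : 𝕜) := ⟨min ε 1 / 2 / 2, min ε 1 / 2, half_pos hr, half_lt_self hr⟩
  refine ⟨g, ofReal_mem_puncturedTestFunctions g.hasCompactSupport g.contDiff ?_,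
    fun x => g.nonneg, ?_, fun x hx => ?_⟩
  · rw [g.tsupport_eq, Metric.mem_closedBall, dist_zero_left, norm_one]
    change ¬ (1 ≤ min ε 1 / 2)
    linarith [min_le_right ε 1]
  · rw [g.one_of_mem_closedBall (Metric.mem_closedBall_self g.rIn_pos.le)]
    exact one_ne_zero
  · refine g.zero_of_le_dist (not_lt.1 fun h => hx (hb (Metric.mem_ball.2 (h.trans_le ?_))))
    change min ε 1 / 2 ≤ ε
    linarith [min_le_left ε 1]

lemma exists_continuousLinearEquiv_eq_fourierChar_inner {ψ : AddChar 𝕜 Circle}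
    (hψ : Continuous ψ) (hψ1 : ψ ≠ 1) :
    ∃ e : 𝕜 ≃L[ℝ] 𝕜, ∀ x y, ψ (x * y) = Real.fourierChar (inner ℝ x (e y)) := by
  obtain ⟨ℓ, hℓ⟩ := exists_continuousLinearMap_eq_circle_exp hψ
  let L : 𝕜 →ₗ[ℝ] 𝕜 :=
    { toFun := fun y => (2 * Real.pi)⁻¹ • (InnerProductSpace.toDual ℝ 𝕜).symm
        (ℓ.comp (ContinuousLinearMap.mul ℝ 𝕜 y))
      map_add' := fun y z => by simp [ContinuousLinearMap.comp_add]
      map_smul' := fun c y => by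
        rw [map_smul, ContinuousLinearMap.comp_smul, map_smulₛₗ, conj_trivial, RingHom.id_apply,
          smul_comm] }
  have hL (x y : 𝕜) : ψ (x * y) = Real.fourierChar (inner ℝ x (L y)) := by
    have hinner : inner ℝ x (L y) = (2 * Real.pi)⁻¹ * ℓ (y * x) := by
      rw [real_inner_comm]
      simp [L, inner_smul_left]
    rw [hinner, Real.fourierChar_apply', mul_inv_cancel_left₀ Real.two_pi_pos.ne', mul_comm y x, hℓ]
  have hinj : Function.Injective L := by
    rw [injective_iff_map_eq_zero]
    intro y hy
    by_contra hy0
    refine hψ1 (DFunLike.ext _ _ fun x => ?_)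
    rw [← div_mul_cancel₀ x hy0, hL, hy, inner_zero_right, AddChar.map_zero_eq_one,
      AddChar.one_apply]
  exact ⟨(LinearEquiv.ofInjectiveEndo L hinj).toContinuousLinearEquiv, hL⟩

variable [MeasurableSpace 𝕜] [BorelSpace 𝕜] {ψ : AddChar 𝕜 Circle}

lemma fourier_mem_schwartzSpace (hψ : Continuous ψ) (hψ1 : ψ ≠ 1) (μ : Measure 𝕜)
    [μ.IsAddHaarMeasure] (f : 𝓢(𝕜, ℂ)) : fourier ψ μ f ∈ schwartzSpace 𝕜 := by
  obtain ⟨e, he⟩ := exists_continuousLinearEquiv_eq_fourierChar_inner hψ hψ1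
  refine ⟨(Measure.addHaarScalarFactor μ volume : ℂ) •
    SchwartzMap.compCLMOfContinuousLinearEquiv ℂ e (FourierTransform.fourier f), ?_⟩
  ext y
  have hvol : fourier ψ volume f y = FourierTransform.fourier (f : 𝕜 → ℂ) (e y) := by
    rw [fourier_apply, Real.fourier_eq]
    simp only [AddChar.map_neg_eq_inv, he, Circle.smul_def, smul_eq_mul]
  conv_lhs => rw [Measure.isAddLeftInvariant_eq_smul μ volume]
  rw [fourier_smul_measure, hvol]
  rfl

theorem isSchwartzBruhatLike_schwartzSpace (hψ : Continuous ψ) (hψ1 : ψ ≠ 1) :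
    IsSchwartzBruhatLike ψ (schwartzSpace 𝕜) where
  add_mem := by
    rintro _ ⟨f, rfl⟩ _ ⟨g, rfl⟩
    exact ⟨f + g, rfl⟩
  smul_mem := by
    rintro c _ ⟨f, rfl⟩
    exact ⟨c • f, rfl⟩
  translate_mem := by
    rintro a _ ⟨f, rfl⟩
    exact ⟨SchwartzMap.compSubConstCLM ℝ (-a) f, funext fun x => by simp⟩
  dilate_mem := by
    rintro t ht _ ⟨f, rfl⟩
    exact ⟨SchwartzMap.compCLMOfContinuousLinearEquiv ℝ
      (LinearEquiv.ofInjectiveEndo (LinearMap.mulLeft ℝ t)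
        (mul_right_injective₀ ht)).toContinuousLinearEquiv f, rfl⟩
  conj_mem := by
    rintro _ ⟨f, rfl⟩
    exact ⟨f.postcompCLM (Complex.conjCLE : ℂ →L[ℝ] ℂ), rfl⟩
  continuous := by
    rintro _ ⟨f, rfl⟩
    exact f.continuous
  decay := by
    rintro _ ⟨f, rfl⟩
    exact exists_norm_schwartz_mul_one_add_modulus_sq_le f
  holder := by
    rintro _ ⟨f, rfl⟩
    exact exists_norm_schwartz_sub_le_mul_modulus_rpow_half f
  fourier_mem := by
    rintro μ _ _ ⟨f, rfl⟩
    exact fourier_mem_schwartzSpace hψ hψ1 μ f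
  opA_mem _ hφ := opA_mem_schwartzSpace hφ
  bump _ hV := exists_bump_schwartzSpace hV
  ae_eq_zero μ _ f hf h := by
    have haway := isOpen_compl_singleton.ae_eq_zero_of_integral_contDiff_smul_eq_zero (μ := μ)
      (f := f) (U := {(0 : 𝕜)}ᶜ) ((hf.locallyIntegrable one_le_two).locallyIntegrableOn _)
      fun g hg hc hsupp => by
        simpa only [Complex.real_smul] using
          h _ (ofReal_mem_puncturedTestFunctions hc hg fun h0 => hsupp h0 rfl)
    filter_upwards [haway, ae_ne_zero μ] with x hx hx0 using hx hx0

end Archimedean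

section LocalFields

variable {F : Type} [Field F] [TopologicalSpace F] {𝒮 : Set (F → ℂ)}

theorem IsSchwartzBruhatSpace.exists_nontriviallyNormedField (h𝒮 : IsSchwartzBruhatSpace F 𝒮) :
    ∃ i : NontriviallyNormedField F, i.toField = ‹Field F› ∧
      i.toNormedField.toMetricSpace.toUniformSpace.toTopologicalSpace = ‹TopologicalSpace F› ∧
      ProperSpace F := by
  cases h𝒮 with
  | nonarchimedean =>
    exact ⟨‹_›, rfl, rfl, ProperSpace.of_nontriviallyNormedField_of_weaklyLocallyCompactSpace F⟩
  | real => exact ⟨inferInstance, rfl, rfl, inferInstance⟩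
  | complex => exact ⟨inferInstance, rfl, rfl, inferInstance⟩

theorem IsSchwartzBruhatSpace.isSchwartzBruhatLike [IsTopologicalRing F] [LocallyCompactSpace F]
    [MeasurableSpace F] [BorelSpace F] (h𝒮 : IsSchwartzBruhatSpace F 𝒮) {ψ : AddChar F Circle}
    (hψ : Continuous ψ) (hψ1 : ψ ≠ 1) : IsSchwartzBruhatLike ψ 𝒮 := by
  cases h𝒮 with
  | nonarchimedean =>
    have : ProperSpace F := ProperSpace.of_nontriviallyNormedField_of_weaklyLocallyCompactSpace F
    exact isSchwartzBruhatLike_locallyConstantSpace hψ hψ1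
  | real => exact isSchwartzBruhatLike_schwartzSpace hψ hψ1
  | complex => exact isSchwartzBruhatLike_schwartzSpace hψ hψ1

end LocalFields

end CommutatorOperator

end

open CommutatorOperator in
theorem theoremE3
    (F : Type) [Field F] [TopologicalSpace F] [IsTopologicalRing F] [LocallyCompactSpace F]
    [MeasurableSpace F] [BorelSpace F]
    (𝒮 : Set (F → ℂ)) (h𝒮 : IsSchwartzBruhatSpace F 𝒮)
    (ψ : AddChar F Circle) (hψ : Continuous ψ) (hψ1 : ψ ≠ 1) :
    -- the self-dual measure exists and is unique
    (∃! μ : Measure F, IsSelfDualMeasure ψ μ 𝒮) ∧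
    ∀ μ : Measure F, IsSelfDualMeasure ψ μ 𝒮 →
      -- the integrals that define `K` on its initial domain converge
      (∀ φ ∈ 𝒮, Integrable (fourierInv ψ μ φ) μ ∧ Integrable (opA (fourierInv ψ μ φ)) μ) ∧
      (∀ φ ∈ puncturedTestFunctions 𝒮, opA φ ∈ puncturedTestFunctions 𝒮) ∧
      ∃ T : Lp ℂ 2 μ →ₗ.[ℂ] Lp ℂ 2 μ, IsCommutatorOperator ψ μ 𝒮 T ∧
        -- `K` is essentially self-adjoint
        IsEssentiallySelfAdjoint T ∧
        -- `K` is bounded: its closure is a bounded operator defined everywhere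
        ∃ Kb : Lp ℂ 2 μ →L[ℂ] Lp ℂ 2 μ,
          T.closure = (Kb : Lp ℂ 2 μ →ₗ[ℂ] Lp ℂ 2 μ).toPMap ⊤ ∧
          -- `K` commutes with the unitary dilations
          (∀ t : Fˣ, ∃ U : Lp ℂ 2 μ ≃ₗᵢ[ℂ] Lp ℂ 2 μ,
            (∀ f : Lp ℂ 2 μ, U f =ᵐ[μ] dilation t f) ∧
            ∀ f, Kb (U f) = U (Kb f)) ∧
          -- `K` anticommutes with the Fourier transform of `L²`
          (∃ 𝓕 : Lp ℂ 2 μ ≃ₗᵢ[ℂ] Lp ℂ 2 μ,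
            (∀ φ ∈ 𝒮, ∀ f : Lp ℂ 2 μ, f =ᵐ[μ] φ → 𝓕 f =ᵐ[μ] fourier ψ μ φ) ∧
            ∀ f, Kb (𝓕 f) = -𝓕 (Kb f)) ∧
          -- `K` anticommutes with the inversion
          (∃ I : Lp ℂ 2 μ ≃ₗᵢ[ℂ] Lp ℂ 2 μ,
            (∀ f : Lp ℂ 2 μ, I f =ᵐ[μ] inversion f) ∧
            ∀ f, Kb (I f) = -I (Kb f)) ∧
          -- the spectral function of `K` is `-i ∂²/∂s² log Γ(χ, s)`: tested against the initial
          -- domain, `χ⁻¹(x)|x|^{-s}` is a generalized eigenvector with this eigenvalue;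
          -- and the spectral function is bounded on the critical line
          ∃ Γ : (Fˣ →ₜ* Circle) → ℂ → ℂ,
            (∀ χ, IsTateGamma ψ μ 𝒮 χ (Γ χ) ∧ DifferentiableOn ℂ (Γ χ) criticalStrip ∧
              ∀ s ∈ criticalStrip, Γ χ s ≠ 0) ∧
            (∀ χ, ∀ s ∈ criticalStrip, ∀ φ ∈ puncturedTestFunctions 𝒮,
              Integrable (fun x => conj (opK ψ μ φ x) * quasiChar χ⁻¹ (-s) x) μ ∧
              ∫ x, conj (opK ψ μ φ x) * quasiChar χ⁻¹ (-s) x ∂μ =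
                spectralFunction (Γ χ) s * ∫ x, conj (φ x) * quasiChar χ⁻¹ (-s) x ∂μ) ∧
            ∃ C : ℝ, ∀ χ, ∀ s : ℂ, s.re = 1 / 2 → ‖spectralFunction (Γ χ) s‖ ≤ C := by
  have H := h𝒮.isSchwartzBruhatLike hψ hψ1
  obtain ⟨_, rfl, rfl, _⟩ := h𝒮.exists_nontriviallyNormedField
  refine ⟨H.existsUnique_isSelfDualMeasure hψ hψ1, fun μ hμ => ?_⟩
  have := hμ.1
  obtain ⟨c, K, hK, hK_opK⟩ := H.exists_isConvolution_opK (μ := μ) hψ hψ1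
  have hodd (t : F) (ht : t ≠ 0) : commutatorKernel c t⁻¹ = -commutatorKernel c t :=
    commutatorKernel_inv c ht
  have hadjoint := hK.adjoint_eq fun t ht => conj_commutatorKernel_inv c ht
  have hdense := H.dense_initialDomain (μ := μ)
  refine ⟨fun φ hφ => ?_, fun φ hφ => opA_mem_punctured H hφ,
    (K : Lp ℂ 2 μ →ₗ[ℂ] Lp ℂ 2 μ).toPMap (H.initialDomain μ),
    ⟨fun f => Iff.rfl, fun f φ hφ hf => hK_opK f φ hφ hf⟩,
    isEssentiallySelfAdjoint_toPMap K hadjoint hdense, K, (closure_toPMap_of_dense K hdense).2,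
    fun t => ⟨dilationL2 μ t, dilationL2_ae_eq μ t,
      hK.commute _ fun s f => dilationL2_comm μ s t f⟩,
    ⟨H.fourierL2 hψ hμ, fun φ hφ f hf => H.fourierL2_ae_eq hψ hμ hφ hf,
      hK.anticommute hodd _ (H.dilationL2_fourierL2 hψ hμ)⟩,
    ⟨inversionL2 μ, inversionL2_ae_eq μ, hK.anticommute hodd _ (dilationL2_inversionL2 μ)⟩,
    H.gammaFactor μ, fun χ => ⟨H.isTateGamma hψ χ, H.differentiableOn_gammaFactor hψ χ,
      fun s hs => H.gammaFactor_ne_zero hψ hμ χ hs⟩,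
    fun χ s hs φ hφ => H.integral_conj_opK_mul_quasiChar hψ hψ1 hμ hφ χ hs,
    H.exists_norm_spectralFunction_le hψ hψ1 hμ⟩
  have hφ' := H.neg_mem (H.fourier_mem μ _ hφ)
  exact ⟨H.integrable hφ', integrable_log_fourier H hφ'⟩
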